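/- **Setting.** Let $(R,\mathfrak m)$ be a reduced local ring essentially of finite type over $\mathbb C$, let $\mathfrak a\subseteq R$ be an ideal containing an element that lies in no minimal prime of $R$ (written $\mathfrak a\cap R^\circ\neq\emptyset$), and let $t>0$ be a real number. **Sharp $F$-singularities.** For a ring $T$ of prime characteristic $p$ and $e\in\mathbb N$, let $F^e_*T$ be $T$ regarded as a $T$-module through the $e$-th iterate of Frobenius, and for $f\in T$ let $\cdot F^e_*f: T\to F^e_*T$ be the $T$-linear map $x\mapsto F^e_*(x^{p^e}f)$. For an ideal $\mathfrak c$ of a Noetherian local ring $(T,\mathfrak n)$ of characteristic $p$, the pair $(T,\mathfrak c^t)$ is *sharply $F$-pure* if for infinitely many $e\in\mathbb N$ there is $f\in\mathfrak c^{\lceil t(p^e-1)\rceil}$ such that $\cdot F^e_*f$ is pure (i.e. stays injective after tensoring with any $T$-module); it is *sharply $F$-injective* if for every $i$ and every nonzero $\eta\in H^i_{\mathfrak n}(T)$, for infinitely many $e\in\mathbb N$ there is $f\in\mathfrak c^{\lceil t(p^e-1)\rceil}$ such that the image of $\eta$ under the induced map $H^i_{\mathfrak n}(T)\to H^i_{\mathfrak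 n}(F^e_*T)$ is nonzero. **Dense type.** $(R,\mathfrak a^t)$ is of *dense sharply $F$-pure* (resp. *dense sharply $F$-injective*) *type* if one can write $(R,\mathfrak a)\cong(S_{\mathfrak p},\mathfrak bS_{\mathfrak p})$ with $S$ a finitely generated $\mathbb C$-algebra, $\mathfrak p\subset S$ prime, $\mathfrak b\subseteq S$ an ideal with $\mathfrak b\cap S^\circ\ne\emptyset$, and there are a finitely generated $\mathbb Z$-subalgebra $A\subset\mathbb C$, a finitely generated $A$-algebra $S_A$ with $\mathbb C\otimes_AS_A\cong S$, ideals $\mathfrak b_A,\mathfrak p_A\subseteq S_A$ with $\mathfrak b_AS=\mathfrak b$, $\mathfrak p_AS=\mathfrak p$, and a set $D$ of maximal ideals of $A$, dense in $\operatorname{Spec}A$, such that for every $\mu\in D$, with $S_\mu=(A/\mu)\otimes_AS_A$, the ideal $\mathfrak p_\mu=\mathfrak p_AS_\mu$ is prime and $\big((S_\mu)_{\mathfrak p_\mu},(\mathfrak b_A(S_\mu)_{\mathfrak p_\mu})^t\big)$ is sharply $F$-pure (resp. sharply $F$-injective). **Approximations.** Let $\mathcal P$ be the set of primes, $\mathcal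 F$ a non-principal ultrafilter on $\mathcal P$; "for almost all $p$" means for all $p$ in some member of $\mathcal F$, and $\operatorname{ulim}_pA_p$ is the ultraproduct. Let $\overline{\mathbb F_p}$ be an algebraic closure of $\mathbb F_p$ and let $\alpha:\operatorname{ulim}_p\overline{\mathbb F_p}\cong\mathbb C$ be a ring isomorphism. Through $\alpha^{-1}$ and $X_i\mapsto\operatorname{ulim}_pX_i$ there is a ring homomorphism $\mathbb C[X_1,\dots,X_n]\to\operatorname{ulim}_p\overline{\mathbb F_p}[X_1,\dots,X_n]$; an approximation of a polynomial $f$ is a sequence $(f_p)$ whose class is the image of $f$. Write $R\cong\big(\mathbb C[X_1,\dots,X_n]/(f_1,\dots,f_r)\big)_{\mathfrak p}$, where the prime $\mathfrak p$ is generated by the classes of $g_1,\dots,g_s$, and $\mathfrak a=(h_1/u_1,\dots,h_k/u_k)$ with polynomials $h_j,u_j$, the class of $u_j$ not in $\mathfrak p$; choose approximations $f_{i,p},g_{i,p},h_{j,p},u_{j,p}$ of all these polynomials. Put $\mathfrak p_p=(g_{1,p},\dots,g_{s,p})\subseteq\overline{\mathbb F_p}[X_1,\dots,X_n]/(f_{1,p},\dots,f_{r,p})$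 and, whenever $\mathfrak p_p$ is prime and no $u_{j,p}$ lies in $\mathfrak p_p$ (this includes almost all $p$), $R_p=\big(\overline{\mathbb F_p}[X_1,\dots,X_n]/(f_{1,p},\dots,f_{r,p})\big)_{\mathfrak p_p}$ and $\mathfrak a_p=(h_{1,p}/u_{1,p},\dots,h_{k,p}/u_{k,p})R_p$. Such a family $(R_p,\mathfrak a_p)$ is an approximation of $(R,\mathfrak a)$ with respect to $(\mathcal F,\alpha)$. **Proposition.** 1. If $(R,\mathfrak a^t)$ is of dense sharply $F$-pure type, then there exist a non-principal ultrafilter $\mathcal F$ on $\mathcal P$ and a ring isomorphism $\alpha:\operatorname{ulim}_p\overline{\mathbb F_p}\cong\mathbb C$ such that for every approximation $(R_p,\mathfrak a_p)$ of $(R,\mathfrak a)$ with respect to $(\mathcal F,\alpha)$, for almost all $p$ the pair $(R_p,\mathfrak a_p^t)$ is defined and sharply $F$-pure. 2. If $(R,\mathfrak a^t)$ is of dense sharply $F$-injective type, then there exist a non-principal ultrafilter $\mathcal F$ on $\mathcal P$ and a ring isomorphism $\alpha:\operatorname{ulim}_p\overline{\mathbb F_p}\cong\mathbb C$ such that for every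 approximation $(R_p,\mathfrak a_p)$ of $(R,\mathfrak a)$ with respect to $(\mathcal F,\alpha)$, for almost all $p$ the pair $(R_p,\mathfrak a_p^t)$ is defined and sharply $F$-injective. -/

import Mathlib

open CategoryTheory Filter
open scoped TensorProduct

noncomputable section

universe u

/-! ### Sharp `F`-purity and sharp `F`-injectivity -/

section Frobenius

variable {R : Type u} [CommRing R]

/-- `𝔞 ∩ R° ≠ ∅`: the ideal `𝔞` contains an element lying in no minimal prime of `R`. -/
def MeetsRCirc (𝔞 : Ideal R) : Prop :=
  ∃ x ∈ 𝔞, ∀ 𝔮 ∈ minimalPrimes R, x ∉ 𝔮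

/-- A linear map `φ : M → N` is pure if `L ⊗ φ` is injective for every `R`-module `L`. -/
def IsPureLinearMap {M N : Type u} [AddCommGroup M] [Module R M] [AddCommGroup N] [Module R N]
    (φ : M →ₗ[R] N) : Prop :=
  ∀ (L : Type u) [AddCommGroup L] [Module R L], Function.Injective (φ.lTensor L)

/-- `F^e_* R`: the additive group of `R`, with `R` acting through the `e`-th iterate of Frobenius,
`a • F^e_* b = F^e_* (a ^ (p ^ e) * b)`. -/
@[nolint unusedArguments]
def FrobeniusPushforward (R : Type u) [CommRing R] (p : ℕ) [ExpChar R p] (_e : ℕ) : Type u := R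

instance (p : ℕ) [ExpChar R p] (e : ℕ) : AddCommGroup (FrobeniusPushforward R p e) :=
  inferInstanceAs (AddCommGroup R)

instance (p : ℕ) [ExpChar R p] (e : ℕ) : Module R (FrobeniusPushforward R p e) :=
  Module.compHom R (iterateFrobenius R p e)

/-- The element `F^e_* b` of `F^e_* R`. -/
def frobeniusElt (p : ℕ) [ExpChar R p] (e : ℕ) (b : R) : FrobeniusPushforward R p e := b

theorem smul_frobeniusElt (p : ℕ) [ExpChar R p] (e : ℕ) (a b : R) :
    a • frobeniusElt p e b = frobeniusElt p e (a ^ p ^ e * b) := rfl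

/-- The `R`-linear map `· F^e_* f : R → F^e_* R`, `x ↦ x • F^e_* f`. -/
def frobeniusMul (p : ℕ) [ExpChar R p] (e : ℕ) (f : R) : R →ₗ[R] FrobeniusPushforward R p e :=
  LinearMap.toSpanSingleton R (FrobeniusPushforward R p e) (frobeniusElt p e f)

/-- The pair `(R, 𝔞 ^ t)` is sharply `F`-pure; part of the assertion is that `R` has prime
characteristic `p` (which `R` determines). -/
def IsSharplyFPure (𝔞 : Ideal R) (t : ℝ) : Prop :=
  ∃ (p : ℕ) (_ : Fact p.Prime) (_ : CharP R p),
    {e : ℕ | ∃ f ∈ 𝔞 ^ ⌈t * ((p : ℝ) ^ e - 1)⌉₊,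
      IsPureLinearMap (frobeniusMul p e f)}.Infinite

/-- The pair `(R, 𝔞 ^ t)` over a local ring `(R, 𝔪)` is sharply `F`-injective; part of the
assertion is that `R` has prime characteristic `p` (which `R` determines). -/
def IsSharplyFInjective [IsLocalRing R] (𝔞 : Ideal R) (t : ℝ) : Prop :=
  ∃ (p : ℕ) (_ : Fact p.Prime) (_ : CharP R p),
    ∀ (i : ℕ) (η : (localCohomology (IsLocalRing.maximalIdeal R) i).obj (ModuleCat.of R R)),
      η ≠ 0 →
      {e : ℕ | ∃ f ∈ 𝔞 ^ ⌈t * ((p : ℝ) ^ e - 1)⌉₊,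
        ((localCohomology (IsLocalRing.maximalIdeal R) i).map
          (ModuleCat.ofHom (frobeniusMul p e f))).hom η
          ≠ 0}.Infinite

end Frobenius

/-- A property of pairs consisting of a local ring and an ideal of it. -/
abbrev PairProperty : Type 1 :=
  ∀ (S : Type) [CommRing S] [IsLocalRing S], Ideal S → Prop

/-! ### Models, reductions modulo `p`, and properties of dense type -/

/-- A model of a triple `(S, 𝔟, 𝔭)`, where `S` is a `ℂ`-algebra and `𝔟`, `𝔭` are ideals of it. -/
structure ReductionModel (S : Type) [CommRing S] [Algebra ℂ S] (𝔟 𝔭 : Ideal S) where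
  /-- the finitely generated `ℤ`-subalgebra `A` of `ℂ` -/
  A : Subalgebra ℤ ℂ
  fg : A.FG
  /-- the finitely generated `A`-algebra `S_A` -/
  SA : Type
  [commRing : CommRing SA]
  [algebra : Algebra A SA]
  [finiteType : Algebra.FiniteType A SA]
  iso : (ℂ ⊗[A] SA) ≃ₐ[ℂ] S
  bA : Ideal SA
  pA : Ideal SA
  map_bA : (bA.map (Algebra.TensorProduct.includeRight : SA →ₐ[A] ℂ ⊗[A] SA)).map iso = 𝔟
  map_pA : (pA.map (Algebra.TensorProduct.includeRight : SA →ₐ[A] ℂ ⊗[A] SA)).map iso = 𝔭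

attribute [instance] ReductionModel.commRing ReductionModel.algebra ReductionModel.finiteType

namespace ReductionModel

variable {S : Type} [CommRing S] [Algebra ℂ S] {𝔟 𝔭 : Ideal S} (M : ReductionModel S 𝔟 𝔭)
  (μ : MaximalSpectrum M.A)

/-- `S_μ = κ(μ) ⊗_A S_A`, where `κ(μ) = A / μ`. -/
def RingMod : Type := (M.A ⧸ μ.asIdeal) ⊗[M.A] M.SA

instance : CommRing (M.RingMod μ) :=
  inferInstanceAs (CommRing ((M.A ⧸ μ.asIdeal) ⊗[M.A] M.SA))

/-- The canonical homomorphism `S_A → S_μ`. -/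
def toRingMod : M.SA →+* M.RingMod μ :=
  (Algebra.TensorProduct.includeRight : M.SA →ₐ[M.A] (M.A ⧸ μ.asIdeal) ⊗[M.A] M.SA).toRingHom

/-- `𝔟_μ = 𝔟_A S_μ`. -/
def bMod : Ideal (M.RingMod μ) := M.bA.map (M.toRingMod μ)

/-- `𝔭_μ = 𝔭_A S_μ`. -/
def pMod : Ideal (M.RingMod μ) := M.pA.map (M.toRingMod μ)

end ReductionModel

/-- The pair `(R, 𝔞)` is of dense `Φ` type. Here `(R, 𝔞)` is written as `(S_𝔭, 𝔟 S_𝔭)` with `S` a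
finitely generated `ℂ`-algebra, `𝔭` a prime and `𝔟` an ideal with `𝔟 ∩ S° ≠ ∅`; every finitely
generated algebra over a ring in `Type` is isomorphic to one in `Type`. -/
def IsOfDenseType (Φ : PairProperty) {R : Type u} [CommRing R] [Algebra ℂ R]
    (𝔞 : Ideal R) : Prop :=
  ∃ (S : Type) (_ : CommRing S) (_ : Algebra ℂ S) (_ : Algebra.FiniteType ℂ S)
    (𝔟 𝔭 : Ideal S) (_ : 𝔭.IsPrime) (iso : Localization.AtPrime 𝔭 ≃ₐ[ℂ] R),
    MeetsRCirc 𝔟 ∧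
    (𝔟.map (algebraMap S (Localization.AtPrime 𝔭))).map iso = 𝔞 ∧
    ∃ (M : ReductionModel S 𝔟 𝔭) (D : Set (MaximalSpectrum M.A)),
      Dense (MaximalSpectrum.toPrimeSpectrum '' D) ∧
      ∀ μ ∈ D, ∃ _ : (M.pMod μ).IsPrime,
        Φ (Localization.AtPrime (M.pMod μ)) ((M.bMod μ).map (algebraMap _ _))

/-! ### Ultraproducts over the set of prime numbers -/

section Ultraproduct

instance factPrimeOfPrimes (p : Nat.Primes) : Fact (p : ℕ).Prime := ⟨p.2⟩

/-- An algebraic closure of the field with `p` elements. -/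
abbrev FBar (p : Nat.Primes) : Type := AlgebraicClosure (ZMod p)

variable (ℱ : Ultrafilter Nat.Primes)

/-- The families of elements that vanish for almost all `p`. -/
def ultraIdeal (A : Nat.Primes → Type) [∀ p, CommRing (A p)] : Ideal (∀ p, A p) where
  carrier := {x | ∀ᶠ p in (ℱ : Filter Nat.Primes), x p = 0}
  add_mem' := fun hx hy => by
    filter_upwards [hx, hy] with p h₁ h₂
    simp [h₁, h₂]
  zero_mem' := Eventually.of_forall fun _ => rfl
  smul_mem' := fun c x hx => by
    filter_upwards [hx] with p h
    simp [h]

/-- The ultraproduct `ulim_p A_p`: families modulo equality for almost all `p`. -/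
abbrev UltraProd (A : Nat.Primes → Type) [∀ p, CommRing (A p)] : Type :=
  (∀ p, A p) ⧸ ultraIdeal ℱ A

/-- The class `ulim_p x_p` of a family `(x_p)`. -/
abbrev ulim {A : Nat.Primes → Type} [∀ p, CommRing (A p)] (x : ∀ p, A p) : UltraProd ℱ A :=
  Ideal.Quotient.mk (ultraIdeal ℱ A) x

theorem ulim_eq_ulim_iff {A : Nat.Primes → Type} [∀ p, CommRing (A p)] (x y : ∀ p, A p) :
    ulim ℱ x = ulim ℱ y ↔ ∀ᶠ p in (ℱ : Filter Nat.Primes), x p = y p := by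
  rw [Ideal.Quotient.eq]
  change (∀ᶠ p in (ℱ : Filter Nat.Primes), (x - y) p = 0) ↔ _
  simp [sub_eq_zero]

/-- The ring homomorphism `ulim_p A_p → ulim_p B_p` induced by homomorphisms `A_p → B_p`. -/
def UltraProd.map {A B : Nat.Primes → Type} [∀ p, CommRing (A p)] [∀ p, CommRing (B p)]
    (φ : ∀ p, A p →+* B p) : UltraProd ℱ A →+* UltraProd ℱ B :=
  Ideal.quotientMap (ultraIdeal ℱ B)
    (RingHom.pi fun p => (φ p).comp (Pi.evalRingHom A p)) fun x hx => by
      change ∀ᶠ p in (ℱ : Filter Nat.Primes), x p = 0 at hx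
      change ∀ᶠ p in (ℱ : Filter Nat.Primes), φ p (x p) = 0
      filter_upwards [hx] with p h
      simp [h]

variable {ℱ} (α : UltraProd ℱ FBar ≃+* ℂ)

/-- The canonical homomorphism `ℂ[X₁, …, Xₙ] → ulim_p F̄_p[X₁, …, Xₙ]`, given on constants by
`ℂ ≅ ulim_p F̄_p` and sending `Xᵢ` to `ulim_p Xᵢ`. -/
def polyHull (n : ℕ) :
    MvPolynomial (Fin n) ℂ →+* UltraProd ℱ fun p => MvPolynomial (Fin n) (FBar p) :=
  MvPolynomial.eval₂Hom
    ((UltraProd.map ℱ fun p => (MvPolynomial.C : FBar p →+* MvPolynomial (Fin n) (FBar p))).comp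
      (α.symm : ℂ →+* UltraProd ℱ FBar))
    fun i => ulim ℱ fun _ => MvPolynomial.X i

/-- The family `(f_p)` is an approximation of the polynomial `f`. -/
def IsPolyApprox {n : ℕ} (f : MvPolynomial (Fin n) ℂ)
    (fp : ∀ p : Nat.Primes, MvPolynomial (Fin n) (FBar p)) : Prop :=
  polyHull α n f = ulim ℱ fp

end Ultraproduct

/-! ### Approximations of local rings essentially of finite type and of their ideals -/

/-- Polynomials over `K` describing a local ring essentially of finite type over `K` together with
an ideal of it: the ring is the localization of `K[X₁, …, Xₙ] / (eqn₁, …, eqn_r)` at the prime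
generated by `gen₁, …, gen_s`, and its ideal is generated by the fractions `num_j / den_j`. -/
structure PairData (K : Type) [CommRing K] (n r s k : ℕ) where
  eqn : Fin r → MvPolynomial (Fin n) K
  gen : Fin s → MvPolynomial (Fin n) K
  num : Fin k → MvPolynomial (Fin n) K
  den : Fin k → MvPolynomial (Fin n) K

namespace PairData

variable {K : Type} [CommRing K] {n r s k : ℕ} (D : PairData K n r s k)

/-- `K[X₁, …, Xₙ] / (eqn₁, …, eqn_r)`. -/
abbrev Alg : Type := MvPolynomial (Fin n) K ⧸ Ideal.span (Set.range D.eqn)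

/-- The class of a polynomial in `D.Alg`. -/
abbrev cls (g : MvPolynomial (Fin n) K) : D.Alg := Ideal.Quotient.mk _ g

/-- The ideal `(gen₁, …, gen_s)` of `D.Alg`. -/
def genIdeal : Ideal D.Alg := Ideal.span (Set.range fun j => D.cls (D.gen j))

/-- The ideal generated by the fractions `num_j / den_j` in the localization of `D.Alg` at the
prime ideal `(gen₁, …, gen_s)`. -/
def fracIdeal [D.genIdeal.IsPrime] (hden : ∀ j, D.cls (D.den j) ∉ D.genIdeal) :
    Ideal (Localization.AtPrime D.genIdeal) :=
  Ideal.span (Set.range fun j =>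
    Localization.mk (D.cls (D.num j)) (⟨D.cls (D.den j), hden j⟩ : D.genIdeal.primeCompl))

/-- The data `D` describe a local ring with an ideal, and this pair has the property `Φ`. -/
def Satisfies (Φ : PairProperty) : Prop :=
  ∃ (_ : D.genIdeal.IsPrime) (hden : ∀ j, D.cls (D.den j) ∉ D.genIdeal),
    Φ (Localization.AtPrime D.genIdeal) (D.fracIdeal hden)

/-- The data `D` describe the local `K`-algebra `R` with its ideal `𝔞`. -/
def Presents {R : Type u} [CommRing R] [Algebra K R] (𝔞 : Ideal R) : Prop :=
  ∃ (_ : D.genIdeal.IsPrime) (hden : ∀ j, D.cls (D.den j) ∉ D.genIdeal)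
    (iso : Localization.AtPrime D.genIdeal ≃ₐ[K] R), (D.fracIdeal hden).map iso = 𝔞

/-- The family `(D_p)` is an approximation of `D`: every polynomial of `D_p` comes from an
approximation of the corresponding polynomial of `D`. When `D` presents `(R, 𝔞)`, the pairs
`(R_p, 𝔞_p)` described by `D_p` form an approximation of `(R, 𝔞)`. -/
structure IsApproximation {ℱ : Ultrafilter Nat.Primes} (α : UltraProd ℱ FBar ≃+* ℂ)
    (D : PairData ℂ n r s k) (Dp : ∀ p : Nat.Primes, PairData (FBar p) n r s k) : Prop where
  eqn : ∀ j, IsPolyApprox α (D.eqn j) fun p => (Dp p).eqn j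
  gen : ∀ j, IsPolyApprox α (D.gen j) fun p => (Dp p).gen j
  num : ∀ j, IsPolyApprox α (D.num j) fun p => (Dp p).num j
  den : ∀ j, IsPolyApprox α (D.den j) fun p => (Dp p).den j

end PairData

/-- With respect to the ultrafilter `ℱ` and the isomorphism `α`, for every approximation
`(R_p, 𝔞_p)` of `(R, 𝔞)` the pair `(R_p, 𝔞_p)` is defined and has the property `Φ` for almost
all `p`. -/
def ApproximationsSatisfy (Φ : PairProperty) {R : Type u} [CommRing R] [Algebra ℂ R]
    (𝔞 : Ideal R) (ℱ : Ultrafilter Nat.Primes) (α : UltraProd ℱ FBar ≃+* ℂ) : Prop :=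
  ∀ (n r s k : ℕ) (D : PairData ℂ n r s k), D.Presents 𝔞 →
    ∀ Dp : (∀ p : Nat.Primes, PairData (FBar p) n r s k), D.IsApproximation α Dp →
      ∀ᶠ p in (ℱ : Filter Nat.Primes), (Dp p).Satisfies Φ

end

/-! Dense type speaks of reductions `S_μ` over the finite fields `A/μ`, approximations of rings over
`F̄_p`. The ultrafilter and `α` are chosen so that some approximation is the base change of the
`S_μ` with `μ ∈ D`; the property has to survive this base change and must not depend on the
presentation.

Choice of `ℱ` and `α`. As `A` is countable and `D` is dense, there are `μ_p ∈ D` of residue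
characteristic `p`, for infinitely many `p`, such that every nonzero element of `A` lies outside all
but finitely many of them. Embedding the finite field `A/μ_p` in `F̄_p` embeds `A` in `ulim F̄_p`.
This field and `ℂ` are algebraically closed of cardinality continuum, so the two embeddings of the
countable ring `A` are matched by an isomorphism `α` (`exists_ringEquiv_of_dense`).

Ascent. Let `T → T'` be free with `𝔪_T T' = 𝔪_T'` and a basis `b` such that the `b_i ^ p ^ e` form a
basis for each `e`. Then `T' ⊗ F^e_* T ≅ F^e_* T'`, which carries purity from `T` to `T'`. For local
cohomology, taking coordinates with respect to `b` on `T'` and to `b ^ p ^ e` on `F^e_* T'` commutes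
with `· F^e_* f`, and a nonzero class over `T'` has a nonzero coordinate class over `T`
(`localCohomology.exists_coordinate_ne_zero`). A basis of a perfect field over a perfect subfield is
of this kind; hence the passage from `A/μ_p` to `F̄_p`, once the extended prime is known to remain
prime.

Transfer. Approximations of a prime ideal are prime for almost all `p`
(`IsPolyApprox.eventually_isPrime`): an affine variety over `ℂ` is birational to a hypersurface,
irreducibility of one polynomial passes to approximations by bounding degrees, and generic freeness
keeps the inverted element regular. Two presentations of one pair are related by finitely many
polynomial identities, so their approximations are isomorphic for almost all `p`
(`PairData.eventually_exists_ringEquiv`). -/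

/-! ### Ext classes as cocycles on an arbitrary projective resolution. -/

section ExtCocycles

open Limits Opposite

noncomputable section

namespace CategoryTheory.ProjectiveResolution

universe u v w

variable {R : Type w} [Ring R] {C : Type u} [Category.{v} C] [Abelian C] [Linear R C]

/-- Postcomposition with `g` on complexes of morphisms. -/
def linearYonedaPost (K : ChainComplex C ℕ) {Y Y' : C} (g : Y ⟶ Y') :
    K.linearYonedaObj R Y ⟶ K.linearYonedaObj R Y' :=
  (HomologicalComplex.unopFunctor _ _).map
    (((NatTrans.mapHomologicalComplex
      (NatTrans.rightOp ((linearYoneda R C).map g)) _).app K)).op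

/-- Precomposition with `φ` on complexes of morphisms. -/
def linearYonedaPre {K L : ChainComplex C ℕ} (φ : K ⟶ L) (Y : C) :
    L.linearYonedaObj R Y ⟶ K.linearYonedaObj R Y :=
  (HomologicalComplex.unopFunctor _ _).map
    ((((linearYoneda R C).obj Y).rightOp.mapHomologicalComplex _).map φ).op

theorem inv_naturality_of_hom_naturality {V : Type*} [Category V] {A B A' B' : V}
    (e : A ≅ B) (e' : A' ≅ B') (f : A ⟶ A') (g : B ⟶ B') (h : f ≫ e'.hom = e.hom ≫ g) :
    g ≫ e'.inv = e.inv ≫ f := by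
  rw [Iso.comp_inv_eq, Category.assoc, h, Iso.inv_hom_id_assoc]

theorem paste_squares {V : Type*} [Category V] {A A' B B' D D' : V} {a : A ⟶ A'} {b : B ⟶ B'}
    {c : D ⟶ D'} {p : A ⟶ B} {p' : A' ⟶ B'} {q : B ⟶ D} {q' : B' ⟶ D'}
    (h₁ : a ≫ p' = p ≫ b) (h₂ : b ≫ q' = q ≫ c) : a ≫ (p' ≫ q') = (p ≫ q) ≫ c := by
  rw [← Category.assoc, h₁, Category.assoc, h₂, Category.assoc]

theorem homologyUnop_inv_naturality {V : Type*} [Category V] [Abelian V] {ι : Type*}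
    {c : ComplexShape ι} {K L : HomologicalComplex Vᵒᵖ c} (φ : K ⟶ L) (n : ι) :
    (HomologicalComplex.homologyMap φ n).unop ≫ (K.homologyUnop n).inv =
      (L.homologyUnop n).inv ≫
        HomologicalComplex.homologyMap ((HomologicalComplex.unopFunctor V c).map φ.op) n :=
  inv_naturality_of_hom_naturality _ _ _ _ (congrArg Quiver.Hom.unop
    (HomologicalComplex.homologyOp_hom_naturality
      ((HomologicalComplex.unopFunctor V c).map φ.op) n)).symm

variable [EnoughProjectives C] {X : C} (P : ProjectiveResolution X)

/-- `isoExt` is the opposite of the comparison with the left derived functor followed by the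
comparison of homology with its opposite; both are natural, and the two squares are pasted. -/
theorem isoExt_hom_naturality_right (n : ℕ) {Y Y' : C} (g : Y ⟶ Y') :
    ((Ext R C n).obj (op X)).map g ≫ (P.isoExt (R := R) n Y').hom =
      (P.isoExt n Y).hom ≫ HomologicalComplex.homologyMap (linearYonedaPost P.complex g) n := by
  have h : (P.isoLeftDerivedObj ((linearYoneda R C).obj Y').rightOp n).inv ≫
      (NatTrans.leftDerived (NatTrans.rightOp ((linearYoneda R C).map g)) n).app X =
      (HomologicalComplex.homologyFunctor _ _ n).map ((NatTrans.mapHomologicalComplex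
        (NatTrans.rightOp ((linearYoneda R C).map g)) (ComplexShape.down ℕ)).app P.complex) ≫
      (P.isoLeftDerivedObj ((linearYoneda R C).obj Y).rightOp n).inv := by
    rw [leftDerived_app_eq _ P n, Iso.inv_hom_id_assoc]
  exact paste_squares (congrArg Quiver.Hom.unop h) (homologyUnop_inv_naturality _ n)

theorem isoExt_hom_naturality_left (n : ℕ) {X' : C} (P' : ProjectiveResolution X')
    (f : X ⟶ X') (φ : P.complex ⟶ P'.complex) (hφ : φ.f 0 ≫ P'.π.f 0 = P.π.f 0 ≫ f) (Y : C) :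
    ((Ext R C n).map f.op).app Y ≫ (P.isoExt (R := R) n Y).hom =
      (P'.isoExt n Y).hom ≫ HomologicalComplex.homologyMap (linearYonedaPre φ Y) n :=
  paste_squares (congrArg Quiver.Hom.unop
    (isoLeftDerivedObj_inv_naturality f P P' φ hφ ((linearYoneda R C).obj Y).rightOp n))
    (homologyUnop_inv_naturality _ n)

/-- The cocycle `z` on the projective resolution `P` of `X` represents `ξ` in `Ext n X Y`. -/
def Represents {n : ℕ} {Y : C} (z : P.complex.X n ⟶ Y)
    (ξ : ((Ext R C n).obj (op X)).obj Y) : Prop :=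
  ∃ c : (P.complex.linearYonedaObj R Y).cycles n,
    (P.complex.linearYonedaObj R Y).iCycles n c = z ∧
      (P.complex.linearYonedaObj R Y).homologyπ n c = (P.isoExt n Y).hom ξ

variable {P} {n : ℕ} {Y : C}

theorem exists_represents (ξ : ((Ext R C n).obj (op X)).obj Y) :
    ∃ z : P.complex.X n ⟶ Y, P.Represents z ξ := by
  obtain ⟨c, hc⟩ := (ModuleCat.epi_iff_surjective _).1
    (inferInstance : Epi ((P.complex.linearYonedaObj R Y).homologyπ n)) ((P.isoExt n Y).hom ξ)
  exact ⟨_, c, rfl, hc⟩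

theorem Represents.cocycle {z : P.complex.X n ⟶ Y} {ξ : ((Ext R C n).obj (op X)).obj Y}
    (h : P.Represents z ξ) (j : ℕ) : P.complex.d j n ≫ z = 0 := by
  obtain ⟨c, rfl, -⟩ := h
  have := (P.complex.linearYonedaObj R Y).iCycles_d n j
  exact congr($this c)

theorem exists_represents_of_cocycle (z : P.complex.X n ⟶ Y)
    (hz : P.complex.d (n + 1) n ≫ z = 0) :
    ∃ ξ : ((Ext R C n).obj (op X)).obj Y, P.Represents z ξ := by
  let S := (P.complex.linearYonedaObj R Y).sc n
  have hz' : S.g.hom z = 0 := by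
    have hnext : (ComplexShape.up ℕ).next n = n + 1 := ComplexShape.next_eq' _ rfl
    change P.complex.d ((ComplexShape.up ℕ).next n) n ≫ z = 0
    rw [hnext, hz]
  let c : (P.complex.linearYonedaObj R Y).cycles n := S.moduleCatCyclesIso.inv ⟨z, hz'⟩
  refine ⟨(P.isoExt n Y).inv ((P.complex.linearYonedaObj R Y).homologyπ n c), c, ?_, ?_⟩
  · exact congr($(S.moduleCatCyclesIso_inv_iCycles) ⟨z, hz'⟩)
  · exact congr($((P.isoExt (R := R) n Y).inv_hom_id) _).symm

theorem Represents.map_right {z : P.complex.X n ⟶ Y} {ξ : ((Ext R C n).obj (op X)).obj Y}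
    (h : P.Represents z ξ) {Y' : C} (g : Y ⟶ Y') :
    P.Represents (z ≫ g) (((Ext R C n).obj (op X)).map g ξ) := by
  obtain ⟨c, rfl, hc⟩ := h
  refine ⟨HomologicalComplex.cyclesMap (linearYonedaPost P.complex g) n c, ?_, ?_⟩
  · have := HomologicalComplex.cyclesMap_i (linearYonedaPost (R := R) P.complex g) n
    exact congr($this c)
  · have h1 := HomologicalComplex.homologyπ_naturality (linearYonedaPost (R := R) P.complex g) n
    have h2 := P.isoExt_hom_naturality_right (R := R) n g
    have h3 := congr($h1 c)
    have h4 := congr($h2 ξ)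
    simp only [ModuleCat.comp_apply] at h3 h4
    rw [← h3, hc, h4]

theorem Represents.map_left {z : P.complex.X n ⟶ Y} {ξ : ((Ext R C n).obj (op X)).obj Y}
    (h : P.Represents z ξ) {X' : C} {P' : ProjectiveResolution X'} (f : X' ⟶ X)
    (φ : P'.complex ⟶ P.complex) (hφ : φ.f 0 ≫ P.π.f 0 = P'.π.f 0 ≫ f) :
    P'.Represents (φ.f n ≫ z) (((Ext R C n).map f.op).app Y ξ) := by
  obtain ⟨c, rfl, hc⟩ := h
  refine ⟨HomologicalComplex.cyclesMap (linearYonedaPre φ Y) n c, ?_, ?_⟩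
  · have := HomologicalComplex.cyclesMap_i (linearYonedaPre (R := R) φ Y) n
    exact congr($this c)
  · have h1 := HomologicalComplex.homologyπ_naturality (linearYonedaPre (R := R) φ Y) n
    have h2 := P'.isoExt_hom_naturality_left (R := R) n P f φ hφ Y
    have h3 := congr($h1 c)
    have h4 := congr($h2 ξ)
    simp only [ModuleCat.comp_apply] at h3 h4
    rw [← h3, hc, h4]

/-- For `n = 0` the index `prev 0` is `0` and the differential `d 0 0` is zero, so the right-hand
side correctly says `z = 0`. -/
theorem Represents.eq_zero_iff {z : P.complex.X n ⟶ Y} {ξ : ((Ext R C n).obj (op X)).obj Y}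
    (h : P.Represents z ξ) :
    ξ = 0 ↔ ∃ w : P.complex.X ((ComplexShape.up ℕ).prev n) ⟶ Y, P.complex.d n _ ≫ w = z := by
  obtain ⟨c, rfl, hc⟩ := h
  let S := (P.complex.linearYonedaObj R Y).sc n
  have h1 : ξ = 0 ↔ (P.isoExt n Y).hom ξ = 0 := by
    refine ⟨fun h => by rw [h, map_zero], fun h => ?_⟩
    exact (ModuleCat.mono_iff_injective (P.isoExt (R := R) n Y).hom).1 inferInstance
      (h.trans (map_zero _).symm)
  have h2 : S.homologyπ c = 0 ↔ S.homologyι (S.homologyπ c) = 0 := by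
    refine ⟨fun h => by rw [h, map_zero], fun h => ?_⟩
    exact (ModuleCat.mono_iff_injective S.homologyι).1 inferInstance
      (h.trans (map_zero _).symm)
  have h3 : S.homologyι (S.homologyπ c) = S.pOpcycles (S.iCycles c) :=
    congr($(S.homology_π_ι) c)
  rw [h1, ← hc]
  exact h2.trans (by rw [h3]; exact S.moduleCat_pOpcycles_eq_zero_iff _)

end CategoryTheory.ProjectiveResolution
end

end ExtCocycles

/-! ### Local cohomology as a filtered colimit of Ext modules, with cocycle representatives. -/

section LocalCohomologyCocycles

open Limits Opposite

noncomputable section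

universe u
variable {R : Type u} [CommRing R] (J : Ideal R)

namespace localCohomology

/-- The module `R / J ^ n`. -/
abbrev quotPow (n : ℕ) : ModuleCat.{u} R := ModuleCat.of R (R ⧸ J ^ n)

/-- The projection `R / J ^ m → R / J ^ n`. -/
def quotPowMap {n m : ℕ} (h : n ≤ m) : quotPow J m ⟶ quotPow J n :=
  ModuleCat.ofHom (Submodule.mapQ _ _ LinearMap.id (Ideal.pow_le_pow_right h))

/-- The structure map from `Ext i (R / J ^ n) N` to local cohomology. -/
def fromExt (i n : ℕ) (N : ModuleCat.{u} R) :
    ((Ext R (ModuleCat.{u} R) i).obj (op (quotPow J n))).obj N ⟶ (localCohomology J i).obj N :=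
  (colimit.ι (diagram (idealPowersDiagram J) i) (op (op n))).app N

theorem fromExt_naturality (i n : ℕ) {N N' : ModuleCat.{u} R} (g : N ⟶ N') :
    ((Ext R (ModuleCat.{u} R) i).obj (op (quotPow J n))).map g ≫ fromExt J i n N' =
      fromExt J i n N ≫ (localCohomology J i).map g :=
  (colimit.ι (diagram (idealPowersDiagram J) i) (op (op n))).naturality g

theorem fromExt_w (i : ℕ) {n m : ℕ} (h : n ≤ m) (N : ModuleCat.{u} R) :
    ((Ext R (ModuleCat.{u} R) i).map (quotPowMap J h).op).app N ≫ fromExt J i m N =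
      fromExt J i n N :=
  congr($(colimit.w (diagram (idealPowersDiagram J) i) (homOfLE h).op.op).app N)

/-- The powers of `J` form a diagram on `ℕᵒᵖ` and Ext is contravariant, which accounts for the
double opposite. -/
instance : IsFiltered ℕᵒᵖᵒᵖ := IsFiltered.of_equivalence (opOpEquivalence ℕ).symm

instance : PreservesColimitsOfShape ℕᵒᵖᵒᵖ (forget (ModuleCat.{u} R)) :=
  haveI : PreservesFilteredColimitsOfSize.{0, 0} (forget (ModuleCat.{u} R)) :=
    preservesFilteredColimitsOfSize_shrink.{0, u, 0, u} _
  inferInstance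

/-- Colimits of functors are computed pointwise and filtered colimits of modules on underlying sets.
Hence every element, and likewise every vanishing below, occurs at a finite stage. -/
theorem exists_fromExt (i : ℕ) (N : ModuleCat.{u} R) (η : (localCohomology J i).obj N) :
    ∃ n ξ, fromExt J i n N ξ = η := by
  let F := diagram (idealPowersDiagram J) i
  have hc : IsColimit (((evaluation _ _).obj N).mapCocone (colimit.cocone F)) :=
    isColimitOfPreserves _ (colimit.isColimit F)
  obtain ⟨j, x, hx⟩ := Concrete.isColimit_exists_rep _ hc η
  exact ⟨j.unop.unop, x, hx⟩

theorem exists_map_eq_zero_of_fromExt_eq_zero (i n : ℕ) (N : ModuleCat.{u} R)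
    (ξ : ((Ext R (ModuleCat.{u} R) i).obj (op (quotPow J n))).obj N)
    (h : fromExt J i n N ξ = 0) :
    ∃ m, ∃ hm : n ≤ m, ((Ext R (ModuleCat.{u} R) i).map (quotPowMap J hm).op).app N ξ = 0 := by
  let F := diagram (idealPowersDiagram J) i
  have hc : IsColimit (((evaluation _ _).obj N).mapCocone (colimit.cocone F)) :=
    isColimitOfPreserves _ (colimit.isColimit F)
  have h0 : (((evaluation _ _).obj N).mapCocone (colimit.cocone F)).ι.app (op (op n)) ξ =
      (((evaluation _ _).obj N).mapCocone (colimit.cocone F)).ι.app (op (op n)) 0 :=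
    h.trans (map_zero (fromExt J i n N).hom).symm
  obtain ⟨k, f, hk⟩ := (hc.eq_iff' _ _).1 h0
  refine ⟨k.unop.unop, leOfHom f.unop.unop, ?_⟩
  exact hk.trans (map_zero _)

variable {J} (P : ∀ n, ProjectiveResolution (quotPow J n)) {i n : ℕ} {N : ModuleCat.{u} R}

/-- The cocycle `z` on the projective resolution of `R / J ^ n` represents the local cohomology
class `η`. -/
def Represents (z : (P n).complex.X i ⟶ N) (η : (localCohomology J i).obj N) : Prop :=
  ∃ ξ, (P n).Represents z ξ ∧ fromExt J i n N ξ = η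

theorem exists_represents (η : (localCohomology J i).obj N) :
    ∃ (n : ℕ) (z : (P n).complex.X i ⟶ N), Represents P z η := by
  obtain ⟨n, ξ, hξ⟩ := exists_fromExt J i N η
  obtain ⟨z, hz⟩ := ProjectiveResolution.exists_represents (P := P n) ξ
  exact ⟨n, z, ξ, hz, hξ⟩

theorem exists_represents_of_cocycle (z : (P n).complex.X i ⟶ N)
    (hz : (P n).complex.d (i + 1) i ≫ z = 0) :
    ∃ η : (localCohomology J i).obj N, Represents P z η := by
  obtain ⟨ξ, hξ⟩ := ProjectiveResolution.exists_represents_of_cocycle (R := R) z hz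
  exact ⟨_, ξ, hξ, rfl⟩

variable {P} {z : (P n).complex.X i ⟶ N} {η : (localCohomology J i).obj N}

theorem Represents.cocycle (h : Represents P z η) (j : ℕ) : (P n).complex.d j i ≫ z = 0 := by
  obtain ⟨ξ, hξ, -⟩ := h
  exact hξ.cocycle j

theorem Represents.map (h : Represents P z η) {N' : ModuleCat.{u} R} (g : N ⟶ N') :
    Represents P (z ≫ g) ((localCohomology J i).map g η) := by
  obtain ⟨ξ, hξ, rfl⟩ := h
  exact ⟨_, hξ.map_right g, congr($(fromExt_naturality J i n g) ξ)⟩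

/-- The bound `m₀` works for all later stages, so finitely many vanishing classes become
coboundaries at one common stage. -/
theorem Represents.exists_eq_d_comp (h : Represents P z η) (hη : η = 0) :
    ∃ m₀, ∃ _ : n ≤ m₀, ∀ (m : ℕ) (hm : n ≤ m) (_ : m₀ ≤ m)
      (φ : (P m).complex ⟶ (P n).complex)
      (_ : φ.f 0 ≫ (P n).π.f 0 = (P m).π.f 0 ≫ quotPowMap J hm),
      ∃ w : (P m).complex.X ((ComplexShape.up ℕ).prev i) ⟶ N,
        (P m).complex.d i _ ≫ w = φ.f i ≫ z := by
  obtain ⟨ξ, hξ, h0⟩ := h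
  obtain ⟨m₀, h₀, h1⟩ := exists_map_eq_zero_of_fromExt_eq_zero J i n N ξ (h0.trans hη)
  refine ⟨m₀, h₀, fun m hm hm₀ φ hφ => ?_⟩
  refine (hξ.map_left _ φ hφ).eq_zero_iff.1 ?_
  have : quotPowMap J hm = quotPowMap J hm₀ ≫ quotPowMap J h₀ := by
    refine ModuleCat.hom_ext (LinearMap.ext fun x => ?_)
    obtain ⟨x, rfl⟩ := Submodule.Quotient.mk_surjective _ x
    rfl
  rw [this, op_comp, Functor.map_comp, NatTrans.comp_app, ModuleCat.comp_apply, h1, map_zero]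

theorem Represents.eq_zero (h : Represents P z η) {m : ℕ} (hm : n ≤ m)
    (φ : (P m).complex ⟶ (P n).complex)
    (hφ : φ.f 0 ≫ (P n).π.f 0 = (P m).π.f 0 ≫ quotPowMap J hm)
    (w : (P m).complex.X ((ComplexShape.up ℕ).prev i) ⟶ N)
    (hw : (P m).complex.d i _ ≫ w = φ.f i ≫ z) : η = 0 := by
  obtain ⟨ξ, hξ, h0⟩ := h
  have h1 := (hξ.map_left _ φ hφ).eq_zero_iff.2 ⟨w, hw⟩
  rw [← h0, ← fromExt_w J i hm, ModuleCat.comp_apply, h1, map_zero]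

end localCohomology

end

end LocalCohomologyCocycles

/-! ### Resolutions by finitely generated projectives over a Noetherian ring. -/

section FiniteResolutions

open Limits

noncomputable section

universe u

namespace FGModuleCat

variable {R : Type u} [CommRing R] [IsNoetherianRing R]

theorem exists_free_cover (M : FGModuleCat.{u} R) :
    ∃ (F : FGModuleCat.{u} R) (f : F ⟶ M), Module.Free R F ∧ Epi f := by
  obtain ⟨n, g, hg⟩ := Module.Finite.exists_fin' R M
  let e : (Fin n →₀ R) ≃ₗ[R] (Fin n → R) := Finsupp.linearEquivFunOnFinite R R (Fin n)
  refine ⟨FGModuleCat.of R (Fin n → R), FGModuleCat.ofHom g, ?_, ?_⟩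
  · exact inferInstanceAs (Module.Free R (Fin n → R))
  · have : Epi ((forget₂ (FGModuleCat.{u} R) (ModuleCat.{u} R)).map
        (FGModuleCat.ofHom g : FGModuleCat.of R (Fin n → R) ⟶ M)) :=
      (ModuleCat.epi_iff_surjective _).2 hg
    exact Functor.epi_of_epi_map _ this

theorem projective_of_module_projective (F : FGModuleCat.{u} R) [Module.Projective R F] :
    Projective F where
  factors {E X} f e _ := by
    have : Epi ((forget₂ (FGModuleCat.{u} R) (ModuleCat.{u} R)).map e) := inferInstance
    have hs := (ModuleCat.epi_iff_surjective _).1 this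
    obtain ⟨h, hh⟩ := Module.projective_lifting_property e.hom.hom f.hom.hom hs
    exact ⟨FGModuleCat.ofHom h, FGModuleCat.hom_ext hh⟩

instance : EnoughProjectives (FGModuleCat.{u} R) where
  presentation M := by
    obtain ⟨F, f, hF, hf⟩ := exists_free_cover M
    have := projective_of_module_projective F
    exact ⟨{ p := F, f := f }⟩

/-- A projective object of `FGModuleCat` is a retract of a free cover, hence a projective module. -/
instance : (forget₂ (FGModuleCat.{u} R) (ModuleCat.{u} R)).PreservesProjectiveObjects where
  projective_obj {M} hM := by
    obtain ⟨F, f, hF, hf⟩ := exists_free_cover M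
    have : Module.Projective R M := by
      refine Module.Projective.of_split (Projective.factorThru (𝟙 M) f).hom.hom f.hom.hom ?_
      have := Projective.factorThru_comp (𝟙 M) f
      exact congr(($this).hom.hom)
    exact IsProjective.iff_projective _ |>.1 this

end FGModuleCat

/-- The resolution is taken in the abelian category of finitely generated modules; the forgetful
functor preserves homology and projectives. Finiteness of the terms is what makes images of cocycles
finitely generated later. -/
theorem ModuleCat.exists_projectiveResolution_finite {R : Type u} [CommRing R]
    [IsNoetherianRing R] (M : Type u) [AddCommGroup M] [Module R M] [Module.Finite R M] :
    ∃ P : ProjectiveResolution (ModuleCat.of R M), ∀ n, Module.Finite R (P.complex.X n) := by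
  let F := forget₂ (FGModuleCat.{u} R) (ModuleCat.{u} R)
  have : F.PreservesHomology := inferInstance
  let P : ProjectiveResolution (FGModuleCat.of R M) :=
    CategoryTheory.projectiveResolution _
  exact ⟨F.mapProjectiveResolution P, fun n => (P.complex.X n).property⟩

end

end FiniteResolutions

/-! ### Flat base change of resolutions and coordinates of local cohomology classes. -/

section BaseChangeResolution

open Limits

noncomputable section

universe u

variable {T : Type u} (T' : Type u) [CommRing T] [CommRing T'] [Algebra T T']

/-- The functor `T' ⊗_T -` from `T`-modules to `T'`-modules. -/
def ModuleCat.baseChangeFunctor : ModuleCat.{u} T ⥤ ModuleCat.{u} T' where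
  obj M := ModuleCat.of T' (T' ⊗[T] M)
  map f := ModuleCat.ofHom (f.hom.baseChange T')
  map_id _ := ModuleCat.hom_ext LinearMap.baseChange_id
  map_comp f g := ModuleCat.hom_ext (LinearMap.baseChange_comp f.hom g.hom)

namespace ModuleCat

instance : (baseChangeFunctor (T := T) T').Additive where
  map_add := ModuleCat.hom_ext (LinearMap.baseChange_add _ _)

instance : (baseChangeFunctor (T := T) T').PreservesProjectiveObjects where
  projective_obj {M} hM := by
    have : Module.Projective T M := (IsProjective.iff_projective M).2 hM
    exact (IsProjective.iff_projective (T' ⊗[T] M)).1 inferInstance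

instance [Module.Flat T T'] : (baseChangeFunctor (T := T) T').PreservesHomology :=
  Functor.preservesHomology_of_map_exact _ fun S hS => by
    rw [ShortComplex.ShortExact.moduleCat_exact_iff_function_exact] at hS ⊢
    exact Module.Flat.lTensor_exact T' hS

end ModuleCat

namespace localCohomology

variable (J : Ideal T)

/-- The canonical `T`-linear map `T / J ^ n → T' / (J T') ^ n`. -/
def quotPowToMap (n : ℕ) :
    (T ⧸ J ^ n) →ₗ[T] (T' ⧸ (J.map (algebraMap T T')) ^ n) :=
  Submodule.liftQ (J ^ n)
    ((((J.map (algebraMap T T')) ^ n).mkQ.restrictScalars T).comp (Algebra.linearMap T T'))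
    fun x hx => by
      refine (Submodule.Quotient.mk_eq_zero _).2 ?_
      rw [← Ideal.map_pow]
      exact Ideal.mem_map_of_mem _ hx

/-- The canonical map `T' ⊗ T / J ^ n → T' / (J T') ^ n`. -/
def baseChangeQuotPow (n : ℕ) :
    T' ⊗[T] (T ⧸ J ^ n) →ₗ[T'] (T' ⧸ (J.map (algebraMap T T')) ^ n) :=
  (quotPowToMap T' J n).liftBaseChange T'

theorem baseChangeQuotPow_tmul (n : ℕ) (s : T') :
    baseChangeQuotPow T' J n (s ⊗ₜ Ideal.Quotient.mk (J ^ n) 1) =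
      Ideal.Quotient.mk ((J.map (algebraMap T T')) ^ n) s := by
  rw [baseChangeQuotPow, LinearMap.liftBaseChange_tmul]
  have : quotPowToMap T' J n (Ideal.Quotient.mk (J ^ n) 1) =
    Ideal.Quotient.mk ((J.map (algebraMap T T')) ^ n) (algebraMap T T' 1) := rfl
  rw [this, map_one]
  exact congrArg (Ideal.Quotient.mk ((J.map (algebraMap T T')) ^ n)) (mul_one s)

theorem exists_eq_tmul_one (n : ℕ) (x : T' ⊗[T] (T ⧸ J ^ n)) :
    ∃ s : T', x = s ⊗ₜ Ideal.Quotient.mk (J ^ n) 1 := by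
  induction x using TensorProduct.induction_on with
  | zero => exact ⟨0, by simp⟩
  | tmul s y =>
    obtain ⟨y, rfl⟩ := Ideal.Quotient.mk_surjective y
    refine ⟨y • s, ?_⟩
    rw [TensorProduct.smul_tmul]
    congr 1
    exact congrArg (Ideal.Quotient.mk (J ^ n)) (mul_one y).symm
  | add x y hx hy =>
    obtain ⟨s, rfl⟩ := hx
    obtain ⟨s', rfl⟩ := hy
    exact ⟨s + s', (TensorProduct.add_tmul _ _ _).symm⟩

theorem tmul_one_eq_zero (n : ℕ) (s : T') (hs : s ∈ (J.map (algebraMap T T')) ^ n) :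
    s ⊗ₜ[T] Ideal.Quotient.mk (J ^ n) 1 = 0 := by
  rw [← Ideal.map_pow] at hs
  induction hs using Submodule.span_induction with
  | mem x hx =>
    obtain ⟨y, hy, rfl⟩ := hx
    rw [Algebra.algebraMap_eq_smul_one, TensorProduct.smul_tmul]
    have : y • Ideal.Quotient.mk (J ^ n) 1 = 0 := by
      have h : y • Ideal.Quotient.mk (J ^ n) 1 = Ideal.Quotient.mk (J ^ n) (y * 1) := rfl
      rw [h, mul_one, Ideal.Quotient.eq_zero_iff_mem.2 hy]
    rw [this, TensorProduct.tmul_zero]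
  | zero => simp
  | add x y _ _ hx hy => rw [TensorProduct.add_tmul, hx, hy, add_zero]
  | smul a x _ hx =>
    have : (a • x) ⊗ₜ[T] Ideal.Quotient.mk (J ^ n) 1 =
      a • (x ⊗ₜ[T] Ideal.Quotient.mk (J ^ n) 1) := rfl
    rw [this, hx, smul_zero]

theorem baseChangeQuotPow_bijective (n : ℕ) : Function.Bijective (baseChangeQuotPow T' J n) := by
  constructor
  · refine (injective_iff_map_eq_zero (baseChangeQuotPow T' J n)).2 fun x hx => ?_
    obtain ⟨s, rfl⟩ := exists_eq_tmul_one T' J n x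
    rw [baseChangeQuotPow_tmul] at hx
    exact tmul_one_eq_zero T' J n s (Ideal.Quotient.eq_zero_iff_mem.1 hx)
  · intro y
    obtain ⟨s, rfl⟩ := Ideal.Quotient.mk_surjective y
    exact ⟨_, baseChangeQuotPow_tmul T' J n s⟩

/-- `T' ⊗ T / J ^ n ≅ T' / (J T') ^ n`. -/
def baseChangeQuotPowIso (n : ℕ) : (ModuleCat.baseChangeFunctor T').obj (quotPow J n) ≅
    quotPow (J.map (algebraMap T T')) n :=
  (LinearEquiv.ofBijective _ (baseChangeQuotPow_bijective T' J n)).toModuleIso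

theorem baseChangeQuotPowIso_naturality {n m : ℕ} (h : n ≤ m) :
    (ModuleCat.baseChangeFunctor T').map (quotPowMap J h) ≫ (baseChangeQuotPowIso T' J n).hom =
      (baseChangeQuotPowIso T' J m).hom ≫ quotPowMap (J.map (algebraMap T T')) h := by
  refine ModuleCat.hom_ext (LinearMap.ext fun x => ?_)
  obtain ⟨s, rfl⟩ := exists_eq_tmul_one T' J m x
  refine (baseChangeQuotPow_tmul T' J n s).trans ?_
  exact (congrArg (quotPowMap (J.map (algebraMap T T')) h).hom
    (baseChangeQuotPow_tmul T' J m s)).symm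

variable [Module.Flat T T']

/-- The base change of a projective resolution of `T / J ^ n`. -/
def baseChangeResolution {J : Ideal T} {n : ℕ} (P : ProjectiveResolution (quotPow J n)) :
    ProjectiveResolution (quotPow (J.map (algebraMap T T')) n) :=
  let Q := (ModuleCat.baseChangeFunctor T').mapProjectiveResolution P
  { complex := Q.complex
    projective := Q.projective
    π := Q.π ≫ (ChainComplex.single₀ _).map (baseChangeQuotPowIso T' J n).hom }

theorem baseChangeResolution_π_f_zero {J : Ideal T} {n : ℕ}
    (P : ProjectiveResolution (quotPow J n)) :
    (baseChangeResolution T' P).π.f 0 =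
      ((ModuleCat.baseChangeFunctor T').map
        (show P.complex.X 0 ⟶ quotPow J n from P.π.f 0) ≫ (baseChangeQuotPowIso T' J n).hom :) := by
  have h : ((HomologicalComplex.singleMapHomologicalComplex (ModuleCat.baseChangeFunctor T')
      (ComplexShape.down ℕ) 0).hom.app (quotPow J n)).f 0 =
      𝟙 ((ModuleCat.baseChangeFunctor T').obj (quotPow J n)) := by
    rw [HomologicalComplex.singleMapHomologicalComplex_hom_app_self]
    simp
    rfl
  change ((ModuleCat.baseChangeFunctor T').map (P.π.f 0) ≫
    ((HomologicalComplex.singleMapHomologicalComplex (ModuleCat.baseChangeFunctor T')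
      (ComplexShape.down ℕ) 0).hom.app (quotPow J n)).f 0) ≫
      ((ChainComplex.single₀ _).map (baseChangeQuotPowIso T' J n).hom).f 0 = _
  rw [h]
  exact congrArg₂ (· ≫ ·) (Category.comp_id _) (ChainComplex.single₀_map_f_zero _)

theorem baseChangeResolution_hom {J : Ideal T} {n m : ℕ} (h : n ≤ m)
    (P : ProjectiveResolution (quotPow J n)) (Q : ProjectiveResolution (quotPow J m))
    (φ : Q.complex ⟶ P.complex) (hφ : φ.f 0 ≫ P.π.f 0 = Q.π.f 0 ≫ quotPowMap J h) :
    (((ModuleCat.baseChangeFunctor T').mapHomologicalComplex _).map φ).f 0 ≫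
      (baseChangeResolution T' P).π.f 0 =
    (baseChangeResolution T' Q).π.f 0 ≫ quotPowMap (J.map (algebraMap T T')) h := by
  rw [baseChangeResolution_π_f_zero, baseChangeResolution_π_f_zero]
  have h1 : (ModuleCat.baseChangeFunctor T').map (φ.f 0) ≫ (ModuleCat.baseChangeFunctor T').map
      (show P.complex.X 0 ⟶ quotPow J n from P.π.f 0) = (ModuleCat.baseChangeFunctor T').map
        (show Q.complex.X 0 ⟶ quotPow J m from Q.π.f 0) ≫
      (ModuleCat.baseChangeFunctor T').map (quotPowMap J h) := by
    rw [← Functor.map_comp, ← Functor.map_comp]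
    exact congrArg (ModuleCat.baseChangeFunctor T').map hφ
  exact ProjectiveResolution.paste_squares h1 (baseChangeQuotPowIso_naturality T' J h)

variable {T'} in
omit [Module.Flat T T'] in
theorem baseChangeFunctor_map_comp {A B : ModuleCat.{u} T} (f : A ⟶ B) {N' : Type u}
    [AddCommGroup N'] [Module T N'] [Module T' N'] [IsScalarTower T T' N'] (z : B →ₗ[T] N') :
    (ModuleCat.baseChangeFunctor T').map f ≫ ModuleCat.ofHom (z.liftBaseChange T') =
      ModuleCat.ofHom ((z.comp f.hom).liftBaseChange T') := by
  refine ModuleCat.hom_ext ?_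
  refine TensorProduct.AlgebraTensorModule.ext fun s x => ?_
  rfl

-- By this adjunction a cochain over `T'` on the base-changed resolution is the same as a `T`-linear
-- cochain on the original resolution.
variable {T'} in
omit [Module.Flat T T'] in
theorem exists_eq_ofHom_liftBaseChange {A : ModuleCat.{u} T} {N' : Type u}
    [AddCommGroup N'] [Module T N'] [Module T' N'] [IsScalarTower T T' N']
    (z' : (ModuleCat.baseChangeFunctor T').obj A ⟶ ModuleCat.of T' N') :
    ∃ z : A →ₗ[T] N', z' = ModuleCat.ofHom (z.liftBaseChange T') :=
  ⟨(LinearMap.liftBaseChangeEquiv T').symm z'.hom,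
    ModuleCat.hom_ext ((LinearMap.liftBaseChangeEquiv T').apply_symm_apply z'.hom).symm⟩

variable {T'} in
omit [Module.Flat T T'] in
theorem ofHom_liftBaseChange_injective {A : ModuleCat.{u} T} {N' : Type u}
    [AddCommGroup N'] [Module T N'] [Module T' N'] [IsScalarTower T T' N'] {z w : A →ₗ[T] N'}
    (h : (ModuleCat.ofHom (z.liftBaseChange T') :
      (ModuleCat.baseChangeFunctor T').obj A ⟶ ModuleCat.of T' N') =
        ModuleCat.ofHom (w.liftBaseChange T')) : z = w :=
  (LinearMap.liftBaseChangeEquiv T').injective (congrArg ModuleCat.Hom.hom h)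

/-- A nonzero local cohomology class over a flat extension `T'` of a Noetherian ring `T` has a
coordinate which is a nonzero local cohomology class over `T`. -/
theorem exists_coordinate_ne_zero [IsNoetherianRing T] (i : ℕ) {N' N : Type u}
    [AddCommGroup N'] [Module T N'] [Module T' N'] [IsScalarTower T T' N']
    [AddCommGroup N] [Module T N] (C : Set (N' →ₗ[T] N))
    (hC : ∀ W : Submodule T N', W.FG → ∃ (r : ℕ) (π : Fin r → N' →ₗ[T] N)
      (σ : Fin r → N →ₗ[T] N'), (∀ j, π j ∈ C) ∧ ∀ x ∈ W, x = ∑ j, σ j (π j x))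
    (η' : (localCohomology (J.map (algebraMap T T')) i).obj (ModuleCat.of T' N')) (hη' : η' ≠ 0) :
    ∃ π ∈ C, ∃ η : (localCohomology J i).obj (ModuleCat.of T N), η ≠ 0 ∧
      ∀ (M' M : Type u) [AddCommGroup M'] [Module T M'] [Module T' M'] [IsScalarTower T T' M']
        [AddCommGroup M] [Module T M] (g' : N' →ₗ[T'] M') (g : N →ₗ[T] M) (ρ : M' →ₗ[T] M),
        (∀ x, ρ (g' x) = g (π x)) →
        ((localCohomology J i).map (ModuleCat.ofHom g)).hom η ≠ 0 →
        ((localCohomology (J.map (algebraMap T T')) i).map (ModuleCat.ofHom g')).hom η' ≠ 0 := by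
  choose P hP using fun n => ModuleCat.exists_projectiveResolution_finite (R := T) (T ⧸ J ^ n)
  let P' := fun n => baseChangeResolution T' (P n)
  let φ := fun (n m : ℕ) (h : n ≤ m) => ProjectiveResolution.lift (quotPowMap J h) (P m) (P n)
  have hφ : ∀ n m h, (φ n m h).f 0 ≫ (P n).π.f 0 = (P m).π.f 0 ≫ quotPowMap J h :=
    fun n m h => ProjectiveResolution.lift_commutes_zero _ _ _
  let φ' := fun (n m : ℕ) (h : n ≤ m) =>
    ((ModuleCat.baseChangeFunctor T').mapHomologicalComplex _).map (φ n m h)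
  have hφ' : ∀ n m h, (φ' n m h).f 0 ≫ (P' n).π.f 0 =
      (P' m).π.f 0 ≫ quotPowMap (J.map (algebraMap T T')) h :=
    fun n m h => baseChangeResolution_hom T' h (P n) (P m) (φ n m h) (hφ n m h)
  obtain ⟨n, z', hz'⟩ := exists_represents P' η'
  obtain ⟨z, rfl⟩ := exists_eq_ofHom_liftBaseChange (T' := T') (A := (P n).complex.X i) z'
  have hz : z.comp ((P n).complex.d (i + 1) i).hom = 0 := by
    refine ofHom_liftBaseChange_injective (T' := T') ?_
    refine (baseChangeFunctor_map_comp _ z).symm.trans ((hz'.cocycle (i + 1)).trans ?_)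
    exact ModuleCat.hom_ext (map_zero (LinearMap.liftBaseChangeEquiv T')).symm
  -- If every coordinate `π ∘ z` represented zero, the coordinates' coboundary expressions would
  -- glue to one for `z`.
  have key : ∃ π ∈ C, ∃ η : (localCohomology J i).obj (ModuleCat.of T N), η ≠ 0 ∧
      Represents P (ModuleCat.ofHom (π.comp z)) η := by
    by_contra! hcon
    have hex : ∀ π : N' →ₗ[T] N, ∃ η : (localCohomology J i).obj (ModuleCat.of T N),
        Represents P (ModuleCat.ofHom (π.comp z)) η := fun π => by
      refine exists_represents_of_cocycle P _ (ModuleCat.hom_ext ?_)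
      exact congrArg (π.comp ·) hz |>.trans (LinearMap.comp_zero π)
    have := hP n i
    -- The term of the resolution is finitely generated, so finitely many coordinates recover all
    -- values of `z`.
    obtain ⟨r, π, σ, hπ, hsum⟩ := hC (LinearMap.range z) (Module.Finite.iff_fg.1 inferInstance)
    choose η hη using fun j => hex (π j)
    have hη0 : ∀ j, η j = 0 := fun j => by
      by_contra h
      exact hcon (π j) (hπ j) (η j) h (hη j)
    choose m₀ hm₀ hw using fun j => (hη j).exists_eq_d_comp (hη0 j)
    -- A single stage at which all the finitely many coordinate cocycles are coboundaries.
    let m := n + ∑ j, m₀ j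
    have hnm : n ≤ m := Nat.le_add_right _ _
    have hjm : ∀ j, m₀ j ≤ m := fun j =>
      (Finset.single_le_sum (fun _ _ => Nat.zero_le _) (Finset.mem_univ j)).trans
        (Nat.le_add_left _ _)
    choose w hw using fun j => hw j m hnm (hjm j) (φ n m hnm) (hφ n m hnm)
    let w' : (P m).complex.X ((ComplexShape.up ℕ).prev i) →ₗ[T] N' := ∑ j, (σ j).comp (w j).hom
    have hw' : w'.comp ((P m).complex.d i _).hom = z.comp ((φ n m hnm).f i).hom := by
      refine LinearMap.ext fun x => ?_
      have h1 : ∀ j, (w j).hom (((P m).complex.d i _).hom x) =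
          π j (z (((φ n m hnm).f i).hom x)) := fun j => congr(($(hw j)).hom x)
      have h2 := hsum (z (((φ n m hnm).f i).hom x)) ⟨_, rfl⟩
      simp only [w', LinearMap.comp_apply, LinearMap.sum_apply, h1]
      exact h2.symm
    refine hη' (hz'.eq_zero hnm (φ' n m hnm) (hφ' n m hnm)
      (ModuleCat.ofHom (w'.liftBaseChange T')) ?_)
    refine (baseChangeFunctor_map_comp _ w').trans ?_
    rw [hw']
    exact (baseChangeFunctor_map_comp _ z).symm
  obtain ⟨π, hπ, η, hη, hrep⟩ := key
  refine ⟨π, hπ, η, hη, ?_⟩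
  intro M' M _ _ _ _ _ _ g' g ρ hρ hg hzero
  obtain ⟨m, hnm, hw⟩ := (hz'.map (ModuleCat.ofHom g')).exists_eq_d_comp hzero
  obtain ⟨w', hw'⟩ := hw m hnm le_rfl (φ' n m hnm) (hφ' n m hnm)
  obtain ⟨w, rfl⟩ := exists_eq_ofHom_liftBaseChange (T' := T')
    (A := (P m).complex.X ((ComplexShape.up ℕ).prev i)) w'
  have hw : w.comp ((P m).complex.d i _).hom =
      ((g'.restrictScalars T).comp z).comp ((φ n m hnm).f i).hom := by
    refine ofHom_liftBaseChange_injective (T' := T') ?_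
    refine (baseChangeFunctor_map_comp _ w).symm.trans (hw'.trans ?_)
    refine Eq.trans ?_ (baseChangeFunctor_map_comp _ _)
    refine congrArg (fun f => (φ' n m hnm).f i ≫ f) ?_
    refine ModuleCat.hom_ext ?_
    refine TensorProduct.AlgebraTensorModule.ext fun s x => ?_
    change g' (s • z x) = s • g' (z x)
    exact map_smul g' s (z x)
  -- If `w` bounds `g' ∘ z`, then `ρ ∘ w` bounds `ρ ∘ g' ∘ z = g ∘ π ∘ z`, which represents the
  -- image of `η` under `g`.
  refine hg ((hrep.map (ModuleCat.ofHom g)).eq_zero hnm (φ n m hnm) (hφ n m hnm)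
    (ModuleCat.ofHom (ρ.comp w)) (ModuleCat.hom_ext (LinearMap.ext fun x => ?_)))
  have h1 := congr(ρ ($hw x))
  exact h1.trans (hρ _)

end localCohomology

end

end BaseChangeResolution

/-! ### Frobenius stable bases and ascent of the two sharp properties. -/

section FrobeniusBasis

noncomputable section

universe u v

/-- `b` is a basis of the algebra `T'` over the ring `T` all of whose iterated Frobenius images
are bases as well. -/
def IsFrobeniusStable (p : ℕ) {T T' ι : Type*} [CommRing T] [CommRing T'] [Algebra T T']
    (b : Module.Basis ι T T') : Prop :=
  ∀ e : ℕ, ∃ b' : Module.Basis ι T T', ∀ i, b' i = b i ^ p ^ e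

section

variable {T T' ι : Type u} [CommRing T] [CommRing T'] [Algebra T T'] (p : ℕ) [Fact p.Prime]
  [CharP T p] [CharP T' p]

variable (T T') in
/-- The structure of a `T`-module on `F^e_* T'` for a `T`-algebra `T'`. -/
abbrev frobeniusPushforwardModule (e : ℕ) : Module T (FrobeniusPushforward T' p e) :=
  Module.compHom _ (algebraMap T T')

attribute [local instance] frobeniusPushforwardModule

omit [CharP T p] in
theorem frobeniusPushforward_isScalarTower (e : ℕ) :
    @IsScalarTower T T' (FrobeniusPushforward T' p e) _ _
      (frobeniusPushforwardModule T T' p e).toSMul where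
  smul_assoc a b c := by
    rw [Algebra.smul_def, mul_smul]
    rfl

variable {p} {b : Module.Basis ι T T'}

/-- Coordinates of `F^e_* T'` with respect to a basis. -/
def frobeniusCoord (e : ℕ) (b' : Module.Basis ι T T') (j : ι) :
    letI := frobeniusPushforwardModule T T' p e
    FrobeniusPushforward T' p e →ₗ[T] FrobeniusPushforward T p e :=
  letI := frobeniusPushforwardModule T T' p e
  { toFun := fun x => frobeniusElt p e (b'.coord j x)
    map_add' := fun x y => map_add (b'.coord j) x y
    map_smul' := fun a (x : T') => by
      change b'.coord j (algebraMap T T' a ^ p ^ e * x) = a ^ p ^ e * b'.coord j x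
      rw [← map_pow, ← Algebra.smul_def, map_smul, smul_eq_mul] }

-- From `x = ∑ x_i b_i` follows `x ^ p ^ e * f = ∑ (x_i ^ p ^ e * f) b_i ^ p ^ e`. This is the
-- compatibility of coordinates with `· F^e_* f`.
omit [CharP T p] in
theorem coord_pow_mul (e : ℕ) (b' : Module.Basis ι T T') (hb' : ∀ i, b' i = b i ^ p ^ e) (j : ι)
    (x : T') (f : T) :
    b'.coord j (x ^ p ^ e * algebraMap T T' f) = b.coord j x ^ p ^ e * f := by
  classical
  have hx : x ^ p ^ e = ∑ i ∈ (b.repr x).support, (b.repr x i) ^ p ^ e • b' i := by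
    conv_lhs => rw [← b.linearCombination_repr x, Finsupp.linearCombination_apply, Finsupp.sum]
    rw [sum_pow_char_pow]
    simp [smul_pow, hb']
  rw [mul_comm, ← Algebra.smul_def, map_smul, hx, map_sum, mul_comm, smul_eq_mul]
  congr 1
  simp only [map_smul, Module.Basis.coord_apply, Module.Basis.repr_self, smul_eq_mul,
    Finsupp.single_apply, mul_ite, mul_one, mul_zero, Finset.sum_ite_eq']
  split_ifs with h
  · rfl
  · rw [Finsupp.notMem_support_iff.1 h, zero_pow (pow_ne_zero _ (Fact.out : p.Prime).ne_zero)]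

theorem frobeniusCoord_frobeniusMul (e : ℕ) (b' : Module.Basis ι T T')
    (hb' : ∀ i, b' i = b i ^ p ^ e) (j : ι) (f : T) (x : T') :
    frobeniusCoord e b' j (frobeniusMul p e (algebraMap T T' f) x) =
      frobeniusMul p e f (b.coord j x) :=
  coord_pow_mul e b' hb' j x f

theorem exists_coord_of_fg (b : Module.Basis ι T T') (W : Submodule T T') (hW : W.FG) :
    ∃ (r : ℕ) (π : Fin r → T' →ₗ[T] T) (σ : Fin r → T →ₗ[T] T'),
      (∀ j, π j ∈ Set.range b.coord) ∧ ∀ x ∈ W, x = ∑ j, σ j (π j x) := by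
  classical
  obtain ⟨S, rfl⟩ := hW
  let U : Finset ι := S.biUnion fun x => (b.repr x).support
  let g := U.equivFin.symm
  refine ⟨U.card, fun j => b.coord (g j), fun j => LinearMap.toSpanSingleton T T' (b (g j)),
    fun j => ⟨_, rfl⟩, fun x hx => ?_⟩
  have h : ∀ x ∈ Submodule.span T (S : Set T'), (b.repr x).support ⊆ U := by
    intro x hx
    have : Submodule.span T (S : Set T') ≤
        (Finsupp.supported T T (U : Set ι)).comap (b.repr : T' →ₗ[T] ι →₀ T) := by
      refine Submodule.span_le.2 fun y hy => ?_
      refine (Finsupp.mem_supported T _).2 ?_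
      exact_mod_cast Finset.subset_biUnion_of_mem (fun x => (b.repr x).support) hy
    exact_mod_cast (Finsupp.mem_supported T _).1 (this hx)
  have hsum := Finsupp.sum_of_support_subset (b.repr x) (h x hx) (fun i a => a • b i) (by simp)
  rw [← Finsupp.linearCombination_apply, b.linearCombination_repr, ← Finset.sum_coe_sort U,
    ← g.sum_comp] at hsum
  exact hsum

/-- The coordinate `j` and the class `η` over `T` are chosen before `e`, so every one of the
infinitely many exponents that work for `η` works for `η'`, with the image of the same `f`. -/
theorem IsSharplyFInjective.of_isFrobeniusStable [IsNoetherianRing T] [IsLocalRing T]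
    [IsLocalRing T'] (hm : (IsLocalRing.maximalIdeal T).map (algebraMap T T') =
      IsLocalRing.maximalIdeal T') (hb : IsFrobeniusStable p b) {𝔞 : Ideal T} {t : ℝ}
    (h : ∀ (i : ℕ) (η : (localCohomology (IsLocalRing.maximalIdeal T) i).obj (ModuleCat.of T T)),
      η ≠ 0 → {e : ℕ | ∃ f ∈ 𝔞 ^ ⌈t * ((p : ℝ) ^ e - 1)⌉₊,
        ((localCohomology (IsLocalRing.maximalIdeal T) i).map
          (ModuleCat.ofHom (frobeniusMul p e f))).hom η ≠ 0}.Infinite) :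
    IsSharplyFInjective (𝔞.map (algebraMap T T')) t := by
  refine ⟨p, inferInstance, inferInstance, ?_⟩
  rw [← hm]
  intro i η' hη'
  have : Module.Flat T T' := by
    have := Module.Free.of_basis b
    infer_instance
  obtain ⟨_, ⟨j, rfl⟩, η, hη, H⟩ := localCohomology.exists_coordinate_ne_zero T'
    (IsLocalRing.maximalIdeal T) i (Set.range b.coord) (exists_coord_of_fg b) η' hη'
  refine (h i η hη).mono ?_
  rintro e ⟨f, hf, hne⟩
  obtain ⟨b', hb'⟩ := hb e
  have := frobeniusPushforward_isScalarTower (T := T) (T' := T') p e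
  refine ⟨algebraMap T T' f, by rw [← Ideal.map_pow]; exact Ideal.mem_map_of_mem _ hf, ?_⟩
  exact @H (FrobeniusPushforward T' p e) (FrobeniusPushforward T p e) _
    (frobeniusPushforwardModule T T' p e) _ this _ _
    (frobeniusMul p e (algebraMap T T' f)) (frobeniusMul p e f) (frobeniusCoord e b' j)
    (frobeniusCoord_frobeniusMul e b' hb' j f) hne

variable (T T' p) in
/-- The inclusion `F^e_* T → F^e_* T'`. -/
def frobeniusPushforwardMap (e : ℕ) :
    letI := frobeniusPushforwardModule T T' p e
    FrobeniusPushforward T p e →ₗ[T] FrobeniusPushforward T' p e :=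
  letI := frobeniusPushforwardModule T T' p e
  { toFun := fun x => frobeniusElt p e (algebraMap T T' x)
    map_add' := fun x y => map_add (algebraMap T T') x y
    map_smul' := fun a (x : T) => by
      change algebraMap T T' (a ^ p ^ e * x) = algebraMap T T' a ^ p ^ e * algebraMap T T' x
      rw [map_mul, map_pow] }

/-- The map sends `b_i ⊗ x` to `b_i ^ p ^ e * x`; it matches the decomposition of the source along
`b` with that of the target along `b'`. -/
theorem liftBaseChange_frobeniusPushforwardMap_bijective (e : ℕ) (b' : Module.Basis ι T T')
    (hb' : ∀ i, b' i = b i ^ p ^ e) :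
    letI := frobeniusPushforwardModule T T' p e
    haveI := frobeniusPushforward_isScalarTower (T := T) (T' := T') p e
    Function.Bijective ((frobeniusPushforwardMap T T' p e).liftBaseChange T') := by
  classical
  let := frobeniusPushforwardModule T T' p e
  have := frobeniusPushforward_isScalarTower (T := T) (T' := T') p e
  let E := (TensorProduct.equivFinsuppOfBasisLeft (N := FrobeniusPushforward T p e) b).symm
  have h : ∀ v : ι →₀ T, (frobeniusPushforwardMap T T' p e).liftBaseChange T'
      (E (show ι →₀ FrobeniusPushforward T p e from v)) =
      frobeniusElt p e (b'.repr.symm v) := by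
    intro v
    have h1 : E (show ι →₀ FrobeniusPushforward T p e from v) =
      Finsupp.sum (show ι →₀ FrobeniusPushforward T p e from v) fun i n => b i ⊗ₜ n :=
      TensorProduct.equivFinsuppOfBasisLeft_symm_apply _ _
    rw [h1, Finsupp.sum, map_sum, b'.repr_symm_apply, Finsupp.linearCombination_apply, Finsupp.sum]
    refine Finset.sum_congr rfl fun i _ => ?_
    rw [LinearMap.liftBaseChange_tmul, hb', Algebra.smul_def, mul_comm]
    rfl
  have hcomp : (frobeniusPushforwardMap T T' p e).liftBaseChange T' ∘ E =
    b'.repr.symm := funext h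
  rw [← Function.Bijective.of_comp_iff _ E.bijective, hcomp]
  exact b'.repr.symm.bijective

/-- For a `T'`-module `L` one has `L ⊗_T' F^e_* T' ≅ L ⊗_T' (T' ⊗_T F^e_* T) ≅ L ⊗_T F^e_* T`.
Purity over `T`, tested on `L` viewed as a `T`-module, then gives injectivity. -/
theorem IsPureLinearMap.frobeniusMul_of_basis (e : ℕ) (b' : Module.Basis ι T T')
    (hb' : ∀ i, b' i = b i ^ p ^ e) (f : T) (hf : IsPureLinearMap (frobeniusMul p e f)) :
    IsPureLinearMap (frobeniusMul p e (algebraMap T T' f)) := by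
  intro L _ _
  let : Module T L := Module.compHom L (algebraMap T T')
  have : IsScalarTower T T' L := ⟨fun a s l => by
    rw [Algebra.smul_def, mul_smul]
    rfl⟩
  let := frobeniusPushforwardModule T T' p e
  have := frobeniusPushforward_isScalarTower (T := T) (T' := T') p e
  let Θ := LinearEquiv.ofBijective ((frobeniusPushforwardMap T T' p e).liftBaseChange T')
    (liftBaseChange_frobeniusPushforwardMap_bijective (b := b) e b' hb')
  refine (injective_iff_map_eq_zero _).2 fun z hz => ?_
  obtain ⟨l, rfl⟩ : ∃ l : L, z = l ⊗ₜ 1 :=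
    ⟨TensorProduct.rid T' L z, ((TensorProduct.rid T' L).symm_apply_apply z).symm⟩
  have h1 : (frobeniusMul p e (algebraMap T T' f)) 1 =
      Θ (1 ⊗ₜ frobeniusMul p e f 1) := by
    change frobeniusElt p e (1 ^ p ^ e * algebraMap T T' f) =
      frobeniusElt p e (1 ^ p ^ e * algebraMap T T' (1 ^ p ^ e * f))
    simp
  rw [LinearMap.lTensor_tmul, h1] at hz
  have h2 : l ⊗ₜ[T'] ((1 : T') ⊗ₜ[T] frobeniusMul p e f 1) = 0 := by
    apply (LinearEquiv.lTensor L Θ).injective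
    rw [map_zero]
    exact hz
  have h3 := congrArg (TensorProduct.AlgebraTensorModule.cancelBaseChange T T' T' L
    (FrobeniusPushforward T p e)) h2
  rw [TensorProduct.AlgebraTensorModule.cancelBaseChange_tmul, one_smul, map_zero] at h3
  have h4 : l ⊗ₜ[T] (1 : T) = 0 := by
    apply hf L
    rw [map_zero]
    exact h3
  have h5 := congrArg (TensorProduct.rid T L) h4
  rw [TensorProduct.rid_tmul, one_smul, map_zero] at h5
  rw [h5, TensorProduct.zero_tmul]

theorem IsSharplyFPure.of_isFrobeniusStable (hb : IsFrobeniusStable p b) {𝔞 : Ideal T} {t : ℝ}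
    (h : {e : ℕ | ∃ f ∈ 𝔞 ^ ⌈t * ((p : ℝ) ^ e - 1)⌉₊,
      IsPureLinearMap (frobeniusMul p e f)}.Infinite) :
    IsSharplyFPure (𝔞.map (algebraMap T T')) t := by
  refine ⟨p, inferInstance, inferInstance, h.mono ?_⟩
  rintro e ⟨f, hf, hpure⟩
  obtain ⟨b', hb'⟩ := hb e
  exact ⟨algebraMap T T' f, by rw [← Ideal.map_pow]; exact Ideal.mem_map_of_mem _ hf,
    hpure.frobeniusMul_of_basis e b' hb' f⟩

end

end

end FrobeniusBasis

/-! ### Ascent along isomorphisms, localizations and algebraic extensions of perfect fields. -/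

section Ascent

noncomputable section

theorem IsFrobeniusStable.map {p : ℕ} {T T' T'' ι : Type*} [CommRing T] [CommRing T']
    [CommRing T''] [Algebra T T'] [Algebra T T''] {b : Module.Basis ι T T'}
    (hb : IsFrobeniusStable p b) (e : T' ≃ₐ[T] T'') : IsFrobeniusStable p (b.map e.toLinearEquiv) := by
  intro n
  obtain ⟨b', hb'⟩ := hb n
  exact ⟨b'.map e.toLinearEquiv, fun i => by simp [hb']⟩

/-- A property of pairs that ascends along local homomorphisms `T → T'` with `𝔪_T T' = 𝔪_T'` such
that `T'` has a Frobenius stable basis over `T`. -/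
def PairProperty.Ascends (Φ : PairProperty) : Prop :=
  ∀ (T T' ι : Type) [CommRing T] [CommRing T'] [IsLocalRing T] [IsLocalRing T']
    [IsNoetherianRing T] [Algebra T T'] (p : ℕ) [Fact p.Prime] [CharP T p]
    (b : Module.Basis ι T T'), IsFrobeniusStable p b →
    (IsLocalRing.maximalIdeal T).map (algebraMap T T') = IsLocalRing.maximalIdeal T' →
    ∀ 𝔞 : Ideal T, Φ T 𝔞 → Φ T' (𝔞.map (algebraMap T T'))

theorem charP_of_algebra {T T' : Type*} [CommRing T] [CommRing T'] [Algebra T T'] [Nontrivial T']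
    (p : ℕ) [Fact p.Prime] [CharP T p] : CharP T' p := by
  refine (CharP.charP_iff_prime_eq_zero Fact.out).2 ?_
  rw [← map_natCast (algebraMap T T'), CharP.cast_eq_zero, map_zero]

theorem ascends_isSharplyFPure (t : ℝ) :
    PairProperty.Ascends fun _ _ _ 𝔟 => IsSharplyFPure 𝔟 t := by
  intro T T' ι _ _ _ _ _ _ p _ hT₀ b hb _ 𝔞 h
  have : CharP T' p := charP_of_algebra (T := T) p
  obtain ⟨q, hq, hT, h⟩ := h
  obtain rfl : q = p := CharP.eq T hT hT₀
  exact IsSharplyFPure.of_isFrobeniusStable hb h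

theorem ascends_isSharplyFInjective (t : ℝ) :
    PairProperty.Ascends fun _ _ _ 𝔟 => IsSharplyFInjective 𝔟 t := by
  intro T T' ι _ _ _ _ _ _ p _ hT₀ b hb hm 𝔞 h
  have : CharP T' p := charP_of_algebra (T := T) p
  obtain ⟨q, hq, hT, h⟩ := h
  obtain rfl : q = p := CharP.eq T hT hT₀
  exact IsSharplyFInjective.of_isFrobeniusStable hm hb h

variable {Φ : PairProperty}

/-- An isomorphism is an extension with the one-element basis `1`, all of whose powers are `1`. -/
theorem PairProperty.Ascends.of_ringEquiv (hΦ : Φ.Ascends) {T T' : Type} [CommRing T] [CommRing T']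
    [IsLocalRing T] [IsLocalRing T'] [IsNoetherianRing T] (p : ℕ) [Fact p.Prime] [CharP T p]
    (e : T ≃+* T') {𝔞 : Ideal T} (h : Φ T 𝔞) : Φ T' (𝔞.map e) := by
  let := (e : T →+* T').toAlgebra
  let E : T ≃ₐ[T] T' := AlgEquiv.ofRingEquiv (f := e) fun _ => rfl
  refine hΦ T T' Unit p ((Module.Basis.singleton Unit T).map E.toLinearEquiv) ?_ ?_ 𝔞 h
  · exact IsFrobeniusStable.map (fun n => ⟨Module.Basis.singleton Unit T, by simp⟩) E
  · exact IsLocalRing.eq_maximalIdeal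
      (Ideal.map_isMaximal_of_equiv e (p := IsLocalRing.maximalIdeal T))

/-- Since `𝔭 S'` is the prime `P` and `S'` is integral over `S`, no other prime of `S'` lies over
`𝔭`. Inverting the image of `S ∖ 𝔭` therefore already yields `S'_P`, and `c` remains a basis after
localization. -/
theorem PairProperty.Ascends.localization (hΦ : Φ.Ascends) {S S' ι : Type} [CommRing S]
    [CommRing S'] [Algebra S S'] [IsNoetherianRing S] (p : ℕ) [Fact p.Prime] (hp : (p : S) = 0)
    [Algebra.IsIntegral S S'] (c : Module.Basis ι S S') (hc : IsFrobeniusStable p c)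
    (𝔭 : Ideal S) [𝔭.IsPrime] (P : Ideal S') [P.IsPrime] (hP : 𝔭.map (algebraMap S S') = P)
    (𝔟 : Ideal S) (h : Φ (Localization.AtPrime 𝔭) (𝔟.map (algebraMap _ _))) :
    Φ (Localization.AtPrime P) ((𝔟.map (algebraMap S S')).map (algebraMap _ _)) := by
  have hP' : P ≠ ⊤ := Ideal.IsPrime.ne_top inferInstance
  have : Nontrivial S' := ⟨0, 1, fun h01 => hP' ((Ideal.eq_top_iff_one P).2 (h01 ▸ P.zero_mem))⟩
  have : Module.Free S S' := Module.Free.of_basis c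
  have hlies : P.comap (algebraMap S S') = 𝔭 := by
    rw [← hP]; exact Ideal.comap_map_eq_self_of_faithfullyFlat 𝔭
  have hover : 𝔭.primesOver S' = {P} := by
    ext Q
    constructor
    · rintro ⟨hQ, hQ'⟩
      have hle : P ≤ Q := by
        rw [← hP, Ideal.map_le_iff_le_comap]
        exact hQ'.over.le
      by_contra hne
      -- Incomparability: a prime strictly containing `P` cannot have the same contraction.
      have := Ideal.IsIntegral.comap_lt_comap (R := S) (lt_of_le_of_ne hle (Ne.symm hne))
      rw [hlies] at this
      exact this.ne hQ'.over
    · rintro rfl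
      exact ⟨inferInstance, ⟨hlies.symm⟩⟩
  have hloc : IsLocalization (Algebra.algebraMapSubmonoid S' 𝔭.primeCompl)
      (Localization.AtPrime P) := by
    refine (IsLocalization.iff_of_le_of_exists_dvd _ P.primeCompl ?_ ?_).2 inferInstance
    · rintro _ ⟨s, hs, rfl⟩ hsP
      exact hs (hlies.le hsP)
    · intro x hx
      obtain ⟨r, hr, hxr⟩ :=
        Ideal.exists_notMem_dvd_algebraMap_of_primesOver_eq_singleton hover x hx
      exact ⟨_, ⟨r, hr, rfl⟩, hxr⟩
  let : Algebra (Localization.AtPrime 𝔭) (Localization.AtPrime P) :=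
    (Localization.localRingHom 𝔭 P (algebraMap S S') hlies.symm).toAlgebra
  have : IsScalarTower S (Localization.AtPrime 𝔭) (Localization.AtPrime P) :=
    .of_algebraMap_eq fun x => by
      rw [RingHom.algebraMap_toAlgebra, Localization.localRingHom_to_map,
        ← IsScalarTower.algebraMap_apply]
  have : CharP (Localization.AtPrime 𝔭) p := by
    refine (CharP.charP_iff_prime_eq_zero Fact.out).2 ?_
    rw [← map_natCast (algebraMap S _), hp, map_zero]
  have key : (𝔟.map (algebraMap S S')).map (algebraMap S' (Localization.AtPrime P)) =
      (𝔟.map (algebraMap S (Localization.AtPrime 𝔭))).map (algebraMap _ _) := by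
    rw [Ideal.map_map, Ideal.map_map, ← IsScalarTower.algebraMap_eq,
      ← IsScalarTower.algebraMap_eq]
  rw [key]
  refine hΦ _ _ ι p
    (c.localizationLocalization (Localization.AtPrime 𝔭) 𝔭.primeCompl (Localization.AtPrime P))
    ?_ ?_ _ h
  · intro e
    obtain ⟨c', hc'⟩ := hc e
    exact ⟨c'.localizationLocalization (Localization.AtPrime 𝔭) 𝔭.primeCompl
      (Localization.AtPrime P), fun i => by simp [hc']⟩
  · rw [← Localization.AtPrime.map_eq_maximalIdeal, ← Localization.AtPrime.map_eq_maximalIdeal,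
      Ideal.map_map, ← IsScalarTower.algebraMap_eq, IsScalarTower.algebraMap_eq S S',
      ← Ideal.map_map, hP]

/-- The iterated Frobenius of `K` is bijective and semilinear over the iterated Frobenius
automorphism of `k`, so it carries bases to bases. -/
theorem isFrobeniusStable_of_perfectField {k K ι : Type*} [Field k] [Field K] [Algebra k K]
    (p : ℕ) [Fact p.Prime] [CharP k p] [PerfectRing k p] [CharP K p] [PerfectRing K p]
    (b : Module.Basis ι k K) : IsFrobeniusStable p b := by
  intro e
  let σ : k ≃+* k := iterateFrobeniusEquiv k p e
  let τ : K ≃+* K := iterateFrobeniusEquiv K p e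
  have hτ : ∀ x, τ x = x ^ p ^ e := fun x => iterateFrobeniusEquiv_apply K p e x
  have hσ : ∀ x, σ x = x ^ p ^ e := fun x => iterateFrobeniusEquiv_apply k p e x
  refine ⟨Module.Basis.mk (v := fun i => b i ^ p ^ e) ?_ ?_, fun i => Module.Basis.mk_apply ..⟩
  · rw [linearIndependent_iff']
    intro s g hg i hi
    have h : ∑ j ∈ s, σ.symm (g j) • b j = 0 := by
      apply τ.injective
      rw [map_zero, ← hg, map_sum]
      refine Finset.sum_congr rfl fun j _ => ?_
      rw [hτ, smul_pow, ← hσ, σ.apply_symm_apply]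
    simpa using linearIndependent_iff'.1 b.linearIndependent s _ h i hi
  · intro x _
    rw [← τ.apply_symm_apply x, hτ, ← b.linearCombination_repr (τ.symm x),
      Finsupp.linearCombination_apply, Finsupp.sum, sum_pow_char_pow]
    refine Submodule.sum_mem _ fun j _ => ?_
    rw [smul_pow]
    exact Submodule.smul_mem _ _ (Submodule.subset_span ⟨j, rfl⟩)

theorem IsFrobeniusStable.baseChange {p : ℕ} {k K S ι : Type*} [CommRing k] [CommRing K]
    [CommRing S] [Algebra k K] [Algebra k S] {b : Module.Basis ι k K}
    (hb : IsFrobeniusStable p b) : IsFrobeniusStable p (Algebra.TensorProduct.basis S b) := by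
  intro e
  obtain ⟨b', hb'⟩ := hb e
  exact ⟨Algebra.TensorProduct.basis S b', fun i => by simp [hb']⟩

/-- Ascent along an algebraic extension of perfect fields `K / k`. -/
theorem PairProperty.Ascends.baseChange (hΦ : Φ.Ascends) {k K S S' : Type} [Field k] [Field K]
    [Algebra k K] [Algebra.IsAlgebraic k K] [CommRing S] [CommRing S'] [Algebra k S]
    [IsNoetherianRing S] (p : ℕ) [Fact p.Prime] [CharP k p] [PerfectRing k p] [PerfectField K]
    (e : S ⊗[k] K ≃+* S')
    (𝔭 𝔟 : Ideal S) [𝔭.IsPrime] (P 𝔟' : Ideal S') [P.IsPrime]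
    (hP : (𝔭.map (algebraMap S (S ⊗[k] K))).map e = P)
    (h𝔟 : (𝔟.map (algebraMap S (S ⊗[k] K))).map e = 𝔟')
    (h : Φ (Localization.AtPrime 𝔭) (𝔟.map (algebraMap _ _))) :
    Φ (Localization.AtPrime P) (𝔟'.map (algebraMap _ _)) := by
  have : CharP K p := charP_of_algebra (T := k) p
  have : ExpChar K p := .prime Fact.out
  have : PerfectRing K p := PerfectField.toPerfectRing p
  let := ((e : S ⊗[k] K →+* S').comp (algebraMap S (S ⊗[k] K))).toAlgebra
  let E : S ⊗[k] K ≃ₐ[S] S' := AlgEquiv.ofRingEquiv (f := e) fun _ => rfl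
  have : Algebra.IsIntegral S (S ⊗[k] K) := inferInstance
  have : Algebra.IsIntegral S S' := this.of_surjective E.toAlgHom E.surjective
  have hS : ∀ I : Ideal S, I.map (algebraMap S S') = (I.map (algebraMap S (S ⊗[k] K))).map e :=
    fun I => by rw [← Ideal.map_coe e, Ideal.map_map]; rfl
  rw [← h𝔟, ← hS]
  rw [← hS] at hP
  refine hΦ.localization p ?_ _ ((isFrobeniusStable_of_perfectField p
    (Module.Basis.ofVectorSpace k K)).baseChange.map E) 𝔭 P hP 𝔟 h
  rw [← map_natCast (algebraMap k S), CharP.cast_eq_zero, map_zero]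

end

end Ascent

/-! ### Transfer of polynomial statements between `ℂ` and almost all `F̄_p`. -/

section PolynomialApproximation

noncomputable section

section UltraProd

variable (ℱ : Ultrafilter Nat.Primes) {A B : Nat.Primes → Type} [∀ p, CommRing (A p)]
  [∀ p, CommRing (B p)]

theorem exists_ulim_eq (z : UltraProd ℱ A) : ∃ x : ∀ p, A p, ulim ℱ x = z :=
  Ideal.Quotient.mk_surjective z

theorem UltraProd.map_ulim (φ : ∀ p, A p →+* B p) (x : ∀ p, A p) :
    UltraProd.map ℱ φ (ulim ℱ x) = ulim ℱ fun p => φ p (x p) := rfl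

theorem ulim_add (x y : ∀ p, A p) : ulim ℱ x + ulim ℱ y = ulim ℱ fun p => x p + y p := rfl

theorem ulim_mul (x y : ∀ p, A p) : ulim ℱ x * ulim ℱ y = ulim ℱ fun p => x p * y p := rfl

theorem ulim_pow (x : ∀ p, A p) (n : ℕ) : ulim ℱ x ^ n = ulim ℱ fun p => x p ^ n := rfl

theorem ulim_sum {ι : Type*} (s : Finset ι) (x : ι → ∀ p, A p) :
    ∑ i ∈ s, ulim ℱ (x i) = ulim ℱ fun p => ∑ i ∈ s, x i p := by
  rw [← map_sum]
  congr 1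
  ext p
  simp

theorem ulim_zero : (0 : UltraProd ℱ A) = ulim ℱ fun _ => 0 := rfl

theorem ulim_one : (1 : UltraProd ℱ A) = ulim ℱ fun _ => 1 := rfl

end UltraProd

variable {ℱ : Ultrafilter Nat.Primes} {α : UltraProd ℱ FBar ≃+* ℂ} {n : ℕ}

variable (α) in
/-- A family of homomorphisms `F̄_p[X] → T_p` induces a homomorphism `ℂ[X] → ulim_p T_p`. -/
def hullMap {T : Nat.Primes → Type} [∀ p, CommRing (T p)]
    (g : ∀ p, MvPolynomial (Fin n) (FBar p) →+* T p) :
    MvPolynomial (Fin n) ℂ →+* UltraProd ℱ T :=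
  (UltraProd.map ℱ g).comp (polyHull α n)

variable (α) in
/-- A representative in `∏_p F̄_p` of a complex number. -/
def approx (a : ℂ) : ∀ p, FBar p := (exists_ulim_eq ℱ (α.symm a)).choose

variable (α) in
theorem ulim_approx (a : ℂ) : ulim ℱ (approx α a) = α.symm a :=
  (exists_ulim_eq ℱ (α.symm a)).choose_spec

theorem polyHull_C (a : ℂ) (ap : ∀ p, FBar p) (h : α.symm a = ulim ℱ ap) :
    polyHull α n (MvPolynomial.C a) = ulim ℱ fun p => MvPolynomial.C (ap p) := by
  simp only [polyHull, MvPolynomial.coe_eval₂Hom, MvPolynomial.eval₂_C, RingHom.comp_apply]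
  change UltraProd.map ℱ _ (α.symm a) = _
  rw [h, UltraProd.map_ulim]

theorem polyHull_X (i : Fin n) :
    polyHull α n (MvPolynomial.X i) = ulim ℱ fun _ => MvPolynomial.X i := by
  simp [polyHull]

section

variable {T : Nat.Primes → Type} [∀ p, CommRing (T p)]
    {g : ∀ p, MvPolynomial (Fin n) (FBar p) →+* T p}

theorem hullMap_apply {f : MvPolynomial (Fin n) ℂ} {fp : ∀ p, MvPolynomial (Fin n) (FBar p)}
    (h : IsPolyApprox α f fp) : hullMap α g f = ulim ℱ fun p => g p (fp p) := by
  rw [hullMap, RingHom.comp_apply, h, UltraProd.map_ulim]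

theorem hullMap_C (a : ℂ) :
    hullMap α g (MvPolynomial.C a) = ulim ℱ fun p => g p (MvPolynomial.C (approx α a p)) :=
  hullMap_apply (polyHull_C _ _ (ulim_approx α a).symm)

theorem hullMap_X (i : Fin n) :
    hullMap α g (MvPolynomial.X i) = ulim ℱ fun p => g p (MvPolynomial.X i) :=
  hullMap_apply (polyHull_X i)

end

namespace IsPolyApprox

theorem exists_approx (f : MvPolynomial (Fin n) ℂ) : ∃ fp, IsPolyApprox α f fp := by
  obtain ⟨fp, h⟩ := exists_ulim_eq ℱ (polyHull α n f)
  exact ⟨fp, h.symm⟩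

variable {f g : MvPolynomial (Fin n) ℂ} {fp gp : ∀ p, MvPolynomial (Fin n) (FBar p)}

theorem eventually_eq (h : IsPolyApprox α f fp) (h' : IsPolyApprox α f gp) :
    ∀ᶠ p in (ℱ : Filter Nat.Primes), fp p = gp p :=
  (ulim_eq_ulim_iff ..).1 (h.symm.trans h')

theorem congr (h : IsPolyApprox α f fp) (h' : ∀ᶠ p in (ℱ : Filter Nat.Primes), fp p = gp p) :
    IsPolyApprox α f gp :=
  h.trans ((ulim_eq_ulim_iff ..).2 h')

protected theorem mul (hf : IsPolyApprox α f fp) (hg : IsPolyApprox α g gp) :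
    IsPolyApprox α (f * g) fun p => fp p * gp p := by
  rw [IsPolyApprox, map_mul, hf, hg, ulim_mul]

protected theorem sum {ι : Type*} (s : Finset ι) {f : ι → MvPolynomial (Fin n) ℂ}
    {fp : ι → ∀ p, MvPolynomial (Fin n) (FBar p)} (h : ∀ i, IsPolyApprox α (f i) (fp i)) :
    IsPolyApprox α (∑ i ∈ s, f i) fun p => ∑ i ∈ s, fp i p := by
  rw [IsPolyApprox, map_sum, ← ulim_sum]
  exact Finset.sum_congr rfl fun i _ => h i

protected theorem zero : IsPolyApprox α (0 : MvPolynomial (Fin n) ℂ) fun _ => 0 := by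
  rw [IsPolyApprox, map_zero]; rfl

protected theorem one : IsPolyApprox α (1 : MvPolynomial (Fin n) ℂ) fun _ => 1 := by
  rw [IsPolyApprox, map_one]; rfl

protected theorem C (a : ℂ) : IsPolyApprox α (MvPolynomial.C (σ := Fin n) a) fun p => .C (approx α a p) :=
  polyHull_C _ _ (ulim_approx α a).symm

/-- Both sides are ring homomorphisms in `f` and agree on constants and variables. Complex points
thus have approximating points, which replaces any direct analysis of `polyHull`. -/
theorem eval (hf : IsPolyApprox α f fp) (x : Fin n → ℂ) :
    α.symm (MvPolynomial.eval x f) =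
      ulim ℱ fun p => MvPolynomial.eval (fun i => approx α (x i) p) (fp p) := by
  rw [← hullMap_apply (g := fun p => MvPolynomial.eval fun i => approx α (x i) p) hf]
  change ((α.symm : ℂ →+* UltraProd ℱ FBar).comp (MvPolynomial.eval x)) f = _
  congr 1
  refine MvPolynomial.ringHom_ext (fun a => ?_) fun i => ?_
  · rw [hullMap_C]
    simp [ulim_approx]
  · rw [hullMap_X]
    simp [ulim_approx]

theorem eval_eq_zero_iff (hf : IsPolyApprox α f fp) (x : Fin n → ℂ) :
    MvPolynomial.eval x f = 0 ↔ ∀ᶠ p in (ℱ : Filter Nat.Primes),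
      MvPolynomial.eval (fun i => approx α (x i) p) (fp p) = 0 := by
  rw [← ulim_eq_ulim_iff ℱ (fun p => MvPolynomial.eval (fun i => approx α (x i) p) (fp p))
    fun _ => 0, ← hf.eval, ← ulim_zero, map_eq_zero_iff _ α.symm.injective]

/-- A complex polynomial is determined by its values, and values can be compared by evaluation at
approximating points. -/
theorem eq_zero_iff (hf : IsPolyApprox α f fp) :
    f = 0 ↔ ∀ᶠ p in (ℱ : Filter Nat.Primes), fp p = 0 := by
  constructor
  · rintro rfl
    exact hf.eventually_eq .zero
  · intro h
    refine MvPolynomial.funext fun x => ?_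
    rw [map_zero, hf.eval_eq_zero_iff]
    filter_upwards [h] with p hp
    rw [hp, map_zero]

theorem eventually_ne_zero (hf : IsPolyApprox α f fp) (h : f ≠ 0) :
    ∀ᶠ p in (ℱ : Filter Nat.Primes), fp p ≠ 0 :=
  Ultrafilter.eventually_not.2 fun h' => h (hf.eq_zero_iff.2 h')

protected theorem sub (hf : IsPolyApprox α f fp) (hg : IsPolyApprox α g gp) :
    IsPolyApprox α (f - g) fun p => fp p - gp p := by
  rw [IsPolyApprox, map_sub, hf, hg]; rfl

theorem eq_of_eventually_eq (hf : IsPolyApprox α f fp) (hg : IsPolyApprox α g gp)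
    (h : ∀ᶠ p in (ℱ : Filter Nat.Primes), fp p = gp p) : f = g := by
  rw [← sub_eq_zero, (hf.sub hg).eq_zero_iff]
  filter_upwards [h] with p hp
  rw [hp, sub_self]

protected theorem monomial (d : Fin n →₀ ℕ) (c : ℂ) (cp : ∀ p, FBar p) (h : α.symm c = ulim ℱ cp) :
    IsPolyApprox α (MvPolynomial.monomial d c) fun p => MvPolynomial.monomial d (cp p) := by
  have hX : polyHull α n (MvPolynomial.monomial d 1) =
      ulim ℱ fun _ => MvPolynomial.monomial d 1 := by
    rw [MvPolynomial.monomial_eq, map_mul, map_one, map_one, one_mul, Finsupp.prod, map_prod]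
    simp only [map_pow, polyHull_X]
    rw [← Finset.prod_congr rfl fun i _ => map_pow _ _ _, ← map_prod]
    congr 1
    ext1 p
    rw [MvPolynomial.monomial_eq, Finset.prod_apply, map_one, one_mul]
    rfl
  have h1 : IsPolyApprox α (MvPolynomial.C (σ := Fin n) c) fun p => .C (cp p) :=
    polyHull_C _ _ h
  simpa [MvPolynomial.C_mul_monomial] using h1.mul hX

/-- A family of polynomials of bounded degree approximates a polynomial. -/
theorem exists_of_totalDegree_le (N : ℕ) (fp : ∀ p, MvPolynomial (Fin n) (FBar p))
    (h : ∀ᶠ p in (ℱ : Filter Nat.Primes), (fp p).totalDegree ≤ N) :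
    ∃ f, IsPolyApprox α f fp := by
  classical
  let s : Finset (Fin n →₀ ℕ) := (Finsupp.finite_of_degree_le N).toFinset
  refine ⟨∑ d ∈ s, MvPolynomial.monomial d (α (ulim ℱ fun p => (fp p).coeff d)),
    (IsPolyApprox.sum s fun d => IsPolyApprox.monomial d _ _ (α.symm_apply_apply _)).congr ?_⟩
  filter_upwards [h] with p hp
  refine Eq.trans ?_ (MvPolynomial.support_sum_monomial_coeff (fp p))
  refine (Finset.sum_subset (fun d hd => ?_) fun d _ hd => ?_).symm
  · simp only [s, Set.Finite.mem_toFinset]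
    exact (MvPolynomial.le_totalDegree hd).trans hp
  · rw [MvPolynomial.notMem_support_iff.1 hd, map_zero]

theorem eventually_totalDegree_le (hf : IsPolyApprox α f fp) :
    ∀ᶠ p in (ℱ : Filter Nat.Primes), (fp p).totalDegree ≤ f.totalDegree := by
  classical
  have h := IsPolyApprox.sum f.support fun d =>
    IsPolyApprox.monomial d (f.coeff d) _ (ulim_approx α (f.coeff d)).symm
  rw [MvPolynomial.support_sum_monomial_coeff] at h
  filter_upwards [hf.eventually_eq h] with p hp
  rw [hp]
  refine MvPolynomial.totalDegree_finsetSum_le fun d hd => ?_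
  exact (MvPolynomial.totalDegree_monomial_le _ _).trans (MvPolynomial.le_totalDegree hd)

theorem isUnit_iff (hf : IsPolyApprox α f fp) :
    IsUnit f ↔ ∀ᶠ p in (ℱ : Filter Nat.Primes), IsUnit (fp p) := by
  constructor
  · intro h
    obtain ⟨g, hg⟩ := h.exists_right_inv
    obtain ⟨gp, hgp⟩ := exists_approx (α := α) g
    have h1 := hf.mul hgp
    rw [hg] at h1
    filter_upwards [h1.eventually_eq .one] with p hp
    exact IsUnit.of_mul_eq_one _ hp
  · intro h
    obtain ⟨g, hg⟩ := exists_of_totalDegree_le (α := α) 0 (fun p => Ring.inverse (fp p)) <| by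
      filter_upwards [h] with p hp
      have h1 := Ring.mul_inverse_cancel _ hp
      have h2 := congrArg MvPolynomial.totalDegree h1
      rw [MvPolynomial.totalDegree_mul_of_isDomain hp.ne_zero (fun h0 => by simp [h0] at h1),
        MvPolynomial.totalDegree_one] at h2
      omega
    refine IsUnit.of_mul_eq_one g ((hf.mul hg).eq_of_eventually_eq .one ?_)
    filter_upwards [h] with p hp
    exact Ring.mul_inverse_cancel _ hp

/-- Approximations of a prime element are prime for almost all `p`. -/
theorem eventually_prime (hf : IsPolyApprox α f fp) (h : Prime f) :
    ∀ᶠ p in (ℱ : Filter Nat.Primes), Prime (fp p) := by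
  suffices H : ∀ᶠ p in (ℱ : Filter Nat.Primes), Irreducible (fp p) by
    filter_upwards [H] with p hp using hp.prime
  by_contra hcon
  rw [← Ultrafilter.eventually_not] at hcon
  have hunit : ∀ᶠ p in (ℱ : Filter Nat.Primes), ¬ IsUnit (fp p) :=
    Ultrafilter.eventually_not.2 fun h' => h.not_isUnit (hf.isUnit_iff.2 h')
  have hex : ∀ p, ∃ u v : MvPolynomial (Fin n) (FBar p), ¬ Irreducible (fp p) → ¬ IsUnit (fp p) →
      fp p = u * v ∧ ¬ IsUnit u ∧ ¬ IsUnit v := by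
    intro p
    by_cases h1 : Irreducible (fp p)
    · exact ⟨0, 0, fun h2 => absurd h1 h2⟩
    by_cases h2 : IsUnit (fp p)
    · exact ⟨0, 0, fun _ h3 => absurd h2 h3⟩
    rw [irreducible_iff] at h1
    push Not at h1
    obtain ⟨u, v, huv, hu, hv⟩ := h1 h2
    exact ⟨u, v, fun _ _ => ⟨huv, hu, hv⟩⟩
  choose u v huv using hex
  have huv : ∀ᶠ p in (ℱ : Filter Nat.Primes),
      fp p = u p * v p ∧ ¬ IsUnit (u p) ∧ ¬ IsUnit (v p) := by
    filter_upwards [hcon, hunit] with p h1 h2 using huv p h1 h2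
  -- The factors of `f_p` have degree at most that of `f`, so they approximate complex polynomials
  -- `U` and `V` with `f = U * V`.
  have hdeg : ∀ᶠ p in (ℱ : Filter Nat.Primes), (u p).totalDegree ≤ f.totalDegree ∧
      (v p).totalDegree ≤ f.totalDegree := by
    filter_upwards [huv, hf.eventually_totalDegree_le, hf.eventually_ne_zero h.ne_zero]
      with p ⟨h1, _⟩ h2 h3
    rw [h1] at h3
    rw [h1, MvPolynomial.totalDegree_mul_of_isDomain (left_ne_zero_of_mul h3)
      (right_ne_zero_of_mul h3)] at h2
    omega
  obtain ⟨U, hU⟩ := exists_of_totalDegree_le (α := α) _ u (hdeg.mono fun _ h => h.1)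
  obtain ⟨V, hV⟩ := exists_of_totalDegree_le (α := α) _ v (hdeg.mono fun _ h => h.2)
  have hUV : f = U * V := hf.eq_of_eventually_eq (hU.mul hV) (huv.mono fun _ h => h.1)
  rcases h.irreducible.isUnit_or_isUnit hUV with h1 | h1
  · obtain ⟨p, h2, h3⟩ := ((hU.isUnit_iff.1 h1).and huv).exists
    exact h3.2.1 h2
  · obtain ⟨p, h2, h3⟩ := ((hV.isUnit_iff.1 h1).and huv).exists
    exact h3.2.2 h2

/-- Polynomials outside a prime ideal have approximations outside the approximating ideals. -/
theorem eventually_notMem {ι : Type*} [Finite ι] {P : Ideal (MvPolynomial (Fin n) ℂ)} [P.IsPrime]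
    {g : ι → MvPolynomial (Fin n) ℂ} {gp : ι → ∀ p, MvPolynomial (Fin n) (FBar p)}
    (hg : ∀ i, IsPolyApprox α (g i) (gp i)) (hP : Ideal.span (Set.range g) = P)
    (hf : IsPolyApprox α f fp) (h : f ∉ P) :
    ∀ᶠ p in (ℱ : Filter Nat.Primes), fp p ∉ Ideal.span (Set.range fun i => gp i p) := by
  -- By the Nullstellensatz the zero locus of `P` has a point where `f` does not vanish; its
  -- approximations separate `fp p` from the approximating ideal.
  obtain ⟨x, hx, hfx⟩ : ∃ x : Fin n → ℂ, (∀ i, MvPolynomial.eval x (g i) = 0) ∧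
      MvPolynomial.eval x f ≠ 0 := by
    by_contra! hcon
    refine h ?_
    rw [← ‹P.IsPrime›.radical, ← MvPolynomial.vanishingIdeal_zeroLocus_eq_radical (K := ℂ)]
    intro x hx
    refine hcon x fun i => hx _ ?_
    rw [← hP]
    exact Ideal.subset_span ⟨i, rfl⟩
  rw [Ne, hf.eval_eq_zero_iff, ← Ultrafilter.eventually_not] at hfx
  have hx' := eventually_all.2 fun i => ((hg i).eval_eq_zero_iff x).1 (hx i)
  filter_upwards [hfx, hx'] with p h1 h2 h3
  refine h1 ?_
  have : Ideal.span (Set.range fun i => gp i p) ≤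
      RingHom.ker (MvPolynomial.eval fun i => approx α (x i) p) := by
    rw [Ideal.span_le]
    rintro _ ⟨i, rfl⟩
    exact h2 i
  exact this h3

/-- Approximations of members of an ideal. -/
theorem eventually_mem {ι : Type*} [Finite ι]
    {g : ι → MvPolynomial (Fin n) ℂ} {gp : ι → ∀ p, MvPolynomial (Fin n) (FBar p)}
    (hg : ∀ i, IsPolyApprox α (g i) (gp i))
    (hf : IsPolyApprox α f fp) (h : f ∈ Ideal.span (Set.range g)) :
    ∀ᶠ p in (ℱ : Filter Nat.Primes), fp p ∈ Ideal.span (Set.range fun i => gp i p) := by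
  have := Fintype.ofFinite ι
  obtain ⟨c, rfl⟩ := (Ideal.mem_span_range_iff_exists_fun ..).1 h
  choose cp hcp using fun i => exists_approx (α := α) (c i)
  filter_upwards [hf.eventually_eq (IsPolyApprox.sum _ fun i => (hcp i).mul (hg i))] with p hp
  rw [hp]
  exact Ideal.sum_mem _ fun i _ => Ideal.mul_mem_left _ _ (Ideal.subset_span ⟨i, rfl⟩)

end IsPolyApprox

/-- A finitely generated subring of `ℂ` maps to `F̄_p` for almost all `p`, compatibly with
approximations. -/
theorem exists_ringHom_approx (A : Subalgebra ℤ ℂ) (hA : A.FG) :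
    ∃ φ : ∀ p, A → FBar p, (∀ᶠ p in (ℱ : Filter Nat.Primes), ∃ ψ : A →+* FBar p, ⇑ψ = φ p) ∧
      ∀ a : A, α.symm a = ulim ℱ fun p => φ p a := by
  have : Algebra.FiniteType ℤ A := A.fg_iff_finiteType.1 hA
  obtain ⟨n, f, hf⟩ := Algebra.FiniteType.iff_quotient_mvPolynomial''.1 this
  let g : ∀ p : Nat.Primes, MvPolynomial (Fin n) ℤ →+* FBar p := fun p =>
    MvPolynomial.eval₂Hom (Int.castRingHom _) fun i => approx α (f (.X i) : ℂ) p
  have hg : ∀ F, α.symm (f F : ℂ) = ulim ℱ fun p => g p F := by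
    intro F
    change (((α.symm : ℂ →+* UltraProd ℱ FBar).comp A.val.toRingHom).comp f.toRingHom) F =
      ((Ideal.Quotient.mk (ultraIdeal ℱ FBar)).comp (RingHom.pi g)) F
    congr 1
    refine MvPolynomial.ringHom_ext (fun a => ?_) fun i => ?_
    · simp
    · have h1 : RingHom.pi g (.X i) = approx α (f (.X i) : ℂ) := by
        ext p
        simp [g]
      rw [RingHom.comp_apply _ (RingHom.pi g), h1]
      exact (ulim_approx α _).symm
  have hs : ∀ F G, f F = f G → ∀ᶠ p in (ℱ : Filter Nat.Primes), g p F = g p G := by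
    intro F G h
    rw [← ulim_eq_ulim_iff ℱ (fun p => g p F) fun p => g p G, ← hg, ← hg, h]
  refine ⟨fun p a => g p (Function.surjInv hf a), ?_, fun a => ?_⟩
  -- The relations of `A` are generated by finitely many polynomials, so they all hold in `F̄_p` for
  -- almost all `p`; for the remaining `p` the map need not be a homomorphism.
  · obtain ⟨s, hs'⟩ := (RingHom.ker f.toRingHom).fg_of_isNoetherianRing
    have hgood : ∀ᶠ p in (ℱ : Filter Nat.Primes), ∀ r ∈ s, g p r = 0 := by
      refine (Filter.eventually_all_finset s).2 fun r hr => ?_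
      have hr' : r ∈ RingHom.ker f.toRingHom := by rw [← hs']; exact Ideal.subset_span hr
      have := hs r 0 (by rw [map_zero]; exact hr')
      simpa using this
    filter_upwards [hgood] with p hp
    have hker : RingHom.ker f.toRingHom ≤ RingHom.ker (g p) := by
      rw [← hs', Ideal.span_le]
      exact hp
    refine ⟨f.toRingHom.liftOfRightInverse _ (Function.rightInverse_surjInv hf) ⟨g p, hker⟩, ?_⟩
    rfl
  · rw [← hg, Function.surjInv_eq hf]

/-- Polynomials over a subring of `ℂ` are approximated by their images over `F̄_p`. -/
theorem isPolyApprox_map {A : Subalgebra ℤ ℂ} {φ : ∀ p, A → FBar p}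
    (hφ : ∀ a : A, α.symm a = ulim ℱ fun p => φ p a)
    {fp : ∀ p, MvPolynomial (Fin n) (FBar p)} (F : MvPolynomial (Fin n) A)
    (h : ∀ᶠ p in (ℱ : Filter Nat.Primes), ∃ ψ : A →+* FBar p, ⇑ψ = φ p ∧ fp p = F.map ψ) :
    IsPolyApprox α (F.map (algebraMap A ℂ)) fp := by
  classical
  have h1 := IsPolyApprox.sum F.support fun d =>
    IsPolyApprox.monomial d ((F.coeff d : A) : ℂ) _ (hφ (F.coeff d))
  have h2 : F.map (algebraMap A ℂ) = ∑ d ∈ F.support, MvPolynomial.monomial d ((F.coeff d : A) : ℂ) := by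
    conv_lhs => rw [← MvPolynomial.support_sum_monomial_coeff F, map_sum]
    simp only [MvPolynomial.map_monomial]
    rfl
  rw [h2]
  refine h1.congr ?_
  filter_upwards [h] with p ⟨ψ, hψ, hp⟩
  rw [hp]
  conv_rhs => rw [← MvPolynomial.support_sum_monomial_coeff F, map_sum]
  simp only [MvPolynomial.map_monomial, ← hψ]

end

end PolynomialApproximation

/-! ### Monic Gröbner bases, generic freeness and persistence of regular elements. -/

section GenericFreeness

noncomputable section

open MvPolynomial

variable {n : ℕ}

/-- An ideal of a polynomial ring has a monic Gröbner basis. -/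
def HasMonicBasis {A : Type*} [CommRing A] (J : Ideal (MvPolynomial (Fin n) A)) : Prop :=
  ∃ (l : ℕ) (g : Fin l → MvPolynomial (Fin n) A),
    (∀ i, MonomialOrder.lex.leadingCoeff (g i) = 1) ∧ (∀ i, g i ∈ J) ∧
    ∀ f ∈ J, f ≠ 0 → ∃ i, MonomialOrder.lex.degree (g i) ≤ MonomialOrder.lex.degree f

/-- The minimal leading exponents form an antichain in `ℕⁿ`, which is finite by Dickson's lemma;
dividing by leading coefficients makes the chosen polynomials monic. -/
theorem hasMonicBasis_of_field {K : Type*} [Field K] (J : Ideal (MvPolynomial (Fin n) K)) :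
    HasMonicBasis J := by
  let L : Set (Fin n →₀ ℕ) := {d | ∃ f ∈ J, f ≠ 0 ∧ MonomialOrder.lex.degree f = d}
  have hfin : {d | Minimal (· ∈ L) d}.Finite :=
    WellQuasiOrderedLE.finite_of_isAntichain (setOfPred_minimal_antichain _)
  obtain ⟨l, e, he⟩ := hfin.fin_param
  have hex : ∀ i, ∃ f ∈ J, f ≠ 0 ∧ MonomialOrder.lex.degree f = e i := fun i => by
    have : e i ∈ {d | Minimal (· ∈ L) d} := he.2 ▸ Set.mem_range_self i
    exact this.1
  choose f hfJ hf0 hfe using hex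
  have hc : ∀ i, MonomialOrder.lex.leadingCoeff (f i) ≠ 0 := fun i =>
    MonomialOrder.leadingCoeff_ne_zero_iff.2 (hf0 i)
  refine ⟨l, fun i => C (MonomialOrder.lex.leadingCoeff (f i))⁻¹ * f i, fun i => ?_,
    fun i => J.mul_mem_left _ (hfJ i), fun h hh hh0 => ?_⟩
  · rw [MonomialOrder.leadingCoeff_mul, MonomialOrder.leadingCoeff_C, inv_mul_cancel₀ (hc i)]
  · have hd : MonomialOrder.lex.degree h ∈ L := ⟨h, hh, hh0, rfl⟩
    obtain ⟨d, hd1, hd2⟩ := exists_minimal_le_of_wellFoundedLT (· ∈ L) _ hd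
    have : d ∈ Set.range e := he.2 ▸ hd2
    obtain ⟨i, rfl⟩ := this
    refine ⟨i, ?_⟩
    rw [MonomialOrder.degree_mul (by simpa using hf0 i) (hf0 i), MonomialOrder.degree_C, zero_add,
      hfe]
    exact hd1

theorem HasMonicBasis.exists_remainder {A : Type*} [CommRing A]
    {J : Ideal (MvPolynomial (Fin n) A)} {l : ℕ} {g : Fin l → MvPolynomial (Fin n) A}
    (hg : ∀ i, MonomialOrder.lex.leadingCoeff (g i) = 1) (hJ : ∀ i, g i ∈ J)
    (f : MvPolynomial (Fin n) A) :
    ∃ r, f - r ∈ J ∧ ∀ c ∈ r.support, ∀ i, ¬ MonomialOrder.lex.degree (g i) ≤ c := by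
  obtain ⟨q, r, h1, -, h2⟩ := MonomialOrder.lex.div (b := g) (fun i => by rw [hg]; exact isUnit_one) f
  refine ⟨r, ?_, h2⟩
  rw [h1, add_sub_cancel_right, Finsupp.linearCombination_apply]
  exact J.sum_mem fun i _ => J.mul_mem_left _ (hJ i)

/-- The standard monomials, divisible by no leading monomial of the `g i`, form a basis: monic
division gives spanning, and a nonzero element of `J` cannot be supported on them. -/
theorem HasMonicBasis.free {A : Type*} [CommRing A] {J : Ideal (MvPolynomial (Fin n) A)}
    (h : HasMonicBasis J) : Module.Free A (MvPolynomial (Fin n) A ⧸ J) := by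
  obtain ⟨l, g, hg, hJ, hd⟩ := h
  let s : Set (Fin n →₀ ℕ) := {c | ∀ i, ¬ MonomialOrder.lex.degree (g i) ≤ c}
  let φ : restrictSupport A s →ₗ[A] MvPolynomial (Fin n) A ⧸ J :=
    (Ideal.Quotient.mkₐ A J).toLinearMap ∘ₗ (restrictSupport A s).subtype
  have hφ : Function.Bijective φ := by
    constructor
    · refine (injective_iff_map_eq_zero φ).2 fun x hx => ?_
      by_contra hx0
      have hx0 : (x : MvPolynomial (Fin n) A) ≠ 0 := fun h0 => hx0 (Subtype.ext h0)
      obtain ⟨i, hi⟩ := hd x (Ideal.Quotient.eq_zero_iff_mem.1 hx) hx0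
      exact (mem_restrictSupport_iff ..).1 x.2 (MonomialOrder.degree_mem_support hx0) i hi
    · intro y
      obtain ⟨f, rfl⟩ := Ideal.Quotient.mk_surjective y
      obtain ⟨r, hr, hs⟩ := exists_remainder hg hJ f
      refine ⟨⟨r, (mem_restrictSupport_iff ..).2 hs⟩, ?_⟩
      exact (Ideal.Quotient.eq.2 hr).symm
  have := Module.Free.of_basis (basisRestrictSupport A s)
  exact Module.Free.of_equiv (LinearEquiv.ofBijective φ hφ)

/-- Over a sufficiently large subring of a field, an ideal has a monic Gröbner basis and is
contracted from the field. -/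
theorem exists_finset_hasMonicBasis {k K : Type*} [CommRing k] [Field K] [Algebra k K] {r : ℕ}
    (f : Fin r → MvPolynomial (Fin n) K) :
    ∃ c : Finset K, ∀ A : Subalgebra k K, (c : Set K) ⊆ A → ∀ f' : Fin r → MvPolynomial (Fin n) A,
      (∀ i, (f' i).map (algebraMap A K) = f i) → HasMonicBasis (Ideal.span (Set.range f')) ∧
      ∀ x : MvPolynomial (Fin n) A, x.map (algebraMap A K) ∈ Ideal.span (Set.range f) →
        x ∈ Ideal.span (Set.range f') := by
  classical
  obtain ⟨l, g, hg, hJ, hd⟩ := hasMonicBasis_of_field (Ideal.span (Set.range f))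
  choose q hq using fun i => (Ideal.mem_span_range_iff_exists_fun ..).1 (hJ i)
  -- The constants adjoined are the coefficients of the Gröbner basis and of its expressions through
  -- the generators `f`, so that both descend to `A`.
  refine ⟨(Finset.univ.biUnion fun i => (g i).coeffs) ∪
    (Finset.univ.biUnion fun i => Finset.univ.biUnion fun j => (q i j).coeffs),
    fun A hA f' hf' => ?_⟩
  have hlift : ∀ x : MvPolynomial (Fin n) K, (x.coeffs : Set K) ⊆ A →
      ∃ y : MvPolynomial (Fin n) A, y.map (algebraMap A K) = x := by
    intro x hx
    refine mem_range_map_iff_coeffs_subset.2 fun a ha => ?_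
    exact ⟨⟨a, hx ha⟩, rfl⟩
  have hinj : Function.Injective (algebraMap A K) := Subtype.val_injective
  have hmap := map_injective (σ := Fin n) _ hinj
  choose g' hg' using fun i => hlift (g i) fun a ha => hA <| by
    simp only [Finset.coe_union, Set.mem_union, Finset.mem_coe, Finset.mem_biUnion]
    exact .inl ⟨i, Finset.mem_univ _, ha⟩
  choose q' hq' using fun i j => hlift (q i j) fun a ha => hA <| by
    simp only [Finset.coe_union, Set.mem_union, Finset.mem_coe, Finset.mem_biUnion]
    exact .inr ⟨i, Finset.mem_univ _, j, Finset.mem_univ _, ha⟩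
  have hsupp : ∀ x : MvPolynomial (Fin n) A, (x.map (algebraMap A K)).support = x.support :=
    fun x => support_map_of_injective x hinj
  have hdeg : ∀ x : MvPolynomial (Fin n) A, MonomialOrder.lex.degree (x.map (algebraMap A K)) =
      MonomialOrder.lex.degree x := fun x => by
    rw [MonomialOrder.degree, MonomialOrder.degree, hsupp]
  have hle : ∀ x ∈ Ideal.span (Set.range f'), x.map (algebraMap A K) ∈ Ideal.span (Set.range f) := by
    intro x hx
    have := Ideal.mem_map_of_mem (MvPolynomial.map (algebraMap A K)) hx
    rw [Ideal.map_span, ← Set.range_comp] at this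
    convert! this using 4
    exact funext fun i => (hf' i).symm
  have hg1 : ∀ i, MonomialOrder.lex.leadingCoeff (g' i) = 1 := by
    intro i
    apply hinj
    rw [map_one, ← hg i, ← hg' i, MonomialOrder.leadingCoeff, MonomialOrder.leadingCoeff, hdeg,
      coeff_map]
  have hgJ : ∀ i, g' i ∈ Ideal.span (Set.range f') := by
    intro i
    have : g' i = ∑ j, q' i j * f' j := by
      apply hmap
      rw [hg', ← hq i, map_sum]
      simp [hq', hf']
    rw [this]
    exact Ideal.sum_mem _ fun j _ => Ideal.mul_mem_left _ _ (Ideal.subset_span ⟨j, rfl⟩)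
  have hd' : ∀ x : MvPolynomial (Fin n) A, x.map (algebraMap A K) ∈ Ideal.span (Set.range f) →
      x ≠ 0 → ∃ i, MonomialOrder.lex.degree (g' i) ≤ MonomialOrder.lex.degree x := by
    intro x hx hx0
    obtain ⟨i, hi⟩ := hd _ hx fun h => hx0 (hmap (by rw [h, map_zero]))
    exact ⟨i, by rwa [← hdeg, ← hdeg, hg']⟩
  refine ⟨⟨l, g', hg1, hgJ, fun x hx => hd' x (hle x hx)⟩, fun x hx => ?_⟩
  -- The remainder of `x` lies in the ideal over `K` and is supported on standard monomials, hence
  -- vanishes; this gives the contraction statement.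
  obtain ⟨y, hy, hy'⟩ := HasMonicBasis.exists_remainder hg1 hgJ x
  by_cases hy0 : y = 0
  · simpa [hy0] using hy
  have h1 : y.map (algebraMap A K) ∈ Ideal.span (Set.range f) := by
    have := Ideal.sub_mem _ hx (hle _ hy)
    rwa [map_sub, sub_sub_cancel] at this
  obtain ⟨i, hi⟩ := hd' y h1 hy0
  exact absurd hi (hy' _ (MonomialOrder.degree_mem_support hy0) i)

section BaseChange

variable {σ A : Type*} (K : Type*) [CommRing A] [CommRing K] [Algebra A K]
    (I : Ideal (MvPolynomial σ A))

/-- The canonical homomorphism `A[X]/I → K[X]/IK[X]`. -/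
def quotientMapAlgHom :
    (MvPolynomial σ A ⧸ I) →ₐ[A] MvPolynomial σ K ⧸ I.map (MvPolynomial.map (algebraMap A K)) :=
  Ideal.Quotient.liftₐ I ((Ideal.Quotient.mkₐ A (I.map (MvPolynomial.map (algebraMap A K)))).comp
    (mapAlgHom (Algebra.ofId A K))) fun _ hf =>
      Ideal.Quotient.eq_zero_iff_mem.2 (Ideal.mem_map_of_mem _ hf)

theorem quotientMapAlgHom_mk (f : MvPolynomial σ A) :
    quotientMapAlgHom K I (Ideal.Quotient.mk I f) =
      Ideal.Quotient.mk _ (f.map (algebraMap A K)) := rfl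

theorem aeval_tmul_map (f : MvPolynomial σ A) :
    aeval (R := K) (S₁ := K ⊗[A] (MvPolynomial σ A ⧸ I))
      (fun i => 1 ⊗ₜ Ideal.Quotient.mk I (X i)) (f.map (algebraMap A K)) =
      1 ⊗ₜ Ideal.Quotient.mk _ f := by
  rw [aeval_map_algebraMap]
  change _ = ((Algebra.TensorProduct.includeRight).comp (Ideal.Quotient.mkₐ A I)) f
  congr 1
  ext i
  simp

/-- The canonical homomorphism `K ⊗ A[X]/I → K[X]/IK[X]`. -/
def quotientBaseChangeHom : K ⊗[A] (MvPolynomial σ A ⧸ I) →ₐ[K]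
    MvPolynomial σ K ⧸ I.map (MvPolynomial.map (algebraMap A K)) :=
  Algebra.TensorProduct.lift (Algebra.ofId _ _) (quotientMapAlgHom K I) fun _ _ => Commute.all _ _

theorem quotientBaseChangeHom_tmul (a : K) (f : MvPolynomial σ A) :
    quotientBaseChangeHom K I (a ⊗ₜ Ideal.Quotient.mk I f) =
      a • Ideal.Quotient.mk _ (f.map (algebraMap A K)) := by
  rw [quotientBaseChangeHom, Algebra.TensorProduct.lift_tmul, quotientMapAlgHom_mk]
  exact (Algebra.smul_def ..).symm

/-- The canonical homomorphism `K[X]/IK[X] → K ⊗ A[X]/I`. -/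
def quotientBaseChangeInv : MvPolynomial σ K ⧸ I.map (MvPolynomial.map (algebraMap A K)) →ₐ[K]
    K ⊗[A] (MvPolynomial σ A ⧸ I) :=
  Ideal.Quotient.liftₐ _ (aeval (R := K) (S₁ := K ⊗[A] (MvPolynomial σ A ⧸ I))
    fun i => 1 ⊗ₜ Ideal.Quotient.mk _ (X i)) fun f hf => by
      have : I.map (MvPolynomial.map (algebraMap A K)) ≤ RingHom.ker (aeval (R := K)
          (S₁ := K ⊗[A] (MvPolynomial σ A ⧸ I)) fun i => 1 ⊗ₜ Ideal.Quotient.mk I (X i)) := by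
        rw [Ideal.map_le_iff_le_comap]
        intro f hf
        rw [Ideal.mem_comap, RingHom.mem_ker, aeval_tmul_map, Ideal.Quotient.eq_zero_iff_mem.2 hf,
          TensorProduct.tmul_zero]
      exact this hf

theorem quotientBaseChangeInv_mk (f : MvPolynomial σ K) :
    quotientBaseChangeInv K I (Ideal.Quotient.mk _ f) =
      aeval (fun i => 1 ⊗ₜ Ideal.Quotient.mk _ (X i)) f := rfl

/-- Base change of a quotient of a polynomial ring. -/
def quotientBaseChange :
    K ⊗[A] (MvPolynomial σ A ⧸ I) ≃ₐ[K]
      MvPolynomial σ K ⧸ I.map (MvPolynomial.map (algebraMap A K)) :=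
  AlgEquiv.ofAlgHom (quotientBaseChangeHom K I) (quotientBaseChangeInv K I)
    (by
      refine Ideal.Quotient.algHom_ext _ (MvPolynomial.algHom_ext fun i => ?_)
      change quotientBaseChangeHom K I (quotientBaseChangeInv K I (Ideal.Quotient.mk _ (X i))) = _
      rw [quotientBaseChangeInv_mk, aeval_X, quotientBaseChangeHom_tmul, one_smul, map_X]
      rfl)
    (by
      refine Algebra.TensorProduct.ext' fun a x => ?_
      obtain ⟨f, rfl⟩ := Ideal.Quotient.mk_surjective x
      rw [AlgHom.comp_apply, quotientBaseChangeHom_tmul, map_smul, quotientBaseChangeInv_mk,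
        aeval_tmul_map, TensorProduct.smul_tmul', smul_eq_mul, mul_one, AlgHom.id_apply])

theorem quotientBaseChange_tmul (f : MvPolynomial σ A) :
    quotientBaseChange K I (1 ⊗ₜ Ideal.Quotient.mk I f) =
      Ideal.Quotient.mk _ (f.map (algebraMap A K)) :=
  (quotientBaseChangeHom_tmul K I 1 f).trans (one_smul ..)

variable {K I}

/-- A linear retraction of multiplication by `c` survives tensoring with `K`, whereas injectivity
alone need not. -/
theorem eq_zero_of_tmul_mul_eq_zero {C : Type*} [CommRing C] [Algebra A C] (c : C)
    (ρ : C →ₗ[A] C) (hρ : ρ ∘ₗ LinearMap.mulLeft A c = LinearMap.id) (z : K ⊗[A] C)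
    (hz : (1 ⊗ₜ c) * z = 0) : z = 0 := by
  have h1 : ∀ z : K ⊗[A] C, (LinearMap.mulLeft A c).lTensor K z = (1 ⊗ₜ c) * z := by
    intro z
    induction z with
    | zero => rw [map_zero, mul_zero]
    | tmul a c => simp
    | add u v hu hv => rw [map_add, mul_add, hu, hv]
  rw [← LinearMap.id_apply (R := A) z, ← LinearMap.lTensor_id, ← hρ, LinearMap.lTensor_comp,
    LinearMap.comp_apply, h1, hz, map_zero]

/-- Multiplication by an element that is regular modulo `I` with free cokernel stays injective
after any base change. -/
theorem mem_map_of_mul_mem_map (s : MvPolynomial σ A) (hs : ∀ x, s * x ∈ I → x ∈ I)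
    [Module.Projective A (MvPolynomial σ A ⧸ (I ⊔ Ideal.span {s}))]
    {x : MvPolynomial σ K} (hx : s.map (algebraMap A K) * x ∈ I.map (MvPolynomial.map (algebraMap A K))) :
    x ∈ I.map (MvPolynomial.map (algebraMap A K)) := by
  let C' := MvPolynomial σ A ⧸ I
  let f : C' →ₗ[A] C' := LinearMap.mulLeft A (Ideal.Quotient.mk I s)
  let g : C' →ₗ[A] MvPolynomial σ A ⧸ (I ⊔ Ideal.span {s}) :=
    (Ideal.Quotient.factorₐ A le_sup_left).toLinearMap
  have hf : Function.Injective f := by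
    refine (injective_iff_map_eq_zero f).2 fun y hy => ?_
    obtain ⟨y, rfl⟩ := Ideal.Quotient.mk_surjective y
    rw [LinearMap.mulLeft_apply, ← map_mul, Ideal.Quotient.eq_zero_iff_mem] at hy
    exact Ideal.Quotient.eq_zero_iff_mem.2 (hs y hy)
  have hg : Function.Surjective g := Ideal.Quotient.factor_surjective le_sup_left
  have hfg : Function.Exact f g := by
    intro y
    obtain ⟨y, rfl⟩ := Ideal.Quotient.mk_surjective y
    change Ideal.Quotient.mk _ y = 0 ↔ _
    rw [Ideal.Quotient.eq_zero_iff_mem]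
    constructor
    · intro hy
      obtain ⟨a, ha, b, hb, rfl⟩ := Submodule.mem_sup.1 hy
      obtain ⟨c, rfl⟩ := Ideal.mem_span_singleton.1 hb
      refine ⟨Ideal.Quotient.mk I c, ?_⟩
      rw [LinearMap.mulLeft_apply, ← map_mul, Ideal.Quotient.eq]
      simpa using ha
    · rintro ⟨c, hc⟩
      obtain ⟨c, rfl⟩ := Ideal.Quotient.mk_surjective c
      rw [LinearMap.mulLeft_apply, ← map_mul, Ideal.Quotient.eq] at hc
      rw [← sub_sub_cancel (s * c) y]
      exact Ideal.sub_mem _ (Ideal.mul_mem_right _ _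
        (Ideal.mem_sup_right (Ideal.mem_span_singleton_self s))) (Ideal.mem_sup_left hc)
  -- The cokernel of multiplication by `s` is projective, so the sequence splits and multiplication
  -- has a retraction `ρ`.
  obtain ⟨l, hl⟩ := Module.projective_lifting_property g LinearMap.id hg
  obtain ⟨-, ρ, hρ⟩ := (hfg.split_tfae'.out 0 1 rfl rfl).1 ⟨hf, l, hl⟩
  rw [← Ideal.Quotient.eq_zero_iff_mem] at hx ⊢
  obtain ⟨z, hz⟩ := (quotientBaseChange K I).surjective (Ideal.Quotient.mk _ x)
  rw [← hz, eq_zero_of_tmul_mul_eq_zero (Ideal.Quotient.mk I s) ρ hρ z, map_zero]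
  apply (quotientBaseChange K I).injective
  rw [map_mul, quotientBaseChange_tmul, hz, map_zero, ← map_mul, hx]

end BaseChange

/-- A polynomial that is regular modulo an ideal has approximations that are regular modulo the
approximating ideals. -/
theorem IsPolyApprox.eventually_mem_of_mul_mem {ℱ : Ultrafilter Nat.Primes}
    {α : UltraProd ℱ FBar ≃+* ℂ} {r : ℕ} {g : Fin r → MvPolynomial (Fin n) ℂ}
    {gp : Fin r → ∀ p, MvPolynomial (Fin n) (FBar p)} (hg : ∀ i, IsPolyApprox α (g i) (gp i))
    {s : MvPolynomial (Fin n) ℂ} {sp : ∀ p, MvPolynomial (Fin n) (FBar p)}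
    (hsp : IsPolyApprox α s sp)
    (hs : ∀ x, s * x ∈ Ideal.span (Set.range g) → x ∈ Ideal.span (Set.range g)) :
    ∀ᶠ p in (ℱ : Filter Nat.Primes), ∀ x,
      sp p * x ∈ Ideal.span (Set.range fun i => gp i p) →
      x ∈ Ideal.span (Set.range fun i => gp i p) := by
  classical
  -- The constants `c₁` make the ideal of the `g i` contracted from `ℂ`, so that `s` is regular
  -- already over `A`; the constants `c₂` make the quotient by the `g i` and `s` free over `A`.
  obtain ⟨c₁, hc₁⟩ := exists_finset_hasMonicBasis (k := ℤ) g
  obtain ⟨c₂, hc₂⟩ := exists_finset_hasMonicBasis (k := ℤ) (Fin.snoc g s : Fin (r + 1) → _)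
  let c : Finset ℂ := c₁ ∪ c₂ ∪ s.coeffs ∪ Finset.univ.biUnion fun i => (g i).coeffs
  let A : Subalgebra ℤ ℂ := Algebra.adjoin ℤ (c : Set ℂ)
  have hcA : (c : Set ℂ) ⊆ A := Algebra.subset_adjoin
  obtain ⟨φ, hφ, hφ'⟩ := exists_ringHom_approx (α := α) A ⟨c, rfl⟩
  have hlift : ∀ x : MvPolynomial (Fin n) ℂ, x.coeffs ⊆ c →
      ∃ y : MvPolynomial (Fin n) A, y.map (algebraMap A ℂ) = x := fun x hx =>
    mem_range_map_iff_coeffs_subset.2 fun a ha => ⟨⟨a, hcA (hx ha)⟩, rfl⟩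
  choose G hG using fun i => hlift (g i) fun a ha => Finset.mem_union_right _
    (Finset.mem_biUnion.2 ⟨i, Finset.mem_univ _, ha⟩)
  obtain ⟨S, hS⟩ := hlift s fun a ha => Finset.mem_union_left _ (Finset.mem_union_right _ ha)
  have hA₁ := hc₁ A (fun a ha => hcA (by simp [c, Finset.mem_coe.1 ha])) G hG
  have hA₂ := hc₂ A (fun a ha => hcA (by simp [c, Finset.mem_coe.1 ha])) (Fin.snoc G S) (by
    intro i
    induction i using Fin.lastCases <;> simp [hG, hS])
  have hfree := hA₂.1.free
  have hrange : Ideal.span (Set.range (Fin.snoc G S : Fin (r + 1) → MvPolynomial (Fin n) A)) =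
      Ideal.span (Set.range G) ⊔ Ideal.span {S} := by
    rw [Fin.range_snoc, Set.insert_eq, Ideal.span_union, sup_comm]
  rw [hrange] at hfree
  let IG := Ideal.span (Set.range G)
  have hreg : ∀ x, S * x ∈ IG → x ∈ IG := by
    intro x hx
    refine hA₁.2 x (hs _ ?_)
    rw [← hS, ← map_mul]
    have := Ideal.mem_map_of_mem (MvPolynomial.map (algebraMap A ℂ)) hx
    rw [Ideal.map_span, ← Set.range_comp] at this
    convert! this using 4
    exact funext fun i => (hG i).symm
  have hGp : ∀ (F : MvPolynomial (Fin n) A) (fp : ∀ p, MvPolynomial (Fin n) (FBar p)),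
      IsPolyApprox α (F.map (algebraMap A ℂ)) fp →
      ∀ᶠ p in (ℱ : Filter Nat.Primes), ∀ ψ : A →+* FBar p, ⇑ψ = φ p → fp p = F.map ψ := by
    intro F fp hF
    have h1 : IsPolyApprox α (F.map (algebraMap A ℂ)) fun p =>
        if h : ∃ ψ : A →+* FBar p, ⇑ψ = φ p then F.map h.choose else 0 := by
      refine isPolyApprox_map hφ' F ?_
      filter_upwards [hφ] with p hp
      exact ⟨hp.choose, hp.choose_spec, by rw [dif_pos hp]⟩
    filter_upwards [hF.eventually_eq h1] with p hp ψ hψ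
    have h : ∃ ψ : A →+* FBar p, ⇑ψ = φ p := ⟨ψ, hψ⟩
    rw [hp, dif_pos h]
    congr 1
    exact congrArg _ (DFunLike.coe_injective (h.choose_spec.trans hψ.symm))
  have hall := eventually_all.2 fun i => hGp (G i) (gp i) (by rw [hG]; exact hg i)
  filter_upwards [hφ, hall, hGp S sp (by rw [hS]; exact hsp)] with p ⟨ψ, hψ⟩ hp hp' x hx
  let := ψ.toAlgebra
  have hI : Ideal.span (Set.range fun i => gp i p) =
      IG.map (MvPolynomial.map (algebraMap A (FBar p))) := by
    rw [Ideal.map_span, ← Set.range_comp]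
    congr 2
    exact funext fun i => hp i ψ hψ
  rw [hI] at hx ⊢
  rw [hp' ψ hψ] at hx
  exact mem_map_of_mul_mem_map S hreg hx

end

end GenericFreeness

/-! ### Approximations of prime ideals are prime. -/

section PrimeTransfer

noncomputable section

open MvPolynomial

/-- If the variables become images of elements of `A` after multiplication by `s`, then so do all
polynomials after multiplication by a power of `s`. -/
theorem exists_map_eq_pow_mul {σ R A E : Type*} [CommRing R] [CommRing A] [CommRing E]
    (η : A →+* E) (s : A) (ev : MvPolynomial σ R →+* E) (hC : ∀ c, ∃ a, η a = ev (C c))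
    (hX : ∀ i, ∃ a, η a = η s * ev (X i)) (f : MvPolynomial σ R) :
    ∃ (N : ℕ) (a : A), η a = η s ^ N * ev f := by
  induction f using MvPolynomial.induction_on with
  | C c =>
    obtain ⟨a, ha⟩ := hC c
    exact ⟨0, a, by simp [ha]⟩
  | add f g hf hg =>
    obtain ⟨N, a, ha⟩ := hf
    obtain ⟨M, b, hb⟩ := hg
    refine ⟨N + M, s ^ M * a + s ^ N * b, ?_⟩
    rw [map_add, map_mul, map_mul, map_pow, map_pow, ha, hb, map_add]
    ring
  | mul_X f i hf =>
    obtain ⟨N, a, ha⟩ := hf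
    obtain ⟨b, hb⟩ := hX i
    refine ⟨N + 1, a * b, ?_⟩
    rw [map_mul, ha, hb, map_mul]
    ring

/-- A finite extension of domains of characteristic zero is generically generated by one
element. -/
theorem exists_generic_generator {Λ B ι : Type*} [CommRing Λ] [IsDomain Λ] [CommRing B] [IsDomain B]
    [CharZero Λ] [Algebra Λ B] [Module.Finite Λ B] [FaithfulSMul Λ B] [Finite ι] (x : ι → B) :
    ∃ (b : B) (s : Λ) (P : ι → Polynomial Λ), s ≠ 0 ∧ ∀ i, Polynomial.aeval b (P i) = s • x i := by
  classical
  have := Fintype.ofFinite ι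
  let Q := FractionRing Λ
  let F := FractionRing B
  let : Algebra Q F := FractionRing.liftAlgebra Λ F
  have : FiniteDimensional Q F := inferInstance
  have : CharZero Q := inferInstance
  obtain ⟨γ, hγ⟩ := Field.exists_primitive_element Q F
  have hΛF : Function.Injective (algebraMap Λ F) := FaithfulSMul.algebraMap_injective Λ F
  -- A multiple of the primitive element `γ` by a nonzero `s₀ ∈ Λ` lies in `B` and still generates
  -- the field extension.
  obtain ⟨⟨b, ⟨_, s₀, hs₀, rfl⟩⟩, hb⟩ :=
    IsLocalization.surj (Algebra.algebraMapSubmonoid B (nonZeroDivisors Λ)) γ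
  have hs₀' : algebraMap Λ F s₀ ≠ 0 := by
    rw [Ne, map_eq_zero_iff _ hΛF]
    exact nonZeroDivisors.ne_zero hs₀
  have hb : algebraMap B F b = γ * algebraMap Λ F s₀ := by
    rw [← hb, IsScalarTower.algebraMap_apply Λ B F]
  have hγb : γ = (algebraMap Λ Q s₀)⁻¹ • algebraMap B F b := by
    rw [Algebra.smul_def, map_inv₀, ← IsScalarTower.algebraMap_apply, hb, mul_comm γ,
      inv_mul_cancel_left₀ hs₀']
  have hadj : ∀ y : F, ∃ R : Polynomial Q, Polynomial.aeval (algebraMap B F b) R = y := by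
    intro y
    have hy : y ∈ Algebra.adjoin Q {γ} := by
      rw [← IntermediateField.adjoin_simple_toSubalgebra_of_isAlgebraic
        (Algebra.IsAlgebraic.isAlgebraic γ), hγ]
      trivial
    have hle : Algebra.adjoin Q {γ} ≤ Algebra.adjoin Q {algebraMap B F b} := by
      refine Algebra.adjoin_le (Set.singleton_subset_iff.2 ?_)
      rw [hγb]
      exact Subalgebra.smul_mem _ (Algebra.self_mem_adjoin_singleton Q _) _
    have := hle hy
    rw [Algebra.adjoin_singleton_eq_range_aeval] at this
    exact this
  have hone : ∀ i, ∃ (s : Λ) (P : Polynomial Λ), s ≠ 0 ∧ Polynomial.aeval b P = s • x i := by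
    intro i
    obtain ⟨R, hR⟩ := hadj (algebraMap B F (x i))
    obtain ⟨s, hs, hP⟩ := IsLocalization.integerNormalization_spec (nonZeroDivisors Λ) R
    refine ⟨s, IsLocalization.integerNormalization (nonZeroDivisors Λ) R,
      nonZeroDivisors.ne_zero hs, ?_⟩
    apply FaithfulSMul.algebraMap_injective B F
    rw [← Polynomial.aeval_algebraMap_apply, ← Polynomial.aeval_map_algebraMap Q, hP,
      ← algebraMap_smul Q s R, map_smul, hR, Algebra.smul_def, Algebra.smul_def, map_mul,
      ← IsScalarTower.algebraMap_apply, ← IsScalarTower.algebraMap_apply]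
  choose s P hs hP using hone
  refine ⟨b, ∏ i, s i, fun i => Polynomial.C (∏ j ∈ Finset.univ.erase i, s j) * P i,
    Finset.prod_ne_zero_iff.2 fun i _ => hs i, fun i => ?_⟩
  rw [map_mul, hP, Polynomial.aeval_C, ← Algebra.smul_def, smul_smul,
    Finset.prod_erase_mul _ _ (Finset.mem_univ i)]

/-- An affine variety in characteristic zero is birational to a hypersurface. -/
theorem exists_birational_hypersurface {K B : Type*} [Field K] [CharZero K] [CommRing B]
    [IsDomain B] [Algebra K B] [Algebra.FiniteType K B] {n : ℕ} (x : Fin n → B) :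
    ∃ (d : ℕ) (ζ : MvPolynomial (Fin d) K →ₐ[K] B) (m S : MvPolynomial (Fin d) K)
      (b : Fin n → MvPolynomial (Fin d) K),
      Prime m ∧ (∀ f, ζ f = 0 ↔ m ∣ f) ∧ ζ S ≠ 0 ∧ ∀ i, ζ (b i) = ζ S * x i := by
  obtain ⟨d, g, hg, hfin⟩ := exists_finite_inj_algHom_of_fg K B
  let := g.toRingHom.toAlgebra
  have : IsScalarTower K (MvPolynomial (Fin d) K) B := .of_algebraMap_eq fun a => (g.commutes a).symm
  have : Module.Finite (MvPolynomial (Fin d) K) B := hfin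
  have : FaithfulSMul (MvPolynomial (Fin d) K) B := (faithfulSMul_iff_algebraMap_injective _ _).2 hg
  obtain ⟨γ, s, P, hs, hP⟩ := exists_generic_generator (Λ := MvPolynomial (Fin d) K) x
  have hγ : IsIntegral (MvPolynomial (Fin d) K) γ := Algebra.IsIntegral.isIntegral γ
  let e := finSuccEquiv K d
  -- After Noether normalization `B` is finite over a polynomial ring and generically generated by
  -- `γ`. The extra variable goes to `γ`; as the polynomial ring is integrally closed, the kernel is
  -- generated by the prime minimal polynomial of `γ`.
  let ζ : MvPolynomial (Fin (d + 1)) K →ₐ[K] B :=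
    ((Polynomial.aeval (R := MvPolynomial (Fin d) K) γ).restrictScalars K).comp e.toAlgHom
  have hζ : ∀ f, ζ (e.symm f) = Polynomial.aeval γ f := fun f => by
    change Polynomial.aeval γ (e (e.symm f)) = _
    rw [e.apply_symm_apply]
  refine ⟨d + 1, ζ, e.symm (minpoly _ γ), e.symm (Polynomial.C s), fun i => e.symm (P i),
    ?_, fun f => ?_, ?_, fun i => ?_⟩
  · exact (MulEquiv.prime_iff e.symm).2 (minpoly.prime_of_isIntegrallyClosed hγ)
  · rw [← e.symm_apply_apply f, hζ, minpoly.isIntegrallyClosed_dvd_iff hγ]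
    exact (map_dvd_iff e.symm).symm
  · rw [hζ, Polynomial.aeval_C, Ne, map_eq_zero_iff _ (FaithfulSMul.algebraMap_injective _ B)]
    exact hs
  · rw [hζ, hζ, hP, Polynomial.aeval_C, Algebra.smul_def]

variable {ℱ : Ultrafilter Nat.Primes} {α : UltraProd ℱ FBar ≃+* ℂ} {n d : ℕ}

theorem IsPolyApprox.aeval {f : MvPolynomial (Fin d) ℂ} {fp : ∀ p, MvPolynomial (Fin d) (FBar p)}
    (hf : IsPolyApprox α f fp) {a : Fin d → MvPolynomial (Fin n) ℂ}
    {ap : Fin d → ∀ p, MvPolynomial (Fin n) (FBar p)} (ha : ∀ j, IsPolyApprox α (a j) (ap j)) :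
    IsPolyApprox α (MvPolynomial.aeval a f) fun p => MvPolynomial.aeval (fun j => ap j p) (fp p) := by
  have h := hullMap_apply (g := fun p =>
    (MvPolynomial.aeval (R := FBar p) fun j => ap j p).toRingHom) hf
  refine Eq.trans ?_ h
  change ((polyHull α n).comp (MvPolynomial.aeval (R := ℂ) a).toRingHom) f = _
  congr 1
  refine MvPolynomial.ringHom_ext (fun c => ?_) fun i => ?_
  · rw [hullMap_C]
    simp only [AlgHom.toRingHom_eq_coe, RingHom.comp_apply, RingHom.coe_coe, algHom_C]
    exact IsPolyApprox.C c
  · rw [hullMap_X]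
    simp only [AlgHom.toRingHom_eq_coe, RingHom.comp_apply, RingHom.coe_coe, aeval_X]
    exact ha i

section

variable {r : ℕ} {g : Fin r → MvPolynomial (Fin n) ℂ} {gp : Fin r → ∀ p, MvPolynomial (Fin n) (FBar p)}
  {a : Fin d → MvPolynomial (Fin n) ℂ} {ap : Fin d → ∀ p, MvPolynomial (Fin n) (FBar p)}
  {m S : MvPolynomial (Fin d) ℂ} {mp Sp : ∀ p, MvPolynomial (Fin d) (FBar p)}
  {b : Fin n → MvPolynomial (Fin d) ℂ}

/-- The maps `β p` realize the inverse `X_i ↦ b_i / S` of the birational parametrization at the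
level of approximations, wherever `S_p` is invertible and `m_p` is zero. -/
theorem exists_hullMap_eq {T : Nat.Primes → Type} [∀ p, CommRing (T p)]
    (can : ∀ p, MvPolynomial (Fin d) (FBar p) →+* T p) (hmp : IsPolyApprox α m mp)
    (hSp : IsPolyApprox α S Sp) (hunit : ∀ p, IsUnit (can p (Sp p))) (hcan : ∀ p, can p (mp p) = 0)
    (hker : ∀ f, MvPolynomial.aeval a f ∈ Ideal.span (Set.range g) ↔ m ∣ f)
    (hb : ∀ i, MvPolynomial.aeval a (b i) - MvPolynomial.aeval a S * X i ∈
      Ideal.span (Set.range g)) :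
    ∃ β : ∀ p, MvPolynomial (Fin n) (FBar p) →+* T p, (∀ p c, β p (C c) = can p (C c)) ∧
      ∀ (f : MvPolynomial (Fin n) ℂ) (z : MvPolynomial (Fin d) ℂ),
        f - MvPolynomial.aeval a z ∈ Ideal.span (Set.range g) → hullMap α β f = hullMap α can z := by
  choose bp hbp using fun i => IsPolyApprox.exists_approx (α := α) (b i)
  choose v hv using fun p => (hunit p).exists_right_inv
  let β : ∀ p, MvPolynomial (Fin n) (FBar p) →+* T p := fun p =>
    MvPolynomial.eval₂Hom ((can p).comp C) fun i => v p * can p (bp i p)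
  have hβC : ∀ p c, β p (C c) = can p (C c) := fun p c => by simp [β]
  have hβX : ∀ p i, can p (Sp p) * β p (X i) = can p (bp i p) := fun p i => by
    simp only [β, coe_eval₂Hom, eval₂_X]
    rw [← mul_assoc, hv, one_mul]
  have hcanS : IsUnit (hullMap α can S) := by
    rw [hullMap_apply hSp]
    refine IsUnit.of_mul_eq_one (ulim ℱ v) ?_
    rw [ulim_mul, ulim_one]
    exact congrArg _ (funext hv)
  have hcanm : hullMap α can m = 0 := by
    rw [hullMap_apply hmp, ulim_zero]
    exact congrArg _ (funext hcan)
  refine ⟨β, hβC, fun f z hfz => ?_⟩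
  let I := Ideal.span (Set.range g)
  -- Working in the product of `ℂ[X]/I` and the ultraproduct clears the denominators of `f` by the
  -- same `F` and `N` in both factors.
  let η := ((Ideal.Quotient.mk I).comp (MvPolynomial.aeval (R := ℂ) a).toRingHom).prod (hullMap α can)
  let ev := (Ideal.Quotient.mk I).prod (hullMap α β)
  have hC : ∀ c, η (C c) = ev (C c) := by
    intro c
    simp only [η, ev, RingHom.prod_apply, hullMap_C, hβC]
    simp
  have hX : ∀ i, η (b i) = η S * ev (X i) := by
    intro i
    simp only [η, ev, RingHom.prod_apply, Prod.mk_mul_mk]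
    refine Prod.ext (Ideal.Quotient.eq.2 (hb i)) ?_
    change hullMap α can (b i) = hullMap α can S * hullMap α β (X i)
    rw [hullMap_X, hullMap_apply hSp, hullMap_apply (hbp i), ulim_mul]
    exact congrArg _ (funext fun p => (hβX p i).symm)
  obtain ⟨N, F, hF⟩ := exists_map_eq_pow_mul η S ev (fun c => ⟨_, hC c⟩) (fun i => ⟨_, hX i⟩) f
  have h1 : Ideal.Quotient.mk I (MvPolynomial.aeval a F) =
      Ideal.Quotient.mk I (MvPolynomial.aeval a S) ^ N * Ideal.Quotient.mk I f :=
    congrArg Prod.fst hF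
  have h2 : hullMap α can F = hullMap α can S ^ N * hullMap α β f := congrArg Prod.snd hF
  have h3 : m ∣ F - S ^ N * z := by
    rw [← hker]
    change _ ∈ I
    have h4 : Ideal.Quotient.mk I f = Ideal.Quotient.mk I (MvPolynomial.aeval a z) :=
      Ideal.Quotient.eq.2 hfz
    rw [← Ideal.Quotient.eq_zero_iff_mem, map_sub, map_sub, h1, h4, map_mul, map_pow, map_mul,
      map_pow, sub_self]
  obtain ⟨q, hq⟩ := h3
  have h5 := congrArg (hullMap α can) hq
  rw [map_mul, hcanm, zero_mul, map_sub, map_mul, map_pow, h2, sub_eq_zero] at h5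
  exact (hcanS.pow N).mul_left_cancel h5

/-- A set of good `p` must serve all `f` at once, so membership cannot be transferred polynomial by
polynomial. The homomorphism `β p` handles them together: it kills the approximating ideal, and
composed with the substitution of `ap` it is the map to `(F̄_p[Y]/(m_p))[1/S_p]`, whose kernel is
`(m_p)` because the prime `m_p` does not divide `S_p`. -/
theorem IsPolyApprox.eventually_dvd_of_aeval_mem (hg : ∀ i, IsPolyApprox α (g i) (gp i))
    (ha : ∀ j, IsPolyApprox α (a j) (ap j)) (hmp : IsPolyApprox α m mp) (hm : Prime m)
    (hker : ∀ f, MvPolynomial.aeval a f ∈ Ideal.span (Set.range g) ↔ m ∣ f) (hS : ¬ m ∣ S)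
    (hb : ∀ i, MvPolynomial.aeval a (b i) - MvPolynomial.aeval a S * X i ∈
      Ideal.span (Set.range g)) :
    ∀ᶠ p in (ℱ : Filter Nat.Primes), ∀ f : MvPolynomial (Fin d) (FBar p),
      MvPolynomial.aeval (fun j => ap j p) f ∈ Ideal.span (Set.range fun i => gp i p) →
        mp p ∣ f := by
  obtain ⟨Sp, hSp⟩ := exists_approx (α := α) S
  let Sq : ∀ p, MvPolynomial (Fin d) (FBar p) ⧸ Ideal.span {mp p} := fun p =>
    Ideal.Quotient.mk _ (Sp p)
  let can : ∀ p, MvPolynomial (Fin d) (FBar p) →+* Localization.Away (Sq p) := fun p =>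
    (algebraMap _ (Localization.Away (Sq p))).comp (Ideal.Quotient.mk (Ideal.span {mp p}))
  obtain ⟨β, hβC, key⟩ := exists_hullMap_eq can hmp hSp
    (fun p => IsLocalization.Away.algebraMap_isUnit (Sq p)) (fun p => by
      rw [RingHom.comp_apply, Ideal.Quotient.eq_zero_iff_mem.2 (Ideal.mem_span_singleton_self _),
        map_zero]) hker hb
  have hgen : ∀ i, ∀ᶠ p in (ℱ : Filter Nat.Primes), β p (gp i p) = 0 := by
    intro i
    have := key (g i) 0 (by rw [map_zero, sub_zero]; exact Ideal.subset_span ⟨i, rfl⟩)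
    rw [map_zero, hullMap_apply (hg i), ulim_zero, ulim_eq_ulim_iff] at this
    exact this
  have hvar : ∀ j, ∀ᶠ p in (ℱ : Filter Nat.Primes), β p (ap j p) = can p (X j) := by
    intro j
    have := key (a j) (X j) (by rw [aeval_X, sub_self]; exact zero_mem _)
    rw [hullMap_apply (ha j), hullMap_X, ulim_eq_ulim_iff] at this
    exact this
  have hprime : (Ideal.span {m}).IsPrime := (Ideal.span_singleton_prime hm.ne_zero).2 hm
  have hmS := IsPolyApprox.eventually_notMem (ι := Unit) (g := fun _ => m) (gp := fun _ => mp)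
    (fun _ => hmp) (by rw [Set.range_const]) hSp (P := Ideal.span {m})
    (by rwa [Ideal.mem_span_singleton])
  filter_upwards [eventually_all.2 hgen, eventually_all.2 hvar, hmS, hmp.eventually_prime hm]
    with p h1 h2 h3 h4 f hf
  rw [Set.range_const, Ideal.mem_span_singleton] at h3
  have h5 : ∀ x ∈ Ideal.span (Set.range fun i => gp i p), β p x = 0 := by
    have : Ideal.span (Set.range fun i => gp i p) ≤ RingHom.ker (β p) := by
      rw [Ideal.span_le]
      rintro _ ⟨i, rfl⟩
      exact h1 i
    exact this
  have h6 : (β p).comp (MvPolynomial.aeval (R := FBar p) fun j => ap j p).toRingHom = can p := by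
    refine MvPolynomial.ringHom_ext (fun c => ?_) fun j => ?_
    · rw [← hβC]
      exact congrArg (β p) (algHom_C (MvPolynomial.aeval (R := FBar p) fun j => ap j p) c)
    · rw [← h2]
      exact congrArg (β p) (aeval_X (R := FBar p) (fun j => ap j p) j)
  have h7 : can p f = 0 := by
    rw [← h6]
    exact h5 _ hf
  obtain ⟨⟨_, k, rfl⟩, hk⟩ := (IsLocalization.map_eq_zero_iff (Submonoid.powers (Sq p))
    (Localization.Away (Sq p)) (Ideal.Quotient.mk _ f)).1 h7
  have h8 : mp p ∣ Sp p ^ k * f := by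
    rw [← Ideal.mem_span_singleton, ← Ideal.Quotient.eq_zero_iff_mem, map_mul, map_pow]
    exact hk
  exact (h4.dvd_or_dvd h8).resolve_left fun h => h3 (h4.dvd_of_dvd_pow h)

/-- Approximations of a prime ideal are prime for almost all `p`. -/
theorem IsPolyApprox.eventually_isPrime (hg : ∀ i, IsPolyApprox α (g i) (gp i))
    (hI : (Ideal.span (Set.range g)).IsPrime) :
    ∀ᶠ p in (ℱ : Filter Nat.Primes), (Ideal.span (Set.range fun i => gp i p)).IsPrime := by
  obtain ⟨d, ζ, m, S, b, hm, hker, hS, hb⟩ := exists_birational_hypersurface (K := ℂ)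
    fun i => Ideal.Quotient.mk (Ideal.span (Set.range g)) (X i)
  choose a ha using fun j => Ideal.Quotient.mk_surjective (ζ (X j))
  have hζ : ∀ f, ζ f = Ideal.Quotient.mk _ (MvPolynomial.aeval a f) := by
    intro f
    change _ = ((Ideal.Quotient.mkₐ ℂ (Ideal.span (Set.range g))).comp (MvPolynomial.aeval a)) f
    congr 1
    refine MvPolynomial.algHom_ext fun j => ?_
    rw [AlgHom.comp_apply, aeval_X]
    exact (ha j).symm
  simp only [hζ, Ideal.Quotient.eq_zero_iff_mem, Ne] at hker hS
  have hb' : ∀ i, MvPolynomial.aeval a (b i) - MvPolynomial.aeval a S * X i ∈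
      Ideal.span (Set.range g) := fun i => by
    rw [← Ideal.Quotient.eq, map_mul, ← hζ, ← hζ]
    exact hb i
  choose ap hap using fun j => exists_approx (α := α) (a j)
  choose bp hbp using fun i => exists_approx (α := α) (b i)
  obtain ⟨mp, hmp⟩ := exists_approx (α := α) m
  obtain ⟨Sp, hSp⟩ := exists_approx (α := α) S
  have e1 := eventually_dvd_of_aeval_mem hg hap hmp hm hker (fun h => hS ((hker S).2 h)) hb'
  have e2 := eventually_mem hg (hmp.aeval hap) ((hker m).2 dvd_rfl)
  have e3 := eventually_all.2 fun i => eventually_mem hg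
    (((hbp i).aeval hap).sub ((hSp.aeval hap).mul (polyHull_X i))) (hb' i)
  have e4 := eventually_mem_of_mul_mem hg (hSp.aeval hap)
    fun x hx => (hI.mem_or_mem hx).resolve_left hS
  have e5 := eventually_notMem hg rfl (IsPolyApprox.one (α := α) (n := n))
    ((Ideal.ne_top_iff_one _).1 hI.ne_top)
  filter_upwards [e1, e2, e3, e4, e5, hmp.eventually_prime hm] with p e1 e2 e3 e4 e5 e6
  set J := Ideal.span (Set.range fun i => gp i p)
  have hmJ : ∀ f, mp p ∣ f → MvPolynomial.aeval (fun j => ap j p) f ∈ J := by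
    rintro _ ⟨q, rfl⟩
    rw [map_mul]
    exact J.mul_mem_right _ e2
  have hpow : ∀ (N : ℕ) (x : MvPolynomial (Fin n) (FBar p)),
      MvPolynomial.aeval (fun j => ap j p) (Sp p) ^ N * x ∈ J → x ∈ J := by
    intro N
    induction N with
    | zero => intro x hx; simpa using hx
    | succ N ih =>
      intro x hx
      rw [pow_succ, mul_assoc] at hx
      exact e4 x (ih _ hx)
  have hclear := exists_map_eq_pow_mul
    ((Ideal.Quotient.mk J).comp (MvPolynomial.aeval (R := FBar p) fun j => ap j p).toRingHom) (Sp p)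
    (Ideal.Quotient.mk J) (fun c => ⟨C c, congrArg _ (algHom_C _ c)⟩) fun i => ⟨bp i p, by
      refine Eq.trans (Ideal.Quotient.eq.2 (e3 i)) (map_mul ..)⟩
  refine ⟨(Ideal.ne_top_iff_one _).2 e5, fun {x y} hxy => ?_⟩
  obtain ⟨N, F, hF⟩ := hclear x
  obtain ⟨M, G, hG⟩ := hclear y
  replace hF : Ideal.Quotient.mk J (MvPolynomial.aeval _ F) =
    Ideal.Quotient.mk J (MvPolynomial.aeval _ (Sp p)) ^ _ * _ := hF
  replace hG : Ideal.Quotient.mk J (MvPolynomial.aeval _ G) =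
    Ideal.Quotient.mk J (MvPolynomial.aeval _ (Sp p)) ^ _ * _ := hG
  -- Modulo `J`, powers of `S_p` turn `x` and `y` into images of `F` and `G`. Since `m_p` is prime
  -- it divides one of these, and regularity of `S_p` modulo `J` then removes the power.
  have hFG : mp p ∣ F * G := by
    refine e1 _ ?_
    rw [← Ideal.Quotient.eq_zero_iff_mem, map_mul, map_mul, hF, hG, mul_mul_mul_comm, ← map_mul _ x, Ideal.Quotient.eq_zero_iff_mem.2 hxy, mul_zero]
  refine (e6.dvd_or_dvd hFG).imp (fun h => hpow N x ?_) fun h => hpow M y ?_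
  · rw [← Ideal.Quotient.eq_zero_iff_mem, map_mul, map_pow, ← hF]
    exact Ideal.Quotient.eq_zero_iff_mem.2 (hmJ _ h)
  · rw [← Ideal.Quotient.eq_zero_iff_mem, map_mul, map_pow, ← hG]
    exact Ideal.Quotient.eq_zero_iff_mem.2 (hmJ _ h)

end

end

end PrimeTransfer

/-! ### Local rings given by polynomial data and a finite criterion for isomorphism. -/

section Presentations

noncomputable section

open MvPolynomial

theorem Fin.range_append_eq {β : Type*} {m n : ℕ} (a : Fin m → β) (b : Fin n → β) :
    Set.range (Fin.append a b) = Set.range a ∪ Set.range b := by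
  ext x
  constructor
  · rintro ⟨i, rfl⟩
    induction i using Fin.addCases with
    | left i => exact .inl ⟨i, (Fin.append_left a b i).symm⟩
    | right i => exact .inr ⟨i, (Fin.append_right a b i).symm⟩
  · rintro (⟨i, rfl⟩ | ⟨i, rfl⟩)
    exacts [⟨_, Fin.append_left a b i⟩, ⟨_, Fin.append_right a b i⟩]

namespace PairData

variable {K : Type} [CommRing K] {n r s k : ℕ} (D : PairData K n r s k)

/-- The ideal of `K[X]` defining the prime ideal of the presentation. -/
def polyIdeal : Ideal (MvPolynomial (Fin n) K) := Ideal.span (Set.range (Fin.append D.eqn D.gen))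

theorem cls_mem_genIdeal_iff (f : MvPolynomial (Fin n) K) :
    D.cls f ∈ D.genIdeal ↔ f ∈ D.polyIdeal := by
  have h1 : D.genIdeal = (Ideal.span (Set.range D.gen)).map
      (Ideal.Quotient.mk (Ideal.span (Set.range D.eqn))) := by
    rw [Ideal.map_span, ← Set.range_comp]; rfl
  have h2 : D.polyIdeal = Ideal.span (Set.range D.gen) ⊔ Ideal.span (Set.range D.eqn) := by
    rw [polyIdeal, Fin.range_append_eq, Ideal.span_union, sup_comm]
  rw [h1, h2, ← Ideal.mem_comap, Ideal.comap_map_of_surjective _ Ideal.Quotient.mk_surjective,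
    ← RingHom.ker_eq_comap_bot, Ideal.mk_ker]

theorem genIdeal_isPrime_iff : D.genIdeal.IsPrime ↔ D.polyIdeal.IsPrime := by
  have h : D.polyIdeal = D.genIdeal.comap (Ideal.Quotient.mk _) := by
    ext f
    exact (D.cls_mem_genIdeal_iff f).symm
  rw [h]
  constructor
  · intro _
    infer_instance
  · intro h'
    refine ⟨fun h => h'.ne_top (by rw [h, Ideal.comap_top]), fun {x y} hxy => ?_⟩
    obtain ⟨x, rfl⟩ := Ideal.Quotient.mk_surjective x
    obtain ⟨y, rfl⟩ := Ideal.Quotient.mk_surjective y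
    exact h'.mem_or_mem (x := x) (y := y) (by rwa [Ideal.mem_comap, map_mul])

variable [D.genIdeal.IsPrime]

/-- The canonical homomorphism from the polynomial ring to the local ring of a presentation. -/
def can : MvPolynomial (Fin n) K →+* Localization.AtPrime D.genIdeal :=
  (algebraMap D.Alg (Localization.AtPrime D.genIdeal)).comp (Ideal.Quotient.mk _)

theorem can_eqn (j : Fin r) : D.can (D.eqn j) = 0 := by
  have : D.cls (D.eqn j) = 0 := Ideal.Quotient.eq_zero_iff_mem.2 (Ideal.subset_span ⟨j, rfl⟩)
  exact (congrArg (algebraMap D.Alg (Localization.AtPrime D.genIdeal)) this).trans (map_zero _)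

theorem can_mem_maximalIdeal_iff (f : MvPolynomial (Fin n) K) :
    D.can f ∈ IsLocalRing.maximalIdeal (Localization.AtPrime D.genIdeal) ↔ f ∈ D.polyIdeal := by
  rw [← cls_mem_genIdeal_iff]
  exact IsLocalization.AtPrime.to_map_mem_maximal_iff (Localization.AtPrime D.genIdeal) D.genIdeal
    (D.cls f)

theorem isUnit_can_iff (f : MvPolynomial (Fin n) K) : IsUnit (D.can f) ↔ f ∉ D.polyIdeal := by
  rw [← can_mem_maximalIdeal_iff, IsLocalRing.mem_maximalIdeal, mem_nonunits_iff, not_not]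

theorem exists_mul_can_eq (z : Localization.AtPrime D.genIdeal) :
    ∃ f u, u ∉ D.polyIdeal ∧ z * D.can u = D.can f := by
  obtain ⟨⟨x, u⟩, h⟩ := IsLocalization.surj D.genIdeal.primeCompl z
  obtain ⟨f, rfl⟩ := Ideal.Quotient.mk_surjective x
  obtain ⟨v, hv⟩ := Ideal.Quotient.mk_surjective u.1
  refine ⟨f, v, ?_, ?_⟩
  · rw [← cls_mem_genIdeal_iff, cls, hv]
    exact u.2
  · rw [can, RingHom.comp_apply, RingHom.comp_apply, hv]
    exact h

theorem exists_mul_can_eq_of_finite {ι : Type*} [Finite ι]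
    (z : ι → Localization.AtPrime D.genIdeal) :
    ∃ (f : ι → _) (u : _), u ∉ D.polyIdeal ∧ ∀ i, D.can u * z i = D.can (f i) := by
  classical
  have := Fintype.ofFinite ι
  choose f u hu hf using fun i => D.exists_mul_can_eq (z i)
  refine ⟨fun i => (∏ j ∈ Finset.univ.erase i, u j) * f i, ∏ i, u i, ?_, fun i => ?_⟩
  · rw [← isUnit_can_iff, map_prod, IsUnit.prod_univ_iff]
    exact fun i => (D.isUnit_can_iff _).2 (hu i)
  · rw [map_mul, ← hf, mul_comm (z i), ← mul_assoc, ← map_mul,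
      Finset.prod_erase_mul _ _ (Finset.mem_univ i)]

theorem exists_lift {T : Type*} [CommRing T] (ψ : MvPolynomial (Fin n) K →+* T)
    (h0 : ∀ j, ψ (D.eqn j) = 0) (hu : ∀ f ∉ D.polyIdeal, IsUnit (ψ f)) :
    ∃ φ : Localization.AtPrime D.genIdeal →+* T, ∀ f, φ (D.can f) = ψ f := by
  have h : ∀ f ∈ Ideal.span (Set.range D.eqn), ψ f = 0 := by
    have : Ideal.span (Set.range D.eqn) ≤ RingHom.ker ψ := by
      rw [Ideal.span_le]
      rintro _ ⟨j, rfl⟩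
      exact h0 j
    exact this
  let ψ' : D.Alg →+* T := Ideal.Quotient.lift _ ψ h
  have hu' : ∀ y : D.genIdeal.primeCompl, IsUnit (ψ' y) := by
    rintro ⟨y, hy⟩
    obtain ⟨f, rfl⟩ := Ideal.Quotient.mk_surjective y
    exact hu f fun hf => hy ((D.cls_mem_genIdeal_iff f).2 hf)
  exact ⟨IsLocalization.lift hu', fun f => IsLocalization.lift_eq hu' _⟩

variable {D} in
theorem ringHom_ext_can {T : Type*} [CommRing T]
    {φ φ' : Localization.AtPrime D.genIdeal →+* T} (h : ∀ f, φ (D.can f) = φ' (D.can f)) :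
    φ = φ' := by
  exact IsLocalization.ringHom_ext D.genIdeal.primeCompl
    (Ideal.Quotient.ringHom_ext (RingHom.ext h))

/-- The fraction `num_j / den_j`. -/
def frac (hden : ∀ j, D.cls (D.den j) ∉ D.genIdeal) (j : Fin k) :
    Localization.AtPrime D.genIdeal :=
  Localization.mk (D.cls (D.num j)) (⟨D.cls (D.den j), hden j⟩ : D.genIdeal.primeCompl)

theorem fracIdeal_eq_span (hden : ∀ j, D.cls (D.den j) ∉ D.genIdeal) :
    D.fracIdeal hden = Ideal.span (Set.range (D.frac hden)) := rfl

theorem frac_mul_can (hden : ∀ j, D.cls (D.den j) ∉ D.genIdeal) (j : Fin k) :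
    D.frac hden j * D.can (D.den j) = D.can (D.num j) := by
  rw [frac, Localization.mk_eq_mk']
  exact IsLocalization.mk'_spec _ _ _

theorem isUnit_can_den (hden : ∀ j, D.cls (D.den j) ∉ D.genIdeal) (j : Fin k) :
    IsUnit (D.can (D.den j)) := by
  rw [isUnit_can_iff, ← cls_mem_genIdeal_iff]
  exact hden j

section Comparison

variable {n' r' s' k' : ℕ} (E : PairData K n' r' s' k') [E.genIdeal.IsPrime]

/-- `ψ` and the denominator `u` describe a homomorphism from an affine neighbourhood, inverted by
`θ` up to denominators. -/
theorem exists_pow_of_inverse (ψ : MvPolynomial (Fin n') K →+* Localization.AtPrime D.genIdeal)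
    (θ : MvPolynomial (Fin n) K →+* Localization.AtPrime E.genIdeal)
    (hψC : ∀ c, ψ (C c) = D.can (C c)) (hθC : ∀ c, θ (C c) = E.can (C c))
    (u : MvPolynomial (Fin n) K) (a : Fin n' → MvPolynomial (Fin n) K)
    (hψ : ∀ i, D.can u * ψ (X i) = D.can (a i)) (hθ : ∀ i, θ u * E.can (X i) = θ (a i))
    (f : MvPolynomial (Fin n') K) :
    ∃ (N : ℕ) (F : MvPolynomial (Fin n) K), D.can F = D.can u ^ N * ψ f ∧
      θ F = θ u ^ N * E.can f := by
  have hC : ∀ c, D.can.prod θ (C c) = ψ.prod E.can (C c) := fun c =>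
    Prod.ext (hψC c).symm (hθC c)
  have hX : ∀ i, D.can.prod θ (a i) = D.can.prod θ u * ψ.prod E.can (X i) := fun i =>
    Prod.ext (hψ i).symm (hθ i).symm
  obtain ⟨N, F, hF⟩ := exists_map_eq_pow_mul
    (E := Localization.AtPrime D.genIdeal × Localization.AtPrime E.genIdeal)
    (D.can.prod θ) u (ψ.prod E.can)
    (fun c => ⟨_, hC c⟩) (fun i => ⟨_, hX i⟩) f
  exact ⟨N, F, congrArg Prod.fst hF, congrArg Prod.snd hF⟩

omit [D.genIdeal.IsPrime] in
theorem map_mem_maximalIdeal (θ : MvPolynomial (Fin n) K →+* Localization.AtPrime E.genIdeal)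
    (h0 : ∀ j, θ (D.eqn j) = 0)
    (hgen : ∀ j, θ (D.gen j) ∈ IsLocalRing.maximalIdeal (Localization.AtPrime E.genIdeal))
    (f : MvPolynomial (Fin n) K) (hf : f ∈ D.polyIdeal) :
    θ f ∈ IsLocalRing.maximalIdeal (Localization.AtPrime E.genIdeal) := by
  have : D.polyIdeal ≤ (IsLocalRing.maximalIdeal (Localization.AtPrime E.genIdeal)).comap θ := by
    rw [polyIdeal, Fin.range_append_eq, Ideal.span_le]
    rintro _ (⟨j, rfl⟩ | ⟨j, rfl⟩)
    · rw [SetLike.mem_coe, Ideal.mem_comap, h0]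
      exact zero_mem _
    · exact hgen j
  exact this hf

/-- All conditions are finitely many identities, units and memberships, so that they can be checked
for almost all `p`. The maps extend to the local rings because clearing denominators turns a
non-unit value `ψ f` into a non-unit value of `E.can f`. -/
theorem exists_ringEquiv (ψ : MvPolynomial (Fin n') K →+* Localization.AtPrime D.genIdeal)
    (θ : MvPolynomial (Fin n) K →+* Localization.AtPrime E.genIdeal)
    (hψC : ∀ c, ψ (C c) = D.can (C c)) (hθC : ∀ c, θ (C c) = E.can (C c))
    (hψ0 : ∀ j, ψ (E.eqn j) = 0) (hθ0 : ∀ j, θ (D.eqn j) = 0)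
    (hψgen : ∀ j, ψ (E.gen j) ∈ IsLocalRing.maximalIdeal (Localization.AtPrime D.genIdeal))
    (hθgen : ∀ j, θ (D.gen j) ∈ IsLocalRing.maximalIdeal (Localization.AtPrime E.genIdeal))
    (u : MvPolynomial (Fin n) K) (a : Fin n' → MvPolynomial (Fin n) K) (hu : IsUnit (θ u))
    (hψ : ∀ i, D.can u * ψ (X i) = D.can (a i)) (hθ : ∀ i, θ u * E.can (X i) = θ (a i))
    (v : MvPolynomial (Fin n') K) (b : Fin n → MvPolynomial (Fin n') K) (hv : IsUnit (ψ v))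
    (hθ' : ∀ i, E.can v * θ (X i) = E.can (b i)) (hψ' : ∀ i, ψ v * D.can (X i) = ψ (b i)) :
    ∃ e : Localization.AtPrime E.genIdeal ≃+* Localization.AtPrime D.genIdeal,
      (∀ f, e (E.can f) = ψ f) ∧ ∀ f, e.symm (D.can f) = θ f := by
  have h1 := exists_pow_of_inverse D E ψ θ hψC hθC u a hψ hθ
  have h2 := exists_pow_of_inverse E D θ ψ hθC hψC v b hθ' hψ'
  obtain ⟨φ, hφ⟩ := E.exists_lift (T := Localization.AtPrime D.genIdeal) ψ hψ0 fun f hf => by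
    by_contra hcon
    have hf' : ψ f ∈ IsLocalRing.maximalIdeal (Localization.AtPrime D.genIdeal) := hcon
    obtain ⟨N, F, hF1, hF2⟩ := h1 f
    have h3 : D.can F ∈ IsLocalRing.maximalIdeal (Localization.AtPrime D.genIdeal) := by
      rw [hF1]
      exact Ideal.mul_mem_left _ _ hf'
    have h4 := D.map_mem_maximalIdeal E θ hθ0 hθgen F ((D.can_mem_maximalIdeal_iff F).1 h3)
    rw [hF2, Ideal.unit_mul_mem_iff_mem _ (hu.pow N), can_mem_maximalIdeal_iff] at h4
    exact hf h4
  obtain ⟨τ, hτ⟩ := D.exists_lift (T := Localization.AtPrime E.genIdeal) θ hθ0 fun f hf => by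
    by_contra hcon
    have hf' : θ f ∈ IsLocalRing.maximalIdeal (Localization.AtPrime E.genIdeal) := hcon
    obtain ⟨N, F, hF1, hF2⟩ := h2 f
    have h3 : E.can F ∈ IsLocalRing.maximalIdeal (Localization.AtPrime E.genIdeal) := by
      rw [hF1]
      exact Ideal.mul_mem_left _ _ hf'
    have h4 := E.map_mem_maximalIdeal D ψ hψ0 hψgen F ((E.can_mem_maximalIdeal_iff F).1 h3)
    rw [hF2, Ideal.unit_mul_mem_iff_mem _ (hv.pow N), can_mem_maximalIdeal_iff] at h4
    exact hf h4
  have h3 : φ.comp τ = RingHom.id _ := ringHom_ext_can (D := D) fun f => by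
    obtain ⟨N, F, hF1, hF2⟩ := h2 f
    rw [RingHom.comp_apply, hτ, RingHom.id_apply]
    refine (hv.pow N).mul_left_cancel ?_
    rw [← hF2, ← hφ, ← hφ, hF1, map_mul, map_pow]
  have h4 : τ.comp φ = RingHom.id _ := ringHom_ext_can (D := E) fun f => by
    obtain ⟨N, F, hF1, hF2⟩ := h1 f
    rw [RingHom.comp_apply, hφ, RingHom.id_apply]
    refine (hu.pow N).mul_left_cancel ?_
    rw [← hF2, ← hτ, ← hτ, hF1, map_mul, map_pow]
  exact ⟨RingEquiv.ofRingHom φ τ h3 h4, hφ, hτ⟩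

theorem map_fracIdeal_le (e : Localization.AtPrime E.genIdeal ≃+* Localization.AtPrime D.genIdeal)
    {ψ : MvPolynomial (Fin n') K →+* Localization.AtPrime D.genIdeal} (he : ∀ f, e (E.can f) = ψ f)
    (hE : ∀ j, E.cls (E.den j) ∉ E.genIdeal) (I : Ideal (Localization.AtPrime D.genIdeal))
    (h : ∀ j, ∃ w ∈ I, w * ψ (E.den j) = ψ (E.num j)) : (E.fracIdeal hE).map e ≤ I := by
  rw [fracIdeal_eq_span, Ideal.map_span, Ideal.span_le]
  rintro _ ⟨_, ⟨j, rfl⟩, rfl⟩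
  obtain ⟨w, hw, h⟩ := h j
  have hu : IsUnit (e (E.can (E.den j))) := (E.isUnit_can_den hE j).map e
  rw [← he, ← he, ← E.frac_mul_can hE j, map_mul] at h
  rw [SetLike.mem_coe, ← hu.mul_right_cancel h]
  exact hw

theorem map_fracIdeal_eq (e : Localization.AtPrime E.genIdeal ≃+* Localization.AtPrime D.genIdeal)
    {ψ : MvPolynomial (Fin n') K →+* Localization.AtPrime D.genIdeal}
    {θ : MvPolynomial (Fin n) K →+* Localization.AtPrime E.genIdeal}
    (he : ∀ f, e (E.can f) = ψ f) (he' : ∀ f, e.symm (D.can f) = θ f)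
    (hD : ∀ j, D.cls (D.den j) ∉ D.genIdeal) (hE : ∀ j, E.cls (E.den j) ∉ E.genIdeal)
    (h : ∀ j, ∃ w ∈ D.fracIdeal hD, w * ψ (E.den j) = ψ (E.num j))
    (h' : ∀ j, ∃ w ∈ E.fracIdeal hE, w * θ (D.den j) = θ (D.num j)) :
    (E.fracIdeal hE).map e = D.fracIdeal hD := by
  refine le_antisymm (map_fracIdeal_le D E e he hE _ h) ?_
  intro x hx
  rw [← e.apply_symm_apply x]
  exact Ideal.mem_map_of_mem e (map_fracIdeal_le E D e.symm he' hD _ h' (Ideal.mem_map_of_mem _ hx))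

end Comparison

end PairData

end

end Presentations

/-! ### Approximations do not depend on the presentation, up to isomorphism for almost all `p`. -/

section PresentationIndependence

noncomputable section

open MvPolynomial

theorem isUnit_ulim_iff (ℱ : Ultrafilter Nat.Primes) {A : Nat.Primes → Type}
    [∀ p, CommRing (A p)] (x : ∀ p, A p) :
    IsUnit (ulim ℱ x) ↔ ∀ᶠ p in (ℱ : Filter Nat.Primes), IsUnit (x p) := by
  constructor
  · intro h
    obtain ⟨y, hy⟩ := h.exists_right_inv
    obtain ⟨y, rfl⟩ := exists_ulim_eq ℱ y
    rw [ulim_mul, ulim_one, ulim_eq_ulim_iff] at hy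
    filter_upwards [hy] with p hp using IsUnit.of_mul_eq_one _ hp
  · intro h
    refine IsUnit.of_mul_eq_one (ulim ℱ fun p => Ring.inverse (x p)) ?_
    rw [ulim_mul, ulim_one, ulim_eq_ulim_iff]
    filter_upwards [h] with p hp using Ring.mul_inverse_cancel _ hp

theorem Ideal.exists_algEquiv_map_eq {K A B C : Type*} [CommSemiring K] [Semiring A] [Semiring B]
    [Semiring C] [Algebra K A] [Algebra K B] [Algebra K C] (e : A ≃ₐ[K] B) (f : C ≃ₐ[K] B)
    {I : Ideal A} {J : Ideal C} (h : I.map e = J.map f) : ∃ g : A ≃ₐ[K] C, I.map g = J := by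
  refine ⟨e.trans f.symm, ?_⟩
  ext x
  constructor
  · intro hx
    obtain ⟨y, hy, rfl⟩ := (Ideal.mem_map_of_equiv (e.trans f.symm) x).1 hx
    have h1 := Ideal.mem_map_of_mem e hy
    rw [h] at h1
    obtain ⟨z, hz, hz'⟩ := (Ideal.mem_map_of_equiv f _).1 h1
    change f.symm (e y) ∈ J
    rwa [← hz', f.symm_apply_apply]
  · intro hx
    have h1 := Ideal.mem_map_of_mem f hx
    rw [← h] at h1
    obtain ⟨z, hz, hz'⟩ := (Ideal.mem_map_of_equiv e _).1 h1
    refine (Ideal.mem_map_of_equiv (e.trans f.symm) x).2 ⟨z, hz, ?_⟩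
    change f.symm (e z) = x
    rw [hz', f.symm_apply_apply]

theorem PairProperty.Ascends.of_map_eq {Φ : PairProperty} (hΦ : Φ.Ascends) (p : ℕ)
    [Fact p.Prime] {A B : Type} [CommRing A] [CommRing B] [IsLocalRing A] [IsLocalRing B]
    [IsNoetherianRing A] [CharP A p] {I : Ideal A} {J : Ideal B} (e : A ≃+* B)
    (he : I.map e = J) (h : Φ A I) : Φ B J := by
  subst he
  exact hΦ.of_ringEquiv p e h

namespace PairData

theorem satisfies_iff {Φ : PairProperty} {K : Type} [Field K] {n r s k : ℕ} {D : PairData K n r s k}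
    [D.genIdeal.IsPrime] (hD : ∀ j, D.cls (D.den j) ∉ D.genIdeal) :
    D.Satisfies Φ ↔ Φ (Localization.AtPrime D.genIdeal) (D.fracIdeal hD) :=
  ⟨fun ⟨_, _, h⟩ => h, fun h => ⟨inferInstance, hD, h⟩⟩

theorem charP_localization (p : ℕ) [Fact p.Prime] {K : Type} [Field K] [CharP K p] {n r s k : ℕ}
    (D : PairData K n r s k) [D.genIdeal.IsPrime] : CharP (Localization.AtPrime D.genIdeal) p := by
  refine (CharP.charP_iff_prime_eq_zero Fact.out).2 ?_
  rw [← map_natCast (D.can.comp C), CharP.cast_eq_zero, map_zero]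

theorem Satisfies.of_ringEquiv {Φ : PairProperty} (hΦ : Φ.Ascends) {K : Type} [Field K] (p : ℕ)
    [Fact p.Prime] [CharP K p] {n r s k n' r' s' k' : ℕ} {D : PairData K n r s k}
    {E : PairData K n' r' s' k'} [D.genIdeal.IsPrime] [E.genIdeal.IsPrime]
    (hD : ∀ j, D.cls (D.den j) ∉ D.genIdeal) (hE : ∀ j, E.cls (E.den j) ∉ E.genIdeal)
    (e : Localization.AtPrime E.genIdeal ≃+* Localization.AtPrime D.genIdeal)
    (he : (E.fracIdeal hE).map e = D.fracIdeal hD) (h : E.Satisfies Φ) : D.Satisfies Φ :=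
  have := E.charP_localization p
  (satisfies_iff (D := D) hD).2 (hΦ.of_map_eq (A := Localization.AtPrime E.genIdeal)
    (B := Localization.AtPrime D.genIdeal) p e he ((satisfies_iff (D := E) hE).1 h))

theorem algebraMap_eq_can {K : Type} [CommRing K] {n r s k : ℕ} (D : PairData K n r s k)
    [D.genIdeal.IsPrime] (c : K) : algebraMap K (Localization.AtPrime D.genIdeal) c = D.can (C c) :=
  rfl

variable {ℱ : Ultrafilter Nat.Primes} {α : UltraProd ℱ FBar ≃+* ℂ} {n r s k : ℕ}
  {D : PairData ℂ n r s k} {Dp : ∀ p : Nat.Primes, PairData (FBar p) n r s k}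

theorem IsApproximation.append (h : D.IsApproximation α Dp) (i : Fin (r + s)) :
    IsPolyApprox α (Fin.append D.eqn D.gen i) fun p => Fin.append (Dp p).eqn (Dp p).gen i := by
  induction i using Fin.addCases with
  | left i => simpa only [Fin.append_left] using h.eqn i
  | right i => simpa only [Fin.append_right] using h.gen i

theorem IsApproximation.eventually_isPrime (h : D.IsApproximation α Dp)
    [hD : D.genIdeal.IsPrime] : ∀ᶠ p in (ℱ : Filter Nat.Primes), (Dp p).genIdeal.IsPrime := by
  filter_upwards [IsPolyApprox.eventually_isPrime h.append (D.genIdeal_isPrime_iff.1 hD)] with p hp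
  exact (genIdeal_isPrime_iff _).2 hp

theorem IsApproximation.eventually_notMem (h : D.IsApproximation α Dp) [hD : D.genIdeal.IsPrime]
    {f : MvPolynomial (Fin n) ℂ} {fp : ∀ p, MvPolynomial (Fin n) (FBar p)}
    (hf : IsPolyApprox α f fp) (hfD : f ∉ D.polyIdeal) :
    ∀ᶠ p in (ℱ : Filter Nat.Primes), fp p ∉ (Dp p).polyIdeal :=
  have := D.genIdeal_isPrime_iff.1 hD
  IsPolyApprox.eventually_notMem h.append (P := D.polyIdeal) rfl hf hfD

theorem IsApproximation.eventually_mem (h : D.IsApproximation α Dp)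
    {f : MvPolynomial (Fin n) ℂ} {fp : ∀ p, MvPolynomial (Fin n) (FBar p)}
    (hf : IsPolyApprox α f fp) (hfD : f ∈ D.polyIdeal) :
    ∀ᶠ p in (ℱ : Filter Nat.Primes), fp p ∈ (Dp p).polyIdeal :=
  IsPolyApprox.eventually_mem h.append hf hfD

variable [D.genIdeal.IsPrime] {T : Nat.Primes → Type} [∀ p, CommRing (T p)]
  {c : ∀ p, MvPolynomial (Fin n) (FBar p) →+* T p}

/-- The canonical homomorphism from a local ring to the ultraproduct of its approximations. -/
theorem IsApproximation.exists_hull (h : D.IsApproximation α Dp)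
    (h0 : ∀ p j, c p ((Dp p).eqn j) = 0) (hu : ∀ p, ∀ f ∉ (Dp p).polyIdeal, IsUnit (c p f)) :
    ∃ Θ : Localization.AtPrime D.genIdeal →+* UltraProd ℱ T, ∀ f, Θ (D.can f) = hullMap α c f := by
  refine D.exists_lift (hullMap α c) (fun j => ?_) fun f hf => ?_
  · rw [hullMap_apply (h.eqn j), ulim_zero]
    exact congrArg (ulim ℱ) (funext fun p => h0 p j)
  · obtain ⟨fp, hfp⟩ := IsPolyApprox.exists_approx (α := α) f
    rw [hullMap_apply hfp, isUnit_ulim_iff]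
    filter_upwards [h.eventually_notMem hfp hf] with p hp
    exact hu p _ hp

section

variable {Θ : Localization.AtPrime D.genIdeal →+* UltraProd ℱ T}
  (hΘ : ∀ f, Θ (D.can f) = hullMap α c f)

include hΘ

theorem IsApproximation.eventually_mem_of_mem_maximalIdeal (h : D.IsApproximation α Dp)
    (hu : ∀ p, ∀ f ∉ (Dp p).polyIdeal, IsUnit (c p f)) (m : ∀ p, Ideal (T p))
    (hm : ∀ p, ∀ f ∈ (Dp p).polyIdeal, c p f ∈ m p)
    {z : Localization.AtPrime D.genIdeal} (hz : z ∈ IsLocalRing.maximalIdeal _)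
    {zp : ∀ p, T p} (hzp : Θ z = ulim ℱ zp) :
    ∀ᶠ p in (ℱ : Filter Nat.Primes), zp p ∈ m p := by
  obtain ⟨f, u, huD, hfu⟩ := D.exists_mul_can_eq z
  have hf : f ∈ D.polyIdeal := by
    rw [← can_mem_maximalIdeal_iff, ← hfu]
    exact Ideal.mul_mem_right _ _ hz
  obtain ⟨fp, hfp⟩ := IsPolyApprox.exists_approx (α := α) f
  obtain ⟨up, hup⟩ := IsPolyApprox.exists_approx (α := α) u
  have h1 := congrArg Θ hfu
  rw [map_mul, hΘ, hΘ, hullMap_apply hfp, hullMap_apply hup, hzp, ulim_mul, ulim_eq_ulim_iff] at h1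
  filter_upwards [h1, h.eventually_notMem hup huD, h.eventually_mem hfp hf] with p h1 h2 h3
  have h4 := hm p _ h3
  rw [← h1] at h4
  exact (Ideal.mul_unit_mem_iff_mem _ (hu p _ h2)).1 h4

theorem IsApproximation.eventually_mem_of_mem_fracIdeal (h : D.IsApproximation α Dp)
    (hden : ∀ j, D.cls (D.den j) ∉ D.genIdeal) (q : Fin k → ∀ p, T p)
    (hq : ∀ p j, q j p * c p ((Dp p).den j) = c p ((Dp p).num j))
    {z : Localization.AtPrime D.genIdeal} (hz : z ∈ D.fracIdeal hden)
    {zp : ∀ p, T p} (hzp : Θ z = ulim ℱ zp) :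
    ∀ᶠ p in (ℱ : Filter Nat.Primes), zp p ∈ Ideal.span (Set.range fun j => q j p) := by
  rw [fracIdeal_eq_span] at hz
  obtain ⟨a, rfl⟩ := (Ideal.mem_span_range_iff_exists_fun ..).1 hz
  choose ap hap using fun j => exists_ulim_eq ℱ (Θ (a j))
  have hq : ∀ j, Θ (D.frac hden j) = ulim ℱ (q j) := by
    intro j
    refine (IsUnit.map Θ (D.isUnit_can_den hden j)).mul_right_cancel ?_
    rw [← map_mul, D.frac_mul_can hden, hΘ, hΘ, hullMap_apply (h.num j), hullMap_apply (h.den j),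
      ulim_mul]
    exact congrArg (ulim ℱ) (funext fun p => (hq p j).symm)
  have h1 : Θ (∑ j, a j * D.frac hden j) = ulim ℱ fun p => ∑ j, ap j p * q j p := by
    rw [map_sum, ← ulim_sum]
    refine Finset.sum_congr rfl fun j _ => ?_
    rw [map_mul, hq, ← hap, ulim_mul]
  have h2 := hzp.symm.trans h1
  rw [ulim_eq_ulim_iff] at h2
  filter_upwards [h2] with p hp
  rw [hp]
  exact Ideal.sum_mem _ fun j _ => Ideal.mul_mem_left _ _ (Ideal.subset_span ⟨j, rfl⟩)

/-- The isomorphism `σ` is lifted to a family of homomorphisms by choosing representatives of the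
images of the variables; on constants the family is forced. -/
theorem exists_family {n' r' s' k' : ℕ} {E : PairData ℂ n' r' s' k'} [E.genIdeal.IsPrime]
    (σ : Localization.AtPrime E.genIdeal ≃ₐ[ℂ] Localization.AtPrime D.genIdeal) :
    ∃ ψ : ∀ p, MvPolynomial (Fin n') (FBar p) →+* T p,
      (∀ p a, ψ p (C a) = c p (C a)) ∧ ∀ f, hullMap α ψ f = Θ (σ (E.can f)) := by
  choose y hy using fun i => exists_ulim_eq ℱ (Θ (σ (E.can (X i))))
  let ψ : ∀ p, MvPolynomial (Fin n') (FBar p) →+* T p := fun p =>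
    eval₂Hom ((c p).comp C) fun i => y i p
  have hψC : ∀ p a, ψ p (C a) = c p (C a) := fun p a => by simp [ψ]
  refine ⟨ψ, hψC, fun f => ?_⟩
  change _ = (Θ.comp ((σ : Localization.AtPrime E.genIdeal →+* Localization.AtPrime D.genIdeal).comp
    E.can)) f
  congr 1
  refine MvPolynomial.ringHom_ext (fun a => ?_) fun i => ?_
  · have h1 : σ (E.can (C a)) = D.can (C a) := by
      rw [← algebraMap_eq_can, ← algebraMap_eq_can, σ.commutes]
    change _ = Θ (σ (E.can (C a)))
    rw [h1, hΘ, hullMap_C, hullMap_C]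
    exact congrArg (ulim ℱ) (funext fun p => hψC p _)
  · rw [hullMap_X]
    refine Eq.trans (congrArg (ulim ℱ) (funext fun p => ?_)) (hy i)
    simp [ψ]

end

section

variable {n' r' s' k' : ℕ} {E : PairData ℂ n' r' s' k'}
  {Ep : ∀ p : Nat.Primes, PairData (FBar p) n' r' s' k'} [E.genIdeal.IsPrime]
  {Θ : Localization.AtPrime D.genIdeal →+* UltraProd ℱ T}
  {σ : Localization.AtPrime E.genIdeal ≃ₐ[ℂ] Localization.AtPrime D.genIdeal}
  {ψ : ∀ p, MvPolynomial (Fin n') (FBar p) →+* T p}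

theorem eventually_eqn_eq_zero (hE : E.IsApproximation α Ep)
    (hψ : ∀ f, hullMap α ψ f = Θ (σ (E.can f))) :
    ∀ᶠ p in (ℱ : Filter Nat.Primes), ∀ j, ψ p ((Ep p).eqn j) = 0 := by
  refine eventually_all.2 fun j => ?_
  have h1 := hψ (E.eqn j)
  rwa [hullMap_apply (hE.eqn j), E.can_eqn, map_zero, map_zero, ulim_zero, ulim_eq_ulim_iff] at h1

theorem eventually_gen_mem (hD : D.IsApproximation α Dp) (hE : E.IsApproximation α Ep)
    (hΘ : ∀ f, Θ (D.can f) = hullMap α c f) (hψ : ∀ f, hullMap α ψ f = Θ (σ (E.can f)))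
    (hu : ∀ p, ∀ f ∉ (Dp p).polyIdeal, IsUnit (c p f)) (m : ∀ p, Ideal (T p))
    (hm : ∀ p, ∀ f ∈ (Dp p).polyIdeal, c p f ∈ m p) :
    ∀ᶠ p in (ℱ : Filter Nat.Primes), ∀ j, ψ p ((Ep p).gen j) ∈ m p := by
  refine eventually_all.2 fun j => ?_
  refine hD.eventually_mem_of_mem_maximalIdeal hΘ hu m hm (z := σ (E.can (E.gen j))) ?_ ?_
  · have h1 : E.can (E.gen j) ∈ IsLocalRing.maximalIdeal (Localization.AtPrime E.genIdeal) := by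
      rw [can_mem_maximalIdeal_iff]
      exact Ideal.subset_span ⟨Fin.natAdd _ j, Fin.append_right ..⟩
    rw [IsLocalRing.mem_maximalIdeal, mem_nonunits_iff] at h1 ⊢
    rwa [MulEquiv.isUnit_map]
  · rw [← hψ, hullMap_apply (hE.gen j)]

/-- One equation `u * σ (X_i) = a_i` with a common denominator `u` is read through `Θ` and through
`Θ' ∘ σ⁻¹`; this yields the two systems required by `exists_ringEquiv`. -/
theorem exists_denominators {T' : Nat.Primes → Type} [∀ p, CommRing (T' p)]
    {c' : ∀ p, MvPolynomial (Fin n') (FBar p) →+* T' p}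
    {Θ' : Localization.AtPrime E.genIdeal →+* UltraProd ℱ T'}
    {θ : ∀ p, MvPolynomial (Fin n) (FBar p) →+* T' p}
    (hΘ : ∀ f, Θ (D.can f) = hullMap α c f) (hΘ' : ∀ f, Θ' (E.can f) = hullMap α c' f)
    (hψ : ∀ f, hullMap α ψ f = Θ (σ (E.can f)))
    (hθ : ∀ f, hullMap α θ f = Θ' (σ.symm (D.can f))) :
    ∃ (u : ∀ p, MvPolynomial (Fin n) (FBar p)) (a : Fin n' → ∀ p, MvPolynomial (Fin n) (FBar p)),
      ∀ᶠ p in (ℱ : Filter Nat.Primes), IsUnit (θ p (u p)) ∧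
        (∀ i, c p (u p) * ψ p (X i) = c p (a i p)) ∧
        ∀ i, θ p (u p) * c' p (X i) = θ p (a i p) := by
  obtain ⟨a, u, huD, ha⟩ := D.exists_mul_can_eq_of_finite fun i => σ (E.can (X i))
  obtain ⟨up, hup⟩ := IsPolyApprox.exists_approx (α := α) u
  choose ap hap using fun i => IsPolyApprox.exists_approx (α := α) (a i)
  have h1 : ∀ᶠ p in (ℱ : Filter Nat.Primes), IsUnit (θ p (up p)) := by
    rw [← isUnit_ulim_iff, ← hullMap_apply hup, hθ]
    exact ((D.isUnit_can_iff _).2 huD).map (Θ'.comp (σ.symm : _ →+* _))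
  have h2 : ∀ᶠ p in (ℱ : Filter Nat.Primes), ∀ i, c p (up p) * ψ p (X i) = c p (ap i p) := by
    refine eventually_all.2 fun i => ?_
    have := congrArg Θ (ha i)
    rwa [map_mul, ← hψ, hΘ, hΘ, hullMap_X, hullMap_apply hup, hullMap_apply (hap i), ulim_mul,
      ulim_eq_ulim_iff] at this
  have h3 : ∀ᶠ p in (ℱ : Filter Nat.Primes), ∀ i, θ p (up p) * c' p (X i) = θ p (ap i p) := by
    refine eventually_all.2 fun i => ?_
    have := congrArg (fun z => Θ' (σ.symm z)) (ha i)
    simp only [map_mul, σ.symm_apply_apply] at this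
    rwa [← hθ, ← hθ, hΘ', hullMap_X, hullMap_apply hup, hullMap_apply (hap i), ulim_mul,
      ulim_eq_ulim_iff] at this
  exact ⟨up, ap, h1.and (h2.and h3)⟩

theorem eventually_exists_frac (hD : D.IsApproximation α Dp) (hE : E.IsApproximation α Ep)
    (hΘ : ∀ f, Θ (D.can f) = hullMap α c f) (hψ : ∀ f, hullMap α ψ f = Θ (σ (E.can f)))
    (hdenD : ∀ j, D.cls (D.den j) ∉ D.genIdeal) (hdenE : ∀ j, E.cls (E.den j) ∉ E.genIdeal)
    (hσ : ∀ j, σ (E.frac hdenE j) ∈ D.fracIdeal hdenD) (q : Fin k → ∀ p, T p)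
    (hq : ∀ p j, q j p * c p ((Dp p).den j) = c p ((Dp p).num j)) :
    ∀ᶠ p in (ℱ : Filter Nat.Primes), ∀ j, ∃ w ∈ Ideal.span (Set.range fun j => q j p),
      w * ψ p ((Ep p).den j) = ψ p ((Ep p).num j) := by
  refine eventually_all.2 fun j => ?_
  obtain ⟨w, hw⟩ := exists_ulim_eq ℱ (Θ (σ (E.frac hdenE j)))
  have h1 := hD.eventually_mem_of_mem_fracIdeal hΘ hdenD q hq (hσ j) hw.symm
  have h2 : ∀ᶠ p in (ℱ : Filter Nat.Primes),
      w p * ψ p ((Ep p).den j) = ψ p ((Ep p).num j) := by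
    have := congrArg (fun z => Θ (σ z)) (E.frac_mul_can hdenE j)
    simp only [map_mul] at this
    rwa [← hψ, ← hψ, ← hw, hullMap_apply (hE.den j), hullMap_apply (hE.num j), ulim_mul,
      ulim_eq_ulim_iff] at this
  filter_upwards [h1, h2] with p h1 h2
  exact ⟨_, h1, h2⟩

end

/-- Approximations of presentations of the same pair are isomorphic for almost all `p`. -/
theorem eventually_exists_ringEquiv {n' r' s' k' : ℕ} {E : PairData ℂ n' r' s' k'}
    {Ep : ∀ p : Nat.Primes, PairData (FBar p) n' r' s' k'} [E.genIdeal.IsPrime]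
    [∀ p, (Dp p).genIdeal.IsPrime] [∀ p, (Ep p).genIdeal.IsPrime]
    (hD : D.IsApproximation α Dp) (hE : E.IsApproximation α Ep)
    (hdenD : ∀ j, D.cls (D.den j) ∉ D.genIdeal) (hdenE : ∀ j, E.cls (E.den j) ∉ E.genIdeal)
    (hdenDp : ∀ p j, (Dp p).cls ((Dp p).den j) ∉ (Dp p).genIdeal)
    (hdenEp : ∀ p j, (Ep p).cls ((Ep p).den j) ∉ (Ep p).genIdeal)
    (σ : Localization.AtPrime E.genIdeal ≃ₐ[ℂ] Localization.AtPrime D.genIdeal)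
    (hσ : (E.fracIdeal hdenE).map σ = D.fracIdeal hdenD) :
    ∀ᶠ p in (ℱ : Filter Nat.Primes),
      ∃ e : Localization.AtPrime (Ep p).genIdeal ≃+* Localization.AtPrime (Dp p).genIdeal,
        ((Ep p).fracIdeal (hdenEp p)).map e = (Dp p).fracIdeal (hdenDp p) := by
  obtain ⟨Θ, hΘ⟩ := hD.exists_hull (T := fun p => Localization.AtPrime (Dp p).genIdeal)
    (c := fun p => (Dp p).can) (fun p => (Dp p).can_eqn)
    fun p f => ((Dp p).isUnit_can_iff f).2
  obtain ⟨Θ', hΘ'⟩ := hE.exists_hull (T := fun p => Localization.AtPrime (Ep p).genIdeal)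
    (c := fun p => (Ep p).can) (fun p => (Ep p).can_eqn)
    fun p f => ((Ep p).isUnit_can_iff f).2
  obtain ⟨ψ, hψC, hψ⟩ := exists_family hΘ σ
  obtain ⟨θ, hθC, hθ⟩ := exists_family hΘ' σ.symm
  have hσ1 : ∀ j, σ (E.frac hdenE j) ∈ D.fracIdeal hdenD := fun j => by
    rw [← hσ]
    exact Ideal.mem_map_of_mem _ (Ideal.subset_span ⟨j, rfl⟩)
  have hσ2 : ∀ j, σ.symm (D.frac hdenD j) ∈ E.fracIdeal hdenE := fun j => by
    have : D.frac hdenD j ∈ (E.fracIdeal hdenE).map σ := by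
      rw [hσ]
      exact Ideal.subset_span ⟨j, rfl⟩
    obtain ⟨z, hz, hz'⟩ := (Ideal.mem_map_of_equiv σ _).1 this
    rwa [← hz', σ.symm_apply_apply]
  obtain ⟨u, a, hua⟩ := exists_denominators (σ := σ) hΘ hΘ' hψ hθ
  obtain ⟨v, b, hvb⟩ := exists_denominators (σ := σ.symm) hΘ' hΘ hθ hψ
  filter_upwards [hua, hvb, eventually_eqn_eq_zero hE hψ, eventually_eqn_eq_zero hD hθ,
    eventually_gen_mem hD hE hΘ hψ (fun p f => ((Dp p).isUnit_can_iff f).2)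
      (fun p => IsLocalRing.maximalIdeal _) fun p f => ((Dp p).can_mem_maximalIdeal_iff f).2,
    eventually_gen_mem hE hD hΘ' hθ (fun p f => ((Ep p).isUnit_can_iff f).2)
      (fun p => IsLocalRing.maximalIdeal _) fun p f => ((Ep p).can_mem_maximalIdeal_iff f).2,
    eventually_exists_frac hD hE hΘ hψ hdenD hdenE hσ1 (fun j p => (Dp p).frac (hdenDp p) j)
      fun p j => (Dp p).frac_mul_can (hdenDp p) j,
    eventually_exists_frac hE hD hΘ' hθ hdenE hdenD hσ2 (fun j p => (Ep p).frac (hdenEp p) j)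
      fun p j => (Ep p).frac_mul_can (hdenEp p) j]
    with p hua hvb hψ0 hθ0 hψg hθg hψf hθf
  obtain ⟨e, he, he'⟩ := exists_ringEquiv (Dp p) (Ep p) (ψ p) (θ p) (hψC p) (hθC p) hψ0 hθ0
    hψg hθg (u p) (fun i => a i p) hua.1 hua.2.1 hua.2.2 (v p) (fun i => b i p) hvb.1 hvb.2.1 hvb.2.2
  exact ⟨e, map_fracIdeal_eq (Dp p) (Ep p) e he he' (hdenDp p) (hdenEp p) hψf hθf⟩

/-- The data describe a local ring with an ideal. -/
def IsDefined {K : Type} [CommRing K] (D : PairData K n r s k) : Prop :=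
  ∃ _ : D.genIdeal.IsPrime, ∀ j, D.cls (D.den j) ∉ D.genIdeal

omit [D.genIdeal.IsPrime] in
theorem IsApproximation.eventually_isDefined (h : D.IsApproximation α Dp) (hD : D.IsDefined) :
    ∀ᶠ p in (ℱ : Filter Nat.Primes), (Dp p).IsDefined := by
  obtain ⟨_, hden⟩ := hD
  have h1 := eventually_all.2 fun j => h.eventually_notMem (h.den j)
    fun hj => hden j ((D.cls_mem_genIdeal_iff _).2 hj)
  filter_upwards [h.eventually_isPrime, h1] with p hp h1
  exact ⟨hp, fun j hj => h1 j (((Dp p).cls_mem_genIdeal_iff _).1 hj)⟩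

/-- Filler data for the few `p` at which an approximation is undefined, so that local rings exist
for every index of the ultraproduct. -/
theorem exists_isDefined (K : Type) [CommRing K] [IsDomain K] (n r s k : ℕ) :
    ∃ D : PairData K n r s k, D.IsDefined := by
  let D : PairData K n r s k := ⟨fun _ => 0, fun _ => 0, fun _ => 0, fun _ => 1⟩
  have hbot : D.polyIdeal = ⊥ := by
    rw [polyIdeal, Ideal.span_eq_bot, Fin.range_append_eq]
    rintro _ (⟨_, rfl⟩ | ⟨_, rfl⟩) <;> rfl
  refine ⟨D, D.genIdeal_isPrime_iff.2 (hbot ▸ Ideal.isPrime_bot), fun j hj => ?_⟩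
  rw [cls_mem_genIdeal_iff, hbot, Ideal.mem_bot] at hj
  exact one_ne_zero hj

omit [D.genIdeal.IsPrime] in
/-- An approximation can be changed for few `p` so that all its members are defined. -/
theorem IsApproximation.exists_isDefined (h : D.IsApproximation α Dp) (hD : D.IsDefined) :
    ∃ Dp' : ∀ p : Nat.Primes, PairData (FBar p) n r s k, D.IsApproximation α Dp' ∧
      (∀ p, (Dp' p).IsDefined) ∧ ∀ᶠ p in (ℱ : Filter Nat.Primes), Dp' p = Dp p := by
  classical
  choose T hT using fun p : Nat.Primes => PairData.exists_isDefined (FBar p) n r s k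
  let Dp' : ∀ p : Nat.Primes, PairData (FBar p) n r s k := fun p =>
    if (Dp p).IsDefined then Dp p else T p
  have heq : ∀ᶠ p in (ℱ : Filter Nat.Primes), Dp' p = Dp p := by
    filter_upwards [h.eventually_isDefined hD] with p hp using if_pos hp
  refine ⟨Dp', ⟨fun j => (h.eqn j).congr ?_, fun j => (h.gen j).congr ?_,
    fun j => (h.num j).congr ?_, fun j => (h.den j).congr ?_⟩, fun p => ?_, heq⟩
  iterate 4 filter_upwards [heq] with p hp; rw [hp]
  by_cases hp : (Dp p).IsDefined
  · simp only [Dp', if_pos hp, hp]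
  · simp only [Dp', if_neg hp, hT]

theorem eventually_satisfies_of_isDefined {Φ : PairProperty} (hΦ : Φ.Ascends) {n' r' s' k' : ℕ}
    {E : PairData ℂ n' r' s' k'} {Ep : ∀ p : Nat.Primes, PairData (FBar p) n' r' s' k'}
    [E.genIdeal.IsPrime] [∀ p, (Dp p).genIdeal.IsPrime] [∀ p, (Ep p).genIdeal.IsPrime]
    (hD : D.IsApproximation α Dp) (hE : E.IsApproximation α Ep)
    (hdenD : ∀ j, D.cls (D.den j) ∉ D.genIdeal) (hdenE : ∀ j, E.cls (E.den j) ∉ E.genIdeal)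
    (hdenDp : ∀ p j, (Dp p).cls ((Dp p).den j) ∉ (Dp p).genIdeal)
    (hdenEp : ∀ p j, (Ep p).cls ((Ep p).den j) ∉ (Ep p).genIdeal)
    (σ : Localization.AtPrime E.genIdeal ≃ₐ[ℂ] Localization.AtPrime D.genIdeal)
    (hσ : (E.fracIdeal hdenE).map σ = D.fracIdeal hdenD)
    (h : ∀ᶠ p in (ℱ : Filter Nat.Primes), (Ep p).Satisfies Φ) :
    ∀ᶠ p in (ℱ : Filter Nat.Primes), (Dp p).Satisfies Φ := by
  refine (h.and (eventually_exists_ringEquiv hD hE hdenD hdenE hdenDp hdenEp σ hσ)).mono ?_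
  intro p hp
  obtain ⟨h3, e, he⟩ := hp
  exact Satisfies.of_ringEquiv (D := Dp p) (E := Ep p) hΦ p (hdenDp p) (hdenEp p) e he h3

theorem Presents.exists_algEquiv {R : Type*} [CommRing R] [Algebra ℂ R] {𝔞 : Ideal R}
    {n' r' s' k' : ℕ} {E : PairData ℂ n' r' s' k'} [E.genIdeal.IsPrime]
    (hdenD : ∀ j, D.cls (D.den j) ∉ D.genIdeal) (hdenE : ∀ j, E.cls (E.den j) ∉ E.genIdeal)
    (hD : D.Presents 𝔞) (hE : E.Presents 𝔞) :
    ∃ σ : Localization.AtPrime E.genIdeal ≃ₐ[ℂ] Localization.AtPrime D.genIdeal,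
      (E.fracIdeal hdenE).map σ = D.fracIdeal hdenD := by
  obtain ⟨_, _, σD, hσD⟩ := hD
  obtain ⟨_, _, σE, hσE⟩ := hE
  exact Ideal.exists_algEquiv_map_eq (K := ℂ) (A := Localization.AtPrime E.genIdeal) (B := R)
    (C := Localization.AtPrime D.genIdeal) σE σD (hσE.trans hσD.symm)

omit [D.genIdeal.IsPrime] in
theorem Presents.isDefined {R : Type*} [CommRing R] [Algebra ℂ R] {𝔞 : Ideal R}
    (h : D.Presents 𝔞) : D.IsDefined := by
  obtain ⟨h1, h2, _⟩ := h
  exact ⟨h1, h2⟩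

omit [D.genIdeal.IsPrime] in
/-- A property of the approximations does not depend on the presentation. -/
theorem Presents.eventually_satisfies {Φ : PairProperty} (hΦ : Φ.Ascends) {R : Type*} [CommRing R]
    [Algebra ℂ R] {𝔞 : Ideal R} {n' r' s' k' : ℕ} {E : PairData ℂ n' r' s' k'}
    {Ep : ∀ p : Nat.Primes, PairData (FBar p) n' r' s' k'} (hD : D.Presents 𝔞) (hE : E.Presents 𝔞)
    (hDp : D.IsApproximation α Dp) (hEp : E.IsApproximation α Ep)
    (h : ∀ᶠ p in (ℱ : Filter Nat.Primes), (Ep p).Satisfies Φ) :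
    ∀ᶠ p in (ℱ : Filter Nat.Primes), (Dp p).Satisfies Φ := by
  obtain ⟨_, hdenD⟩ := hD.isDefined
  obtain ⟨_, hdenE⟩ := hE.isDefined
  obtain ⟨σ, hσ⟩ := Presents.exists_algEquiv hdenD hdenE hD hE
  obtain ⟨Dp', hDp', hD', heqD⟩ := hDp.exists_isDefined hD.isDefined
  obtain ⟨Ep', hEp', hE', heqE⟩ := hEp.exists_isDefined hE.isDefined
  choose hD1 hD2 using hD'
  choose hE1 hE2 using hE'
  have h' : ∀ᶠ p in (ℱ : Filter Nat.Primes), (Ep' p).Satisfies Φ := by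
    filter_upwards [h, heqE] with p h1 h2
    rwa [h2]
  have key := eventually_satisfies_of_isDefined hΦ hDp' hEp' hdenD hdenE hD2 hE2 σ hσ h'
  filter_upwards [key, heqD] with p h1 h2
  rwa [← h2]

end PairData

end

end PresentationIndependence

/-! ### The ultraproduct of the `F̄_p` as an algebraically closed field of cardinality continuum. -/

section UltraproductField

noncomputable section

open Cardinal

/-- Over a countable ring an uncountable field has the cardinality of its transcendence bases. A
bijection of these gives an isomorphism of polynomial rings, which extends to algebraic closures. -/
theorem IsAlgClosed.nonempty_algEquiv {R K L : Type} [CommRing R] [Countable R] [Field K] [Field L]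
    [Algebra R K] [Algebra R L] [FaithfulSMul R K] [FaithfulSMul R L] [IsAlgClosed K]
    [IsAlgClosed L] (hK : ℵ₀ < #K) (hKL : #K = #L) : Nonempty (K ≃ₐ[R] L) := by
  have := (algebraMap R K).domain_nontrivial
  obtain ⟨s, hs⟩ := exists_isTranscendenceBasis R K
  obtain ⟨t, ht⟩ := exists_isTranscendenceBasis R L
  have hR : #R ≤ ℵ₀ := mk_le_aleph0
  have h1 := cardinal_eq_cardinal_transcendence_basis_of_aleph0_lt' _ hs hR hK
  have h2 := cardinal_eq_cardinal_transcendence_basis_of_aleph0_lt' _ ht hR (hKL ▸ hK)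
  obtain ⟨e⟩ := Cardinal.eq.1 (h1.symm.trans (hKL.trans h2))
  have := isAlgClosure_of_transcendence_basis _ hs
  have := isAlgClosure_of_transcendence_basis _ ht
  let f : Algebra.adjoin R (Set.range ((↑) : s → K)) ≃ₐ[R]
      Algebra.adjoin R (Set.range ((↑) : t → L)) :=
    hs.1.aevalEquiv.symm.trans ((MvPolynomial.renameEquiv R e).trans ht.1.aevalEquiv)
  refine ⟨AlgEquiv.ofRingEquiv (f := IsAlgClosure.equivOfEquiv K L f.toRingEquiv) fun r => ?_⟩
  rw [IsScalarTower.algebraMap_apply R (Algebra.adjoin R (Set.range ((↑) : s → K))) K,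
    IsAlgClosure.equivOfEquiv_algebraMap,
    IsScalarTower.algebraMap_apply R (Algebra.adjoin R (Set.range ((↑) : t → L))) L]
  exact congrArg _ (f.commutes r)

variable (ℱ : Ultrafilter Nat.Primes)

theorem ultraIdeal_isMaximal (A : Nat.Primes → Type) [∀ p, Field (A p)] :
    (ultraIdeal ℱ A).IsMaximal := by
  refine Ideal.isMaximal_iff.2 ⟨fun h => ?_, fun J x hJ hx hxJ => ?_⟩
  · exact one_ne_zero (Eventually.exists (f := (ℱ : Filter Nat.Primes)) h).choose_spec
  · have hx' : ∀ᶠ p in (ℱ : Filter Nat.Primes), x p ≠ 0 := Ultrafilter.eventually_not.2 hx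
    have h1 : 1 - x * x⁻¹ ∈ ultraIdeal ℱ A := by
      change ∀ᶠ p in (ℱ : Filter Nat.Primes), 1 - x p * (x p)⁻¹ = 0
      filter_upwards [hx'] with p hp
      rw [mul_inv_cancel₀ hp, sub_self]
    have := J.add_mem (hJ h1) (J.mul_mem_right x⁻¹ hxJ)
    rwa [sub_add_cancel] at this

instance (A : Nat.Primes → Type) [∀ p, Field (A p)] : Field (UltraProd ℱ A) :=
  have := ultraIdeal_isMaximal ℱ A
  Ideal.Quotient.field _

-- Representatives of the lower coefficients of a monic irreducible polynomial give monic
-- polynomials of the same positive degree over each `A p`; roots are chosen for each `p`.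
open Polynomial in
theorem isAlgClosed_ultraProd (A : Nat.Primes → Type) [∀ p, Field (A p)] [∀ p, IsAlgClosed (A p)] :
    IsAlgClosed (UltraProd ℱ A) := by
  refine IsAlgClosed.of_exists_root _ fun f hf hirr => ?_
  choose a ha using fun i => exists_ulim_eq ℱ (f.coeff i)
  have h1 : ∀ p, ∃ x : A p, x ^ f.natDegree + ∑ i ∈ Finset.range f.natDegree, a i p * x ^ i = 0 := by
    intro p
    let g : (A p)[X] := X ^ f.natDegree + ∑ i ∈ Finset.range f.natDegree, C (a i p) * X ^ i
    have hg : (∑ i ∈ Finset.range f.natDegree, C (a i p) * X ^ i).degree <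
        (f.natDegree : WithBot ℕ) := by
      refine (degree_sum_le _ _).trans_lt ((Finset.sup_lt_iff (WithBot.bot_lt_coe _)).2 fun i hi => ?_)
      exact (degree_C_mul_X_pow_le _ _).trans_lt (by exact_mod_cast Finset.mem_range.1 hi)
    have hg' : g.degree ≠ 0 := by
      rw [degree_add_eq_left_of_degree_lt (by rwa [degree_X_pow]), degree_X_pow]
      exact_mod_cast hirr.natDegree_pos.ne'
    obtain ⟨x, hx⟩ := IsAlgClosed.exists_root g hg'
    refine ⟨x, ?_⟩
    simpa [g, eval_finsetSum] using hx
  choose x hx using h1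
  refine ⟨ulim ℱ x, ?_⟩
  rw [hf.as_sum]
  simp only [eval_add, eval_pow, eval_X, eval_finsetSum, eval_mul, eval_C, ← ha, ulim_pow, ulim_mul,
    ulim_sum, ulim_add, hx]
  rfl

theorem mk_ultraProd {A : Nat.Primes → Type} [∀ p, CommRing (A p)] [∀ p, Infinite (A p)]
    [∀ p, Countable (A p)] (hℱ : (ℱ : Filter Nat.Primes) ≤ cofinite) :
    #(UltraProd ℱ A) = 𝔠 := by
  refine le_antisymm ?_ ?_
  · calc #(UltraProd ℱ A) ≤ #(∀ p, A p) := mk_le_of_surjective Ideal.Quotient.mk_surjective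
      _ ≤ #(Nat.Primes → ℕ) := by
        choose f hf using fun p => exists_injective_nat (A p)
        exact mk_le_of_injective (f := fun x p => f p (x p)) fun x y h =>
          funext fun p => hf p (congrFun h p)
      _ = 𝔠 := by simp
  · rw [show 𝔠 = #(ℕ → Bool) by simp]
    -- The `p`-th entry encodes the first `p` terms of `g`. Distinct sequences differ at all large
    -- `p`, hence in the ultraproduct.
    let e : ∀ g : ℕ → Bool, ∀ p, A p := fun g p =>
      Infinite.natEmbedding (A p) (Encodable.encode ((List.range p).map g))
    refine mk_le_of_injective (f := fun g => ulim ℱ (e g)) fun g h hgh => ?_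
    by_contra hne
    obtain ⟨i, hi⟩ := Function.ne_iff.1 hne
    have h1 := (ulim_eq_ulim_iff ℱ _ _).1 hgh
    have h2 : ∀ᶠ p : Nat.Primes in cofinite, i < p := by
      have : Tendsto (fun p : Nat.Primes => (p : ℕ)) cofinite atTop :=
        Nat.cofinite_eq_atTop ▸ Subtype.val_injective.tendsto_cofinite
      exact this.eventually_gt_atTop i
    obtain ⟨p, h1, h2⟩ := (h1.and (hℱ h2)).exists
    have h3 := Encodable.encode_injective ((Infinite.natEmbedding (A p)).injective h1)
    exact hi (List.map_inj_left.1 h3 i (List.mem_range.2 h2))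

instance (p : Nat.Primes) : Countable (FBar p) := by
  rw [← mk_le_aleph0_iff]
  refine (Algebra.IsAlgebraic.cardinalMk_le_max (ZMod p) (FBar p)).trans ?_
  rw [max_le_iff]
  exact ⟨mk_le_aleph0, le_rfl⟩

variable {ℱ} in
/-- A countable subring of both `ℂ` and the ultraproduct can be fixed by the isomorphism. -/
theorem exists_ringEquiv_ultraProd (hℱ : (ℱ : Filter Nat.Primes) ≤ cofinite) {A : Type}
    [CommRing A] [Countable A] (κ : A →+* UltraProd ℱ FBar) (hκ : Function.Injective κ)
    (ι : A →+* ℂ) (hι : Function.Injective ι) :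
    ∃ α : UltraProd ℱ FBar ≃+* ℂ, ∀ a, α.symm (ι a) = κ a := by
  algebraize [κ, ι]
  have : FaithfulSMul A (UltraProd ℱ FBar) := (faithfulSMul_iff_algebraMap_injective ..).2 hκ
  have : FaithfulSMul A ℂ := (faithfulSMul_iff_algebraMap_injective ..).2 hι
  have := isAlgClosed_ultraProd ℱ FBar
  have hinf : ∀ p, Infinite (FBar p) := fun p => IsAlgClosed.instInfinite
  have h := mk_ultraProd ℱ (A := FBar) hℱ
  obtain ⟨e⟩ := IsAlgClosed.nonempty_algEquiv (R := A) (K := UltraProd ℱ FBar) (L := ℂ)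
    (h ▸ aleph0_lt_continuum) (h.trans mk_complex.symm)
  refine ⟨e.toRingEquiv, fun a => ?_⟩
  exact e.symm.commutes a

end

end UltraproductField

/-! ### Choosing maximal ideals from a dense set, and an ultrafilter on the primes. -/

section DenseMaximalIdeals

/-- For the zero ideal: if `x` is in the Jacobson radical then `x * x + 1` is a unit, which forces
`x = 0`. Nonzero primes are maximal. -/
theorem Int.isJacobsonRing : IsJacobsonRing ℤ := by
  refine isJacobsonRing_iff_prime_eq.2 fun P hP => ?_
  by_cases h : P = ⊥
  · subst h
    refine le_antisymm (fun x hx => ?_) Ideal.le_jacobson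
    have h1 := Int.isUnit_iff.1 (Ideal.mem_jacobson_bot.1 hx x)
    rw [Ideal.mem_bot]
    nlinarith [mul_self_nonneg x, h1.resolve_right (by nlinarith [mul_self_nonneg x])]
  · have := hP.isMaximal h
    exact Ideal.jacobson_eq_self_of_isMaximal

/-- A maximal ideal from a dense set which avoids a given element and has large characteristic. -/
theorem exists_mem_notMem_of_dense {A : Type} [CommRing A] [IsDomain A] [CharZero A]
    [Algebra.FiniteType ℤ A] {D : Set (MaximalSpectrum A)}
    (hD : Dense (MaximalSpectrum.toPrimeSpectrum '' D)) {a : A} (ha : a ≠ 0) (N : ℕ) :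
    ∃ (p : Nat.Primes) (μ : MaximalSpectrum A), N < p ∧ μ ∈ D ∧ ((p : ℕ) : A) ∈ μ.asIdeal ∧
      a ∉ μ.asIdeal := by
  -- Avoiding `N!` excludes every residue characteristic `p ≤ N`.
  have hb : a * (N.factorial : A) ≠ 0 := mul_ne_zero ha (Nat.cast_ne_zero.2 N.factorial_ne_zero)
  obtain ⟨_, h1, μ, hμ, rfl⟩ := hD.inter_open_nonempty _
    (PrimeSpectrum.basicOpen (a * (N.factorial : A))).isOpen
    ⟨⟨⊥, Ideal.isPrime_bot⟩, fun h => hb h⟩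
  have h2 : a * (N.factorial : A) ∉ μ.asIdeal := h1
  have := μ.isMaximal
  let := Ideal.Quotient.field μ.asIdeal
  have := Int.isJacobsonRing
  have : Module.Finite ℤ (A ⧸ μ.asIdeal) := finite_of_finite_type_of_isJacobsonRing ℤ _
  obtain ⟨p, hp⟩ := CharP.exists (A ⧸ μ.asIdeal)
  -- The residue field is finite over `ℤ`; in characteristic zero integrality would make `ℤ` a
  -- field.
  have hp0 : p ≠ 0 := by
    rintro rfl
    have := CharP.charP_to_charZero (A ⧸ μ.asIdeal)
    have : Algebra.IsIntegral ℤ (A ⧸ μ.asIdeal) := inferInstance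
    have hf := isField_of_isIntegral_of_isField (R := ℤ) (S := A ⧸ μ.asIdeal)
      (RingHom.injective_int (algebraMap ℤ (A ⧸ μ.asIdeal))) (Field.toIsField _)
    exact Int.not_isField hf
  have hpp := (CharP.char_is_prime_or_zero (A ⧸ μ.asIdeal) p).resolve_right hp0
  have hpμ : ((p : ℕ) : A) ∈ μ.asIdeal := by
    rw [← Ideal.Quotient.eq_zero_iff_mem, map_natCast, CharP.cast_eq_zero]
  refine ⟨⟨p, hpp⟩, μ, ?_, hμ, hpμ, fun h => h2 (Ideal.mul_mem_right _ _ h)⟩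
  by_contra! hle
  obtain ⟨m, hm⟩ := Nat.dvd_factorial hpp.pos hle
  refine h2 (Ideal.mul_mem_left _ _ ?_)
  rw [hm, Nat.cast_mul]
  exact Ideal.mul_mem_right _ _ hpμ

/-- The nonzero elements are enumerated as `a 0, a 1, …`, and the `N`-th maximal ideal avoids `a 0 *
… * a N` and has residue characteristic above `N`. Along a subsequence the characteristics increase
strictly, and a nonprincipal ultrafilter on `ℕ` is pushed forward to the primes. -/
theorem exists_ultrafilter_of_dense {A : Type} [CommRing A] [IsDomain A] [CharZero A] [Countable A]
    [Algebra.FiniteType ℤ A] {D : Set (MaximalSpectrum A)}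
    (hD : Dense (MaximalSpectrum.toPrimeSpectrum '' D)) :
    ∃ (ℱ : Ultrafilter Nat.Primes) (_ : (ℱ : Filter Nat.Primes) ≤ cofinite)
      (μ : Nat.Primes → MaximalSpectrum A),
      (∀ᶠ p in (ℱ : Filter Nat.Primes), μ p ∈ D ∧ ((p : ℕ) : A) ∈ (μ p).asIdeal) ∧
      ∀ a ≠ 0, ∀ᶠ p in (ℱ : Filter Nat.Primes), a ∉ (μ p).asIdeal := by
  classical
  have : Nonempty {a : A // a ≠ 0} := ⟨⟨1, one_ne_zero⟩⟩
  obtain ⟨a, ha⟩ := exists_surjective_nat {a : A // a ≠ 0}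
  choose p μ hN hμ hp hμa using fun N : ℕ => exists_mem_notMem_of_dense hD
    (Finset.prod_ne_zero_iff.2 fun i (_ : i ∈ Finset.range (N + 1)) => (a i).2) N
  obtain ⟨φ, hφ, hpφ⟩ := strictMono_subseq_of_id_le (u := fun N => (p N : ℕ)) fun N => (hN N).le
  have hinj : Function.Injective fun N => p (φ N) := fun i j h =>
    hpφ.injective (congrArg Subtype.val h)
  -- The default `μ 0` at primes outside the subsequence is harmless: the ultrafilter is
  -- concentrated on the subsequence.
  let μ' : Nat.Primes → MaximalSpectrum A :=
    Function.extend (fun N => p (φ N)) (fun N => μ (φ N)) fun _ => μ 0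
  have hμ' : ∀ N, μ' (p (φ N)) = μ (φ N) := fun N => hinj.extend_apply _ _ N
  refine ⟨(hyperfilter ℕ).map fun N => p (φ N), ?_, μ', ?_, fun b hb => ?_⟩
  · exact (Filter.map_mono hyperfilter_le_cofinite).trans hinj.tendsto_cofinite
  · refine Filter.eventually_map.2 (Eventually.of_forall fun N => ?_)
    rw [hμ']
    exact ⟨hμ _, hp _⟩
  · obtain ⟨n, hn⟩ := ha ⟨b, hb⟩
    have h0 : ∀ᶠ N in (hyperfilter ℕ : Filter ℕ), n ≤ N :=
      Nat.hyperfilter_le_atTop (eventually_ge_atTop n)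
    refine Filter.eventually_map.2 (h0.mono fun N hnN hb' => ?_)
    rw [hμ'] at hb'
    have h1 : b ∣ ∏ i ∈ Finset.range (φ N + 1), (a i : A) := by
      have := Finset.dvd_prod_of_mem (fun i => (a i : A))
        (Finset.mem_range.2 (Nat.lt_succ_of_le (hnN.trans hφ.le_apply)))
      rwa [hn] at this
    exact hμa (φ N) (Ideal.mem_of_dvd _ h1 hb')

end DenseMaximalIdeals

/-! ### Presentations of models over `A` and their base changes. -/

section ModelPresentation

noncomputable section

open MvPolynomial

namespace PairData

variable {A : Type} [CommRing A] {n r s k : ℕ}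

/-- The image of the data under a homomorphism of the coefficients. -/
def map {K : Type} [CommRing K] (φ : A →+* K) (E : PairData A n r s k) : PairData K n r s k where
  eqn j := (E.eqn j).map φ
  gen j := (E.gen j).map φ
  num j := (E.num j).map φ
  den j := (E.den j).map φ

/-- The ideal `(num₁, …, num_k)` of `D.Alg`. -/
def numIdeal (D : PairData A n r s k) : Ideal D.Alg :=
  Ideal.span (Set.range fun j => D.cls (D.num j))

theorem fracIdeal_eq_map_numIdeal (D : PairData A n r s k) [D.genIdeal.IsPrime]
    (hden : ∀ j, D.cls (D.den j) ∉ D.genIdeal) (h1 : ∀ j, D.den j = 1) :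
    D.fracIdeal hden = D.numIdeal.map (algebraMap _ (Localization.AtPrime D.genIdeal)) := by
  rw [fracIdeal_eq_span, numIdeal, Ideal.map_span, ← Set.range_comp]
  congr 2
  funext j
  have := D.frac_mul_can hden j
  rwa [h1, map_one, mul_one] at this

theorem den_notMem (D : PairData A n r s k) [D.genIdeal.IsPrime] (h1 : ∀ j, D.den j = 1) (j : Fin k) :
    D.cls (D.den j) ∉ D.genIdeal := by
  rw [h1, cls, map_one]
  exact fun h => Ideal.IsPrime.ne_top' ((Ideal.eq_top_iff_one _).2 h)

/-- Relations and both ideals are finitely generated by Noetherianity; generators of the ideals lift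
to polynomials, so all denominators can be `1`. -/
theorem exists_of_finiteType [IsNoetherianRing A] {B : Type} [CommRing B] [Algebra A B]
    [Algebra.FiniteType A B] (I J : Ideal B) :
    ∃ (n r s k : ℕ) (E : PairData A n r s k) (f : E.Alg ≃ₐ[A] B), (∀ j, E.den j = 1) ∧
      E.genIdeal.map f = I ∧ E.numIdeal.map f = J := by
  have := Algebra.FiniteType.isNoetherianRing A B
  obtain ⟨n, π, hπ⟩ := Algebra.FiniteType.iff_quotient_mvPolynomial''.1 ‹Algebra.FiniteType A B›
  obtain ⟨r, eqn, heqn⟩ := Submodule.fg_iff_exists_fin_generating_family.1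
    ((RingHom.ker π).fg_of_isNoetherianRing)
  obtain ⟨s, g, hg⟩ := Submodule.fg_iff_exists_fin_generating_family.1 I.fg_of_isNoetherianRing
  obtain ⟨k, h, hh⟩ := Submodule.fg_iff_exists_fin_generating_family.1 J.fg_of_isNoetherianRing
  choose gen hgen using fun j => hπ (g j)
  choose num hnum using fun j => hπ (h j)
  let E : PairData A n r s k := ⟨eqn, gen, num, fun _ => 1⟩
  let f : E.Alg ≃ₐ[A] B := (Ideal.quotientEquivAlgOfEq A heqn).trans
    (Ideal.quotientKerAlgEquivOfSurjective hπ)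
  have hf : ∀ F, f (E.cls F) = π F := fun F => rfl
  refine ⟨n, r, s, k, E, f, fun _ => rfl, ?_, ?_⟩
  · rw [genIdeal, Ideal.map_span, ← Set.range_comp, ← hg]
    refine congrArg (fun x => Ideal.span (Set.range x)) (funext fun j => ?_)
    exact (hf _).trans (hgen j)
  · rw [numIdeal, Ideal.map_span, ← Set.range_comp, ← hh]
    refine congrArg (fun x => Ideal.span (Set.range x)) (funext fun j => ?_)
    exact (hf _).trans (hnum j)

theorem exists_baseChange {B : Type} [CommRing B] [Algebra A B] (E : PairData A n r s k)
    (f : E.Alg ≃ₐ[A] B) (K : Type) [CommRing K] [Algebra A K] :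
    ∃ g : K ⊗[A] B ≃ₐ[K] (E.map (algebraMap A K)).Alg,
      ((E.genIdeal.map f).map (Algebra.TensorProduct.includeRight : B →ₐ[A] K ⊗[A] B)).map g =
        (E.map (algebraMap A K)).genIdeal ∧
      ((E.numIdeal.map f).map (Algebra.TensorProduct.includeRight : B →ₐ[A] K ⊗[A] B)).map g =
        (E.map (algebraMap A K)).numIdeal := by
  have h : (Ideal.span (Set.range E.eqn)).map (MvPolynomial.map (algebraMap A K)) =
      Ideal.span (Set.range (E.map (algebraMap A K)).eqn) := by
    rw [Ideal.map_span, ← Set.range_comp]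
    rfl
  let g : K ⊗[A] B ≃ₐ[K] (E.map (algebraMap A K)).Alg :=
    (Algebra.TensorProduct.congr AlgEquiv.refl f.symm).trans
      ((quotientBaseChange K (Ideal.span (Set.range E.eqn))).trans
        (Ideal.quotientEquivAlgOfEq K h))
  have hg : ∀ F, g (1 ⊗ₜ f (E.cls F)) = (E.map (algebraMap A K)).cls (F.map (algebraMap A K)) := by
    intro F
    change Ideal.quotientEquivAlgOfEq K h (quotientBaseChange K (Ideal.span (Set.range E.eqn))
      (1 ⊗ₜ f.symm (f (E.cls F)))) = _
    rw [f.symm_apply_apply, quotientBaseChange_tmul]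
    rfl
  refine ⟨g, ?_, ?_⟩
  · rw [genIdeal, Ideal.map_span, Ideal.map_span, Ideal.map_span, ← Set.range_comp,
      ← Set.range_comp, ← Set.range_comp]
    exact congrArg (fun x => Ideal.span (Set.range x)) (funext fun j => hg _)
  · rw [numIdeal, Ideal.map_span, Ideal.map_span, Ideal.map_span, ← Set.range_comp,
      ← Set.range_comp, ← Set.range_comp]
    exact congrArg (fun x => Ideal.span (Set.range x)) (funext fun j => hg _)

theorem isApproximation_map {ℱ : Ultrafilter Nat.Primes} {α : UltraProd ℱ FBar ≃+* ℂ}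
    {A : Subalgebra ℤ ℂ} {φ : ∀ p, A → FBar p}
    (hφ : ∀ a : A, α.symm a = ulim ℱ fun p => φ p a) (E : PairData A n r s k)
    {Ep : ∀ p : Nat.Primes, PairData (FBar p) n r s k}
    (h : ∀ᶠ p in (ℱ : Filter Nat.Primes), ∃ ψ : A →+* FBar p, ⇑ψ = φ p ∧ Ep p = E.map ψ) :
    (E.map (algebraMap A ℂ)).IsApproximation α Ep := by
  refine ⟨fun j => isPolyApprox_map hφ _ ?_, fun j => isPolyApprox_map hφ _ ?_,
    fun j => isPolyApprox_map hφ _ ?_, fun j => isPolyApprox_map hφ _ ?_⟩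
  all_goals
    filter_upwards [h] with p ⟨ψ, h1, h2⟩
    exact ⟨ψ, h1, by rw [h2]; rfl⟩

end PairData

theorem exists_localization_algEquiv {K S S' : Type} [CommRing K] [CommRing S] [CommRing S']
    [Algebra K S] [Algebra K S'] (g : S ≃ₐ[K] S') {𝔭 : Ideal S} {P : Ideal S'} [𝔭.IsPrime]
    [P.IsPrime] (hP : 𝔭.map g = P) :
    ∃ σ : Localization.AtPrime P ≃ₐ[K] Localization.AtPrime 𝔭,
      ∀ I : Ideal S, ((I.map g).map (algebraMap S' (Localization.AtPrime P))).map σ =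
        I.map (algebraMap S (Localization.AtPrime 𝔭)) := by
  have h : ∀ y, g.symm y ∈ 𝔭 ↔ y ∈ P := by
    intro y
    rw [← hP, Ideal.mem_map_of_equiv g]
    exact ⟨fun h => ⟨_, h, g.apply_symm_apply y⟩, by rintro ⟨x, hx, rfl⟩; simpa using hx⟩
  have H : P.primeCompl.map g.symm = 𝔭.primeCompl := by
    ext x
    constructor
    · rintro ⟨y, hy, rfl⟩
      exact fun h' => hy ((h y).1 h')
    · intro hx
      refine ⟨g x, fun h' => hx ?_, g.symm_apply_apply x⟩
      simpa using (h (g x)).2 h'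
  refine ⟨IsLocalization.algEquivOfAlgEquiv (Localization.AtPrime P) (Localization.AtPrime 𝔭)
    g.symm H, fun I => ?_⟩
  rw [← Ideal.span_eq I]
  simp only [Ideal.map_span, Set.image_image]
  refine congrArg Ideal.span (Set.image_congr fun x _ => ?_)
  rw [IsLocalization.algEquivOfAlgEquiv_eq, g.symm_apply_apply]

/-- With `k = A/μ` and `K = F̄_p` this identifies the approximation with the extension of scalars of
`S_μ`, compatibly with ideals coming from `S_A`. -/
theorem exists_ringEquiv_tmul_tmul {A k K B C : Type} [CommRing A] [CommRing k] [CommRing K]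
    [CommRing B] [CommRing C] [Algebra A k] [Algebra k K] [Algebra A K] [IsScalarTower A k K]
    [Algebra A B] [Algebra K C] (g : K ⊗[A] B ≃ₐ[K] C) :
    ∃ e : (k ⊗[A] B) ⊗[k] K ≃+* C, ∀ I : Ideal B,
      ((I.map (Algebra.TensorProduct.includeRight : B →ₐ[A] k ⊗[A] B)).map
        (algebraMap (k ⊗[A] B) ((k ⊗[A] B) ⊗[k] K))).map e =
      (I.map (Algebra.TensorProduct.includeRight : B →ₐ[A] K ⊗[A] B)).map g := by
  let e : (k ⊗[A] B) ⊗[k] K ≃+* C :=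
    ((Algebra.TensorProduct.comm k (k ⊗[A] B) K).toRingEquiv.trans
      (Algebra.TensorProduct.cancelBaseChange A k k K B).toRingEquiv).trans g.toRingEquiv
  refine ⟨e, fun I => ?_⟩
  rw [← Ideal.span_eq I]
  simp only [Ideal.map_span, Set.image_image]
  refine congrArg Ideal.span (Set.image_congr fun x _ => ?_)
  change g (Algebra.TensorProduct.cancelBaseChange A k k K B (1 ⊗ₜ (1 ⊗ₜ x))) = g (1 ⊗ₜ x)
  rw [Algebra.TensorProduct.cancelBaseChange_tmul, one_smul]

end

end ModelPresentation

/-! ### From dense type to approximations. -/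

section DenseType

noncomputable section

theorem Subalgebra.countable_of_fg {A : Subalgebra ℤ ℂ} (hA : A.FG) : Countable A := by
  have : Algebra.FiniteType ℤ A := A.fg_iff_finiteType.1 hA
  obtain ⟨n, f, hf⟩ := Algebra.FiniteType.iff_quotient_mvPolynomial''.1 this
  have : Countable (MvPolynomial (Fin n) ℤ) := by
    rw [← Cardinal.mk_le_aleph0_iff]
    exact MvPolynomial.cardinalMk_le_max.trans (by simp)
  exact hf.countable

theorem finite_quotient_of_charP {A : Type} [CommRing A] [Algebra.FiniteType ℤ A]
    (μ : MaximalSpectrum A) (p : ℕ) [Fact p.Prime] (hp : ((p : ℕ) : A) ∈ μ.asIdeal) :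
    Finite (A ⧸ μ.asIdeal) ∧ CharP (A ⧸ μ.asIdeal) p := by
  have := μ.isMaximal
  let := Ideal.Quotient.field μ.asIdeal
  have hchar : CharP (A ⧸ μ.asIdeal) p := by
    refine (CharP.charP_iff_prime_eq_zero Fact.out).2 ?_
    rw [← map_natCast (Ideal.Quotient.mk μ.asIdeal)]
    exact Ideal.Quotient.eq_zero_iff_mem.2 hp
  have := Int.isJacobsonRing
  have : Module.Finite ℤ (A ⧸ μ.asIdeal) := finite_of_finite_type_of_isJacobsonRing ℤ _
  let := ZMod.algebra (A ⧸ μ.asIdeal) p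
  have : Module.Finite (ZMod p) (A ⧸ μ.asIdeal) := Module.Finite.of_restrictScalars_finite ℤ _ _
  exact ⟨Module.finite_of_finite (ZMod p), hchar⟩

/-- An ultrafilter and an isomorphism adapted to a dense set of maximal ideals of `A`: the
inclusion `A → ℂ` becomes the ultraproduct of the reductions of `A` modulo ideals from the set. -/
theorem exists_ringEquiv_of_dense {A : Subalgebra ℤ ℂ} (hA : A.FG) {D : Set (MaximalSpectrum A)}
    (hD : Dense (MaximalSpectrum.toPrimeSpectrum '' D)) :
    ∃ (ℱ : Ultrafilter Nat.Primes) (_ : (ℱ : Filter Nat.Primes) ≤ cofinite)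
      (α : UltraProd ℱ FBar ≃+* ℂ) (μ : Nat.Primes → MaximalSpectrum A) (φ : ∀ p, A → FBar p),
      (∀ a : A, α.symm a = ulim ℱ fun p => φ p a) ∧
      ∀ᶠ p in (ℱ : Filter Nat.Primes), μ p ∈ D ∧ ((p : ℕ) : A) ∈ (μ p).asIdeal ∧
        ∃ ψ : A ⧸ (μ p).asIdeal →+* FBar p, ∀ a, φ p a = ψ (Ideal.Quotient.mk _ a) := by
  classical
  have := Subalgebra.countable_of_fg hA
  have : Algebra.FiniteType ℤ A := A.fg_iff_finiteType.1 hA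
  obtain ⟨ℱ, hℱ, μ, hμ, ha⟩ := exists_ultrafilter_of_dense hD
  let Good : ∀ p, (A → FBar p) → Prop := fun p φ =>
    ∃ ψ : A ⧸ (μ p).asIdeal →+* FBar p, ∀ a, φ a = ψ (Ideal.Quotient.mk _ a)
  have h1 : ∀ p : Nat.Primes, ∃ φ : A → FBar p, ((p : ℕ) : A) ∈ (μ p).asIdeal → Good p φ := by
    intro p
    by_cases hp : ((p : ℕ) : A) ∈ (μ p).asIdeal
    · obtain ⟨_, _⟩ := finite_quotient_of_charP (μ p) p hp
      have := (μ p).isMaximal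
      let := Ideal.Quotient.field (μ p).asIdeal
      let := ZMod.algebra (A ⧸ (μ p).asIdeal) p
      -- The residue field is finite of characteristic `p`, hence algebraic over `ZMod p`, and
      -- embeds in `F̄_p`.
      let ψ : A ⧸ (μ p).asIdeal →ₐ[ZMod p] FBar p := IsAlgClosed.lift
      exact ⟨fun a => ψ (Ideal.Quotient.mk _ a), fun _ => ⟨ψ, fun _ => rfl⟩⟩
    · exact ⟨0, fun h => (hp h).elim⟩
  choose φ hφ using h1
  have hgood : ∀ᶠ p in (ℱ : Filter Nat.Primes), Good p (φ p) := hμ.mono fun p hp => hφ p hp.2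
  let κ : A →+* UltraProd ℱ FBar :=
    { toFun a := ulim ℱ fun p => φ p a
      map_one' := by
        rw [ulim_one, ulim_eq_ulim_iff]
        filter_upwards [hgood] with p ⟨ψ, hψ⟩
        rw [hψ, map_one, map_one]
      map_zero' := by
        rw [ulim_zero, ulim_eq_ulim_iff]
        filter_upwards [hgood] with p ⟨ψ, hψ⟩
        rw [hψ, map_zero, map_zero]
      map_mul' a b := by
        rw [ulim_mul, ulim_eq_ulim_iff]
        filter_upwards [hgood] with p ⟨ψ, hψ⟩
        rw [hψ, hψ, hψ, map_mul, map_mul]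
      map_add' a b := by
        rw [ulim_add, ulim_eq_ulim_iff]
        filter_upwards [hgood] with p ⟨ψ, hψ⟩
        rw [hψ, hψ, hψ, map_add, map_add] }
  -- A nonzero `a` avoids `μ p` for almost all `p`, and there its image in `F̄_p` is nonzero.
  have hκ : Function.Injective κ := by
    refine (injective_iff_map_eq_zero κ).2 fun a h0 => ?_
    by_contra hne
    have h0' : ulim ℱ (fun p => φ p a) = 0 := h0
    rw [ulim_zero, ulim_eq_ulim_iff] at h0'
    obtain ⟨p, ⟨ψ, hψ⟩, h0, hp⟩ := (hgood.and (h0'.and (ha a hne))).exists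
    have := (μ p).isMaximal
    let := Ideal.Quotient.field (μ p).asIdeal
    rw [hψ, map_eq_zero, Ideal.Quotient.eq_zero_iff_mem] at h0
    exact hp h0
  obtain ⟨α, hα⟩ := exists_ringEquiv_ultraProd hℱ κ hκ (algebraMap A ℂ) Subtype.val_injective
  refine ⟨ℱ, hℱ, α, μ, φ, hα, ?_⟩
  filter_upwards [hμ, hgood] with p h1 h2 using ⟨h1.1, h1.2, h2⟩

theorem Ideal.map_algEquiv_trans {K A B C : Type*} [CommSemiring K] [Semiring A] [Semiring B]
    [Semiring C] [Algebra K A] [Algebra K B] [Algebra K C] (e : A ≃ₐ[K] B) (f : B ≃ₐ[K] C)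
    (I : Ideal A) : I.map (e.trans f) = (I.map e).map f := by
  rw [← Ideal.span_eq I]
  simp only [Ideal.map_span, Set.image_image]
  rfl

/-- The finite field `k` and `K` are perfect and `K / k` is algebraic, so ascent applies to `k ⊗ B →
K ⊗ B`. -/
theorem PairData.satisfies_of_baseChange {Φ : PairProperty} (hΦ : Φ.Ascends) {A B k K : Type}
    [CommRing A] [CommRing B] [Field k] [Field K] [Algebra A B] [Algebra.FiniteType A B]
    [Algebra A k] [Algebra A K] [Algebra k K] [IsScalarTower A k K] [Finite k]
    [Algebra.IsAlgebraic k K] [PerfectField K] (p : ℕ) [Fact p.Prime] [CharP k p] {n r s m : ℕ}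
    {E : PairData A n r s m} (f : E.Alg ≃ₐ[A] B) {I J : Ideal B} (hden : ∀ j, E.den j = 1)
    (hgen : E.genIdeal.map f = I) (hnum : E.numIdeal.map f = J)
    [(I.map (Algebra.TensorProduct.includeRight : B →ₐ[A] k ⊗[A] B)).IsPrime]
    [(E.map (algebraMap A K)).genIdeal.IsPrime]
    (h : Φ (Localization.AtPrime (I.map (Algebra.TensorProduct.includeRight : B →ₐ[A] k ⊗[A] B)))
      ((J.map (Algebra.TensorProduct.includeRight : B →ₐ[A] k ⊗[A] B)).map (algebraMap _ _))) :
    (E.map (algebraMap A K)).Satisfies Φ := by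
  obtain ⟨g, hg1, hg2⟩ := E.exists_baseChange f K
  rw [hgen] at hg1
  rw [hnum] at hg2
  obtain ⟨e, he⟩ := exists_ringEquiv_tmul_tmul (A := A) (k := k) (K := K) (B := B) g
  have hden' : ∀ j, (E.map (algebraMap A K)).den j = 1 := fun j => by
    change (E.den j).map _ = 1
    rw [hden, map_one]
  have hd := PairData.den_notMem (E.map (algebraMap A K)) hden'
  have : ExpChar k p := .prime Fact.out
  have : IsNoetherianRing (k ⊗[A] B) := Algebra.FiniteType.isNoetherianRing k _
  refine (PairData.satisfies_iff (D := E.map (algebraMap A K)) hd).2 ?_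
  rw [PairData.fracIdeal_eq_map_numIdeal _ _ hden']
  exact hΦ.baseChange (k := k) (K := K) (S := k ⊗[A] B) p e _ _ _ _ ((he I).trans hg1)
    ((he J).trans hg2) h

namespace ReductionModel

variable {S : Type} [CommRing S] [Algebra ℂ S] {𝔟 𝔭 : Ideal S} (M : ReductionModel S 𝔟 𝔭)
  {n r s k : ℕ} {E : PairData M.A n r s k} (f : E.Alg ≃ₐ[M.A] M.SA)

theorem presents [𝔭.IsPrime] {R : Type*} [CommRing R] [Algebra ℂ R] {𝔞 : Ideal R}
    (iso : Localization.AtPrime 𝔭 ≃ₐ[ℂ] R)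
    (h𝔞 : (𝔟.map (algebraMap S (Localization.AtPrime 𝔭))).map iso = 𝔞)
    (hden : ∀ j, E.den j = 1) (hgen : E.genIdeal.map f = M.pA) (hnum : E.numIdeal.map f = M.bA) :
    (E.map (algebraMap M.A ℂ)).Presents 𝔞 := by
  obtain ⟨g, hg1, hg2⟩ := E.exists_baseChange f ℂ
  have hG : ∀ I : Ideal M.SA, ((I.map (Algebra.TensorProduct.includeRight :
      M.SA →ₐ[M.A] ℂ ⊗[M.A] M.SA)).map M.iso).map (M.iso.symm.trans g) =
      (I.map (Algebra.TensorProduct.includeRight : M.SA →ₐ[M.A] ℂ ⊗[M.A] M.SA)).map g := by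
    intro I
    rw [← Ideal.span_eq I]
    simp only [Ideal.map_span, Set.image_image]
    refine congrArg Ideal.span (Set.image_congr fun x _ => ?_)
    exact congrArg g (M.iso.symm_apply_apply _)
  have h1 : 𝔭.map (M.iso.symm.trans g) = (E.map (algebraMap M.A ℂ)).genIdeal := by
    refine (congrArg (Ideal.map _) M.map_pA.symm).trans ((hG _).trans ?_)
    rw [← hgen, hg1]
  have h2 : 𝔟.map (M.iso.symm.trans g) = (E.map (algebraMap M.A ℂ)).numIdeal := by
    refine (congrArg (Ideal.map _) M.map_bA.symm).trans ((hG _).trans ?_)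
    rw [← hnum, hg2]
  have hprime : (E.map (algebraMap M.A ℂ)).genIdeal.IsPrime := by
    rw [← h1]
    exact Ideal.map_isPrime_of_equiv _
  have hden' : ∀ j, (E.map (algebraMap M.A ℂ)).den j = 1 := fun j => by
    change (E.den j).map _ = 1
    rw [hden, map_one]
  obtain ⟨σ, hσ⟩ := exists_localization_algEquiv (M.iso.symm.trans g) h1
  refine ⟨hprime, PairData.den_notMem _ hden', σ.trans iso, ?_⟩
  rw [PairData.fracIdeal_eq_map_numIdeal _ _ hden', ← h2]
  exact (Ideal.map_algEquiv_trans _ _ _).trans ((congrArg (Ideal.map iso) (hσ 𝔟)).trans h𝔞)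

/-- Primality over `A/μ` need not persist over `F̄_p`, so `hprime` is a separate hypothesis; it will
come from primality over `ℂ` by transfer. -/
theorem satisfies {Φ : PairProperty} (hΦ : Φ.Ascends) (μ : MaximalSpectrum M.A)
    (hμ : ∃ _ : (M.pMod μ).IsPrime,
      Φ (Localization.AtPrime (M.pMod μ)) ((M.bMod μ).map (algebraMap _ _)))
    (p : Nat.Primes) (hp : ((p : ℕ) : M.A) ∈ μ.asIdeal) (ψ : M.A ⧸ μ.asIdeal →+* FBar p)
    (hden : ∀ j, E.den j = 1) (hgen : E.genIdeal.map f = M.pA) (hnum : E.numIdeal.map f = M.bA)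
    (hprime : (E.map (ψ.comp (Ideal.Quotient.mk _))).genIdeal.IsPrime) :
    (E.map (ψ.comp (Ideal.Quotient.mk _))).Satisfies Φ := by
  obtain ⟨hpμ, hμ⟩ := hμ
  have : Algebra.FiniteType ℤ M.A := M.A.fg_iff_finiteType.1 M.fg
  obtain ⟨_, _⟩ := finite_quotient_of_charP μ p hp
  have := μ.isMaximal
  let := Ideal.Quotient.field μ.asIdeal
  let := ψ.toAlgebra
  let := (ψ.comp (Ideal.Quotient.mk μ.asIdeal)).toAlgebra
  have : IsScalarTower M.A (M.A ⧸ μ.asIdeal) (FBar p) := .of_algebraMap_eq fun _ => rfl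
  let := ZMod.algebra (M.A ⧸ μ.asIdeal) p
  have : IsScalarTower (ZMod p) (M.A ⧸ μ.asIdeal) (FBar p) :=
    .of_algebraMap_eq' (Subsingleton.elim _ _)
  have : Algebra.IsAlgebraic (M.A ⧸ μ.asIdeal) (FBar p) :=
    Algebra.IsAlgebraic.tower_top (K := ZMod p) _
  have : (M.pA.map (Algebra.TensorProduct.includeRight :
      M.SA →ₐ[M.A] (M.A ⧸ μ.asIdeal) ⊗[M.A] M.SA)).IsPrime := hpμ
  exact PairData.satisfies_of_baseChange (A := M.A) (B := M.SA) (k := M.A ⧸ μ.asIdeal)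
    (K := FBar p) hΦ p f hden hgen hnum hμ

end ReductionModel

theorem IsOfDenseType.exists_approximationsSatisfy {Φ : PairProperty} (hΦ : Φ.Ascends) {R : Type*}
    [CommRing R] [Algebra ℂ R] {𝔞 : Ideal R} (h : IsOfDenseType Φ 𝔞) :
    ∃ (ℱ : Ultrafilter Nat.Primes) (_ : (ℱ : Filter Nat.Primes) ≤ cofinite)
      (α : UltraProd ℱ FBar ≃+* ℂ), ApproximationsSatisfy Φ 𝔞 ℱ α := by
  classical
  obtain ⟨S, _, _, _, 𝔟, 𝔭, _, iso, -, h𝔞, M, D, hD, hM⟩ := h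
  have : Algebra.FiniteType ℤ M.A := M.A.fg_iff_finiteType.1 M.fg
  have := Algebra.FiniteType.isNoetherianRing ℤ M.A
  obtain ⟨ℱ, hℱ, α, μ, φ, hφ, hμ⟩ := exists_ringEquiv_of_dense M.fg hD
  obtain ⟨n, r, s, k, E, f, hden, hgen, hnum⟩ :=
    PairData.exists_of_finiteType (A := M.A) (B := M.SA) M.pA M.bA
  have hE := M.presents f iso h𝔞 hden hgen hnum
  have h1 : ∀ p : Nat.Primes, ∃ Ep : PairData (FBar p) n r s k,
      ∀ ψ : M.A ⧸ (μ p).asIdeal →+* FBar p, (∀ a, φ p a = ψ (Ideal.Quotient.mk _ a)) →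
        Ep = E.map (ψ.comp (Ideal.Quotient.mk _)) := by
    intro p
    by_cases hp : ∃ ψ : M.A ⧸ (μ p).asIdeal →+* FBar p, ∀ a, φ p a = ψ (Ideal.Quotient.mk _ a)
    · obtain ⟨ψ, hψ⟩ := hp
      refine ⟨E.map (ψ.comp (Ideal.Quotient.mk _)), fun ψ' hψ' => congrArg E.map ?_⟩
      exact RingHom.ext fun a => (hψ a).symm.trans (hψ' a)
    · exact ⟨⟨0, 0, 0, 0⟩, fun ψ hψ => (hp ⟨ψ, hψ⟩).elim⟩
  choose Ep hEp using h1
  have happrox : (E.map (algebraMap M.A ℂ)).IsApproximation α Ep := by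
    refine PairData.isApproximation_map hφ E ?_
    filter_upwards [hμ] with p hp
    obtain ⟨-, -, ψ, hψ⟩ := hp
    exact ⟨ψ.comp (Ideal.Quotient.mk _), funext fun a => (hψ a).symm, hEp p ψ hψ⟩
  refine ⟨ℱ, hℱ, α, fun n' r' s' k' F hF Fp hFp => ?_⟩
  -- It suffices to treat the approximation `Ep` obtained by reducing the model, since any other
  -- presentation and approximation agree with it for almost all `p`.
  refine PairData.Presents.eventually_satisfies hΦ hF hE hFp happrox ?_
  filter_upwards [hμ, happrox.eventually_isDefined hE.isDefined] with p hp hdef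
  obtain ⟨hpD, hpμ, ψ, hψ⟩ := hp
  obtain ⟨hprime, -⟩ := hdef
  rw [hEp p ψ hψ] at hprime ⊢
  exact M.satisfies f hΦ (μ p) (hM _ hpD) p hpμ ψ hden hgen hnum hprime

end

end DenseType

theorem mainTheorem6 {R : Type*} [CommRing R] [Algebra ℂ R] [IsLocalRing R] [IsReduced R]
    [Algebra.EssFiniteType ℂ R] (𝔞 : Ideal R) (h𝔞 : MeetsRCirc 𝔞) (t : ℝ) (ht : 0 < t) :
    (IsOfDenseType (fun _ _ _ 𝔟 => IsSharplyFPure 𝔟 t) 𝔞 →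
      ∃ (ℱ : Ultrafilter Nat.Primes) (_ : (ℱ : Filter Nat.Primes) ≤ Filter.cofinite)
        (α : UltraProd ℱ FBar ≃+* ℂ),
        ApproximationsSatisfy (fun _ _ _ 𝔟 => IsSharplyFPure 𝔟 t) 𝔞 ℱ α) ∧
    (IsOfDenseType (fun _ _ _ 𝔟 => IsSharplyFInjective 𝔟 t) 𝔞 →
      ∃ (ℱ : Ultrafilter Nat.Primes) (_ : (ℱ : Filter Nat.Primes) ≤ Filter.cofinite)
        (α : UltraProd ℱ FBar ≃+* ℂ),
        ApproximationsSatisfy (fun _ _ _ 𝔟 => IsSharplyFInjective 𝔟 t) 𝔞 ℱ α) :=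
  ⟨fun h => h.exists_approximationsSatisfy (ascends_isSharplyFPure t),
    fun h => h.exists_approximationsSatisfy (ascends_isSharplyFInjective t)⟩
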